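/- Let $\Sigma=\{\mathtt L,\mathtt R\}$. For a string $s=c_1\dots c_N$ over $\Sigma$ let $h_s(i)$ be the number of $\mathtt L$'s minus the number of $\mathtt R$'s in $c_1\dots c_i$; for strings of equal length write $s>s'$ if $h_s(i)>h_{s'}(i)$ at the first index $i$ where $h_s$ and $h_{s'}$ differ. The alternate string of $s$ is $\alpha(s)=c_1c_Nc_2c_{N-1}\cdots$. A permutation diagram of a graph $G=(V,E)$ with $n$ vertices is a pair $P=(\pi_1,\pi_2)$ of bijections $V\to\{1,\dots,n\}$ such that $uv\in E$ iff $(\pi_1(u)-\pi_1(v))(\pi_2(u)-\pi_2(v))<0$. A bipartite permutation graph is a bipartite graph that has a permutation diagram. The string representation of $P$ is $s(P)=x_1y_1x_2y_2\dots x_ny_n\in\Sigma^{2n}$, where $x_i=\mathtt L$ if $i<\pi_2(\pi_1^{-1}(i))$ and $x_i=\mathtt R$ otherwise, and $y_i=\mathtt R$ if $i>\pi_1(\pi_2^{-1}(i))$ and $y_i=\mathtt L$ otherwise. With $\overline\pi(v)=n+1-\pi(v)$, put $P^{\mathrm V}=(\pi_2,\pi_1)$, $P^{\mathrm H}=(\overline{\pi_1},\overline{\pi_2})$,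 $P^{\mathrm R}=(\overline{\pi_2},\overline{\pi_1})$. The representation $s(P)$ is canonical if $s(P)\ge s(P^{\mathrm V})$, $s(P)\ge s(P^{\mathrm H})$ and $s(P)\ge s(P^{\mathrm R})$. A BDD for strings of length $\ell\ge 1$ consists of finitely many nodes at levels $1,\dots,\ell$, exactly one of them (the root) at level $1$, together with a $0$-terminal and a $1$-terminal; every node at level $i$ has an $\mathtt L$-arc and an $\mathtt R$-arc, each leading to a node at level $i+1$ or to a terminal, and only to a terminal if $i=\ell$. It accepts a string of length $\ell$ if following the arcs labelled by its letters from the root leads to the $1$-terminal. A BDD for strings of length $2n$ represents a class of $n$-vertex graphs if the strings of length $2n$ that it accepts are exactly the strings $\alpha(s)$, where $s$ is a canonical string representation of a member of the class. Running time is measured on a unit-cost word RAM with words of $O(\log n)$ bits (respectively $O(\log (n+m))$ bits) on input $n$ (respectively $n,m$); the output is the table of the nodes with their levels and arcs. **Theorem.** Let $n\ge 1$. 1. Every connected bipartite permutation graph with $n$ vertices has a canonical string representation, and canonical string representations of two such graphs are equal if and only if the graphs are isomorphic. 2. If $P$ is a permutation diagram of a connected bipartite permutation graph with $n$ vertices,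 then the graph has exactly $\frac12\sum_{i=1}^{n}h_{s(P)}(2i)$ edges. 3. A BDD with $O(n^3)$ nodes that represents all connected bipartite permutation graphs with $n$ vertices can be constructed from $n$ in $O(n^3)$ time. 4. For every $m\ge 0$, a BDD with $O(n^3\max(m,1))$ nodes that represents all connected bipartite permutation graphs with $n$ vertices and $m$ edges can be constructed from $n$ and $m$ in $O(n^3\max(m,1))$ time; this is $O(n^3m)$ for $m\ge1$. In 3 and 4 a single program works for all inputs, and the implied constants are absolute. -/

import Mathlib

/-! ### Strings over the alphabet `{L, R}` -/

/-- The binary alphabet. -/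
inductive Letter : Type
  | L
  | R
  deriving DecidableEq

/-- The height `h_s(i)`: occurrences of `L` minus occurrences of `R` among the first `i` letters. -/
def heightAt (s : List Letter) (i : ℕ) : ℤ :=
  ((s.take i).count Letter.L : ℤ) - ((s.take i).count Letter.R : ℤ)

/-- `s` is larger than `s'` (used for strings of the same length): at the first index where the
height functions differ, `s` is higher. -/
def Larger (s s' : List Letter) : Prop :=
  ∃ i, 1 ≤ i ∧ i ≤ s.length ∧ (∀ j, j < i → heightAt s j = heightAt s' j) ∧
    heightAt s' i < heightAt s i

/-- `s ≥ s'`. -/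
def LargerEq (s s' : List Letter) : Prop :=
  Larger s s' ∨ s = s'

/-- The alternate string `c₁ cₙ c₂ cₙ₋₁ …` of `c₁ c₂ … cₙ`. -/
def alternate (s : List Letter) : List Letter :=
  List.ofFn fun k : Fin s.length =>
    if k.val % 2 = 0 then s[k.val / 2]'(by omega) else s[s.length - 1 - k.val / 2]'(by omega)

/-! ### Permutation diagrams and bipartite permutation graphs -/

/-- A pair `(π₁, π₂)` of bijections from `V` onto the `n` positions of each of the two lines.
Positions are numbered `0, …, n - 1`. -/
structure PermDiagram (V : Type*) (n : ℕ) where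
  π₁ : V ≃ Fin n
  π₂ : V ≃ Fin n

namespace PermDiagram

variable {V : Type*} {n : ℕ}

/-- `P` is a permutation diagram of `G`: adjacency is crossing of segments. -/
def IsDiagramOf (P : PermDiagram V n) (G : SimpleGraph V) : Prop :=
  ∀ u v : V, G.Adj u v ↔
    (((P.π₁ u : ℕ) : ℤ) - ((P.π₁ v : ℕ) : ℤ)) * (((P.π₂ u : ℕ) : ℤ) - ((P.π₂ v : ℕ) : ℤ)) < 0

/-- The letter `x_i` of the upper line. -/
def xLetter (P : PermDiagram V n) (i : Fin n) : Letter :=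
  if i < P.π₂ (P.π₁.symm i) then Letter.L else Letter.R

/-- The letter `y_i` of the lower line. -/
def yLetter (P : PermDiagram V n) (i : Fin n) : Letter :=
  if P.π₁ (P.π₂.symm i) < i then Letter.R else Letter.L

/-- The string representation `s(P) = x₁ y₁ x₂ y₂ … xₙ yₙ`. -/
def str (P : PermDiagram V n) : List Letter :=
  (List.ofFn fun i : Fin n => [P.xLetter i, P.yLetter i]).flatten

/-- `P^V = (π₂, π₁)`. -/
def flipV (P : PermDiagram V n) : PermDiagram V n :=
  ⟨P.π₂, P.π₁⟩

/-- `P^H`: both lines are reversed. -/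
def flipH (P : PermDiagram V n) : PermDiagram V n :=
  ⟨P.π₁.trans Fin.revPerm, P.π₂.trans Fin.revPerm⟩

/-- `P^R`: the lines are exchanged and reversed. -/
def flipR (P : PermDiagram V n) : PermDiagram V n :=
  ⟨P.π₂.trans Fin.revPerm, P.π₁.trans Fin.revPerm⟩

/-- The string representation of `P` is canonical. -/
def Canonical (P : PermDiagram V n) : Prop :=
  LargerEq P.str P.flipV.str ∧ LargerEq P.str P.flipH.str ∧ LargerEq P.str P.flipR.str

end PermDiagram

/-- Connected bipartite permutation graphs on `n` vertices. -/
def IsConnBipPerm {n : ℕ} (G : SimpleGraph (Fin n)) : Prop :=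
  G.Connected ∧ G.IsBipartite ∧ ∃ P : PermDiagram (Fin n) n, P.IsDiagramOf G

/-- `s` is a canonical string representation of `G`. -/
def IsCanonicalRep {n : ℕ} (G : SimpleGraph (Fin n)) (s : List Letter) : Prop :=
  ∃ P : PermDiagram (Fin n) n, P.IsDiagramOf G ∧ P.Canonical ∧ P.str = s

/-! ### Binary decision diagrams -/

/-- A BDD for strings of length `ℓ`. The nonterminal nodes are `Fin size`, at levels `1, …, ℓ`;
the terminals are `Sum.inr false` (the `0`-terminal) and `Sum.inr true` (the `1`-terminal). The root
is the only node at level `1`, and an arc leads to the next level or to a terminal. -/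
structure BDD (ℓ : ℕ) where
  size : ℕ
  level : Fin size → ℕ
  root : Fin size
  arc : Fin size → Letter → Fin size ⊕ Bool
  one_le_level : ∀ u, 1 ≤ level u
  level_le : ∀ u, level u ≤ ℓ
  level_eq_one_iff : ∀ u, level u = 1 ↔ u = root
  level_arc : ∀ u c v, arc u c = Sum.inl v → level v = level u + 1

namespace BDD

variable {ℓ : ℕ}

/-- Follow the arcs labelled by the letters of a string; `true` if the `1`-terminal is reached. The
letters left over when a terminal is reached are ignored. -/
def follow (D : BDD ℓ) : Fin D.size ⊕ Bool → List Letter → Bool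
  | Sum.inr b, _ => b
  | Sum.inl _, [] => false
  | Sum.inl u, c :: w => D.follow (D.arc u c) w

/-- `D` accepts the string `w` (meant for strings of length `ℓ`). -/
def Accepts (D : BDD ℓ) (w : List Letter) : Prop :=
  D.follow (Sum.inl D.root) w = true

/-- `D` represents the class `𝒢` of graphs with `n` vertices: the strings of length `2n` that it
accepts are exactly the alternate strings of the canonical representations of members of `𝒢`. -/
def Represents {n : ℕ} (D : BDD (2 * n)) (𝒢 : Set (SimpleGraph (Fin n))) : Prop :=
  ∀ w : List Letter, w.length = 2 * n →
    (D.Accepts w ↔ ∃ G ∈ 𝒢, ∃ s, IsCanonicalRep G s ∧ w = alternate s)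

end BDD

/-! ### A word RAM with a step count

The machine has registers and a memory, both holding natural numbers. Programs are structured; each
instruction and each evaluation of a test is one step. Memory is addressed indirectly, through
registers. No word may ever reach the bound `W` (that is, words have about `log₂ W` bits). -/

/-- A machine state. -/
structure RAMState where
  reg : ℕ → ℕ
  mem : ℕ → ℕ

/-- All words of the state are smaller than `W`. -/
def RAMState.Bounded (W : ℕ) (σ : RAMState) : Prop :=
  (∀ r, σ.reg r < W) ∧ ∀ a, σ.mem a < W

/-- Instructions; the arguments are names of registers, except for the constant `k`. -/
inductive RAMInstr : Type
  | const (d k : ℕ)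
  | copy (d a : ℕ)
  | add (d a b : ℕ)
  | sub (d a b : ℕ)
  | mul (d a b : ℕ)
  | load (d a : ℕ)
  | store (a b : ℕ)

/-- The effect of an instruction. Subtraction is truncated; `load d a` reads the memory word whose
address is in register `a`, and `store a b` writes register `b` to the address in register `a`. -/
def RAMInstr.apply : RAMInstr → RAMState → RAMState
  | .const d k, σ => ⟨Function.update σ.reg d k, σ.mem⟩
  | .copy d a, σ => ⟨Function.update σ.reg d (σ.reg a), σ.mem⟩
  | .add d a b, σ => ⟨Function.update σ.reg d (σ.reg a + σ.reg b), σ.mem⟩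
  | .sub d a b, σ => ⟨Function.update σ.reg d (σ.reg a - σ.reg b), σ.mem⟩
  | .mul d a b, σ => ⟨Function.update σ.reg d (σ.reg a * σ.reg b), σ.mem⟩
  | .load d a, σ => ⟨Function.update σ.reg d (σ.mem (σ.reg a)), σ.mem⟩
  | .store a b, σ => ⟨σ.reg, Function.update σ.mem (σ.reg a) (σ.reg b)⟩

/-- Tests comparing two registers. -/
inductive RAMTest : Type
  | lt (a b : ℕ)
  | eq (a b : ℕ)

/-- The meaning of a test. -/
def RAMTest.Holds : RAMTest → RAMState → Prop
  | .lt a b, σ => σ.reg a < σ.reg b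
  | .eq a b, σ => σ.reg a = σ.reg b

/-- Programs. -/
inductive RAMProg : Type
  | skip
  | instr (i : RAMInstr)
  | seq (p q : RAMProg)
  | ite (c : RAMTest) (p q : RAMProg)
  | while (c : RAMTest) (p : RAMProg)

/-- `Exec W p σ t σ'`: started in `σ`, the program `p` halts in `σ'` after exactly `t` steps, and
every word stays below `W`. -/
inductive RAMProg.Exec (W : ℕ) : RAMProg → RAMState → ℕ → RAMState → Prop
  | skip (σ : RAMState) : Exec W .skip σ 1 σ
  | instr (i : RAMInstr) (σ : RAMState) (h : (i.apply σ).Bounded W) :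
      Exec W (.instr i) σ 1 (i.apply σ)
  | seq {p q : RAMProg} {σ σ' σ'' : RAMState} {t t' : ℕ}
      (hp : Exec W p σ t σ') (hq : Exec W q σ' t' σ'') : Exec W (.seq p q) σ (t + t') σ''
  | ite_true {c : RAMTest} {p q : RAMProg} {σ σ' : RAMState} {t : ℕ}
      (hc : c.Holds σ) (hp : Exec W p σ t σ') : Exec W (.ite c p q) σ (t + 1) σ'
  | ite_false {c : RAMTest} {p q : RAMProg} {σ σ' : RAMState} {t : ℕ}
      (hc : ¬ c.Holds σ) (hq : Exec W q σ t σ') : Exec W (.ite c p q) σ (t + 1) σ'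
  | while_true {c : RAMTest} {p : RAMProg} {σ σ' σ'' : RAMState} {t t' : ℕ}
      (hc : c.Holds σ) (hp : Exec W p σ t σ') (hw : Exec W (.while c p) σ' t' σ'') :
      Exec W (.while c p) σ (t + t' + 1) σ''
  | while_false {c : RAMTest} {p : RAMProg} {σ : RAMState}
      (hc : ¬ c.Holds σ) : Exec W (.while c p) σ 1 σ

/-- The initial state with inputs `a`, `b` in registers `0`, `1` and zeros elsewhere. -/
def RAMState.init (a b : ℕ) : RAMState :=
  ⟨fun r => if r = 0 then a else if r = 1 then b else 0, fun _ => 0⟩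

/-- The word that encodes the target of an arc: `0` and `1` for the terminals, `u + 2` for the
node `u`. -/
def BDD.targetWord {ℓ : ℕ} (D : BDD ℓ) : Fin D.size ⊕ Bool → ℕ
  | Sum.inr false => 0
  | Sum.inr true => 1
  | Sum.inl u => u.val + 2

/-- The state `σ` holds the BDD `D`: register `0` holds the number of nodes, register `1` the address
of a table, register `2` the root, and the table has, for each node, three consecutive words: its
level, the target of its `L`-arc, the target of its `R`-arc. -/
def RAMState.Holds {ℓ : ℕ} (σ : RAMState) (D : BDD ℓ) : Prop :=
  σ.reg 0 = D.size ∧ σ.reg 2 = D.root.val ∧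
    ∀ u : Fin D.size,
      σ.mem (σ.reg 1 + 3 * u.val) = D.level u ∧
      σ.mem (σ.reg 1 + 3 * u.val + 1) = D.targetWord (D.arc u Letter.L) ∧
      σ.mem (σ.reg 1 + 3 * u.val + 2) = D.targetWord (D.arc u Letter.R)

/-- On inputs `a`, `b`, with words smaller than `W`, the program `p` constructs the BDD `D` and halts
within `T` steps. -/
def RAMProg.Constructs {ℓ : ℕ} (p : RAMProg) (W a b T : ℕ) (D : BDD ℓ) : Prop :=
  ∃ (t : ℕ) (σ : RAMState), p.Exec W (RAMState.init a b) t σ ∧ t ≤ T ∧ σ.Holds D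

/-! Uniqueness. In a diagram of a connected bipartite graph with at least two vertices, crossing
segments run in opposite directions and no segment is vertical (`IsDiagramOf.proper`); otherwise
counting positions yields three pairwise crossing segments. Direction is therefore a 2-colouring of
a connected graph, fixed up to exchanging the lines. Of two non-adjacent vertices one lies to the
left of the other, and this order persists when one of them moves along an edge neither end of which
is adjacent to the other. Such moves link all non-adjacent pairs of opposite direction, so two
diagrams with equal directions agree on all of these pairs or on none (`agree_or`). Directions and
these comparisons determine the letters. Hence all strings of one graph are flips of each other
(`str_eq_flip`), and the largest is the canonical one. Conversely, the permutation of a diagram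
increases on the rightward and on the leftward segments, so the letters determine it, and with it
the graph up to isomorphism.

Edges. Half the height after `i` pairs counts the segments that start before cut `i` on the upper
line and end behind it on the lower line. Summing over all cuts adds up the lengths of the rightward
segments. The length of such a segment is the degree of its vertex (`Proper.degree_eq`), and the
rightward vertices form one colour class.

Automaton. For `n ≥ 2` the strings of diagrams are exactly those whose heights at even positions are
positive inside and zero at the end (`IsDiagramOf.validHeights`, `ValidHeights.exists_diagram`). The
alternate string delivers the letters from both ends inwards, in groups of four. Reversal and
rotation are involutions, so the outer half decides the comparisons with those two flips
(`lexRange_of_symm`), and a bounded control suffices for all comparisons. The heights seen from both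
ends have to match in the middle. A state is thus a control, two heights at most `n` and an edge
count at most `m + 1`, which gives a constant times `n ^ 2 * max m 1` states on each of `2 * n`
levels. Edges of weight zero make the count trivial and give the bound `n ^ 3` for the class without
a prescribed number of edges.

Program. Nodes are numbered in mixed radix by level, heights, edge count and control. For a fixed
control, each word of the table is an arithmetic expression of constant size in the counters. One
loop writes, for each setting of the counters, the words of all controls, and then increments the
counters with carries; all values stay polynomial in `n + m`. -/

/-! ### Lexicographic comparison of strings -/

namespace Letter

/-- The other letter. -/
def swap : Letter → Letter
  | L => R
  | R => L

/-- The contribution of a letter to the height. -/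
def val : Letter → ℤ
  | L => 1
  | R => -1

/-- `1` if `a` is `L` and `b` is `R`, `-1` in the opposite case, `0` if the letters agree. -/
def cmp : Letter → Letter → SignType
  | L, R => 1
  | R, L => -1
  | _, _ => 0

instance : Fintype Letter := ⟨{L, R}, by rintro (_ | _) <;> decide⟩

theorem cmp_eq_zero {a b : Letter} : cmp a b = 0 ↔ a = b := by
  cases a <;> cases b <;> decide

theorem cmp_neg (a b : Letter) : cmp b a = - cmp a b := by
  cases a <;> cases b <;> decide

end Letter

/-- Lexicographic combination of the outcomes of two comparisons. -/
def lexThen (a b : SignType) : SignType := if a = 0 then b else a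

@[simp] theorem lexThen_zero_left (a : SignType) : lexThen 0 a = a := by simp [lexThen]

@[simp] theorem lexThen_zero_right (a : SignType) : lexThen a 0 = a := by
  revert a; decide

theorem lexThen_assoc (a b c : SignType) :
    lexThen (lexThen a b) c = lexThen a (lexThen b c) := by
  revert a b c; decide

theorem lexThen_eq_zero {a b : SignType} : lexThen a b = 0 ↔ a = 0 ∧ b = 0 := by
  revert a b; decide

theorem lexThen_neg (a b : SignType) : lexThen (-a) (-b) = - lexThen a b := by
  revert a b; decide

/-- Lexicographic comparison of two strings of the same length. -/
def lexSign : List Letter → List Letter → SignType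
  | a :: s, b :: s' => lexThen (Letter.cmp a b) (lexSign s s')
  | _, _ => 0

theorem lexSign_append {s s' t t' : List Letter} (h : s.length = s'.length) :
    lexSign (s ++ t) (s' ++ t') = lexThen (lexSign s s') (lexSign t t') := by
  induction s generalizing s' with
  | nil => cases s' <;> simp_all [lexSign]
  | cons a s ih =>
    cases s' with
    | nil => simp at h
    | cons b s' => simp only [List.cons_append, lexSign, ih (by simpa using h), lexThen_assoc]

theorem lexSign_neg (s s' : List Letter) : lexSign s' s = - lexSign s s' := by
  induction s generalizing s' with
  | nil => cases s' <;> simp [lexSign]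
  | cons a s ih =>
    cases s' with
    | nil => simp [lexSign]
    | cons b s' => simp only [lexSign, ih s', Letter.cmp_neg a b, lexThen_neg]

theorem lexSign_eq_zero {s s' : List Letter} (h : s.length = s'.length) :
    lexSign s s' = 0 ↔ s = s' := by
  induction s generalizing s' with
  | nil => cases s' <;> simp_all [lexSign]
  | cons a s ih =>
    cases s' with
    | nil => simp at h
    | cons b s' =>
      simp only [lexSign, lexThen_eq_zero, Letter.cmp_eq_zero, ih (by simpa using h : _ = _),
        List.cons.injEq]

@[simp] theorem heightAt_zero (s : List Letter) : heightAt s 0 = 0 := by simp [heightAt]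

theorem heightAt_cons (a : Letter) (s : List Letter) (i : ℕ) :
    heightAt (a :: s) (i + 1) = a.val + heightAt s i := by
  cases a <;> simp [heightAt, Letter.val] <;> ring

theorem larger_cons {a b : Letter} {s s' : List Letter} :
    Larger (a :: s) (b :: s') ↔ (a = .L ∧ b = .R) ∨ (a = b ∧ Larger s s') := by
  constructor
  · rintro ⟨i, h1, h2, h3, h4⟩
    obtain ⟨i, rfl⟩ : ∃ k, i = k + 1 := ⟨i - 1, by omega⟩
    rw [heightAt_cons, heightAt_cons] at h4
    rcases Nat.eq_zero_or_pos i with rfl | hi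
    · left; cases a <;> cases b <;> simp_all [Letter.val]
    · right
      have h5 := h3 1 (by omega)
      rw [heightAt_cons a s 0, heightAt_cons b s' 0] at h5
      have hab : a = b := by cases a <;> cases b <;> simp_all [Letter.val]
      subst hab
      refine ⟨rfl, i, hi, by simpa using h2, fun j hj => ?_, by linarith⟩
      have := h3 (j + 1) (by omega)
      rw [heightAt_cons, heightAt_cons] at this
      linarith
  · rintro (⟨rfl, rfl⟩ | ⟨rfl, i, h1, h2, h3, h4⟩)
    · refine ⟨1, le_rfl, by simp, fun j hj => ?_, ?_⟩
      · obtain rfl : j = 0 := by omega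
        simp
      · rw [heightAt_cons _ s 0, heightAt_cons _ s' 0]; simp [Letter.val]
    · refine ⟨i + 1, by omega, by simpa using h2, fun j hj => ?_, ?_⟩
      · cases j with
        | zero => simp
        | succ j => rw [heightAt_cons, heightAt_cons, h3 j (by omega)]
      · rw [heightAt_cons, heightAt_cons]; linarith

theorem larger_iff_lexSign {s s' : List Letter} (h : s.length = s'.length) :
    Larger s s' ↔ lexSign s s' = 1 := by
  induction s generalizing s' with
  | nil =>
    have : ¬ Larger [] s' := by
      rintro ⟨i, h1, h2, -⟩
      simp at h2
      omega
    simp [lexSign, this]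
  | cons a s ih =>
    cases s' with
    | nil => simp at h
    | cons b s' =>
      rw [larger_cons, ih (by simpa using h), lexSign]
      cases a <;> cases b <;> simp [Letter.cmp, lexThen]

theorem largerEq_iff_lexSign {s s' : List Letter} (h : s.length = s'.length) :
    LargerEq s s' ↔ lexSign s s' ≠ -1 := by
  rw [LargerEq, larger_iff_lexSign h, ← lexSign_eq_zero h]
  generalize lexSign s s' = a
  revert a; decide

theorem LargerEq.antisymm {s s' : List Letter} (h : s.length = s'.length) (h1 : LargerEq s s')
    (h2 : LargerEq s' s) : s = s' := by
  rw [largerEq_iff_lexSign h] at h1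
  rw [largerEq_iff_lexSign h.symm, lexSign_neg] at h2
  rw [← lexSign_eq_zero h]
  revert h1 h2
  generalize lexSign s s' = a
  revert a; decide

/-- A string read as a binary number with `L` as the digit one. -/
def binaryValue : List Letter → ℕ
  | [] => 0
  | a :: s => (if a = .L then 2 ^ s.length else 0) + binaryValue s

theorem binaryValue_lt (s : List Letter) : binaryValue s < 2 ^ s.length := by
  induction s with
  | nil => simp [binaryValue]
  | cons a s ih =>
    simp only [binaryValue, List.length_cons, pow_succ]
    split_ifs <;> omega

theorem larger_iff_binaryValue {s s' : List Letter} (h : s.length = s'.length) :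
    Larger s s' ↔ binaryValue s' < binaryValue s := by
  induction s generalizing s' with
  | nil =>
    rw [larger_iff_lexSign h]
    simp [lexSign, binaryValue]
  | cons a s ih =>
    cases s' with
    | nil => simp at h
    | cons b s' =>
      have h' : s.length = s'.length := by simpa using h
      have h1 := binaryValue_lt s
      have h2 := binaryValue_lt s'
      rw [larger_cons, ih h', binaryValue, binaryValue, h']
      rw [h'] at h1
      cases a <;> cases b <;> simp <;> omega

theorem largerEq_iff_binaryValue {s s' : List Letter} (h : s.length = s'.length) :
    LargerEq s s' ↔ binaryValue s' ≤ binaryValue s := by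
  have h1 : LargerEq s s' ↔ ¬ Larger s' s := by
    rw [largerEq_iff_lexSign h, larger_iff_lexSign h.symm, lexSign_neg s s']
    generalize lexSign s s' = a
    revert a; decide
  rw [h1, larger_iff_binaryValue h.symm, not_lt]

/-- Lexicographic combination of `f 0, …, f (k - 1)`. -/
def lexRange (f : ℕ → SignType) : ℕ → SignType
  | 0 => 0
  | k + 1 => lexThen (lexRange f k) (f k)

theorem lexRange_add (f : ℕ → SignType) (j k : ℕ) :
    lexRange f (j + k) = lexThen (lexRange f j) (lexRange (fun i => f (j + i)) k) := by
  induction k with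
  | zero => simp [lexRange]
  | succ k ih => rw [← Nat.add_assoc, lexRange, ih, lexThen_assoc]; rfl

theorem lexRange_succ' (f : ℕ → SignType) (k : ℕ) :
    lexRange f (k + 1) = lexThen (f 0) (lexRange (fun i => f (i + 1)) k) := by
  rw [Nat.add_comm, lexRange_add]
  simp [lexRange, Nat.add_comm]

theorem lexRange_eq_zero {f : ℕ → SignType} {k : ℕ} :
    lexRange f k = 0 ↔ ∀ i < k, f i = 0 := by
  induction k with
  | zero => simp [lexRange]
  | succ k ih => rw [lexRange, lexThen_eq_zero, ih, Nat.forall_lt_succ_right]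

theorem lexRange_congr {f g : ℕ → SignType} {k : ℕ} (h : ∀ i < k, f i = g i) :
    lexRange f k = lexRange g k := by
  induction k with
  | zero => rfl
  | succ k ih =>
    rw [lexRange, lexRange, ih fun i hi => h i (by omega), h k (by omega)]

/-- If the vanishing of `f` is symmetric, the first half decides. -/
theorem lexRange_of_symm {f : ℕ → SignType} {n k : ℕ} (hk : k ≤ n) (hn : n ≤ 2 * k)
    (hf : ∀ i < n, f i = 0 → f (n - 1 - i) = 0) : lexRange f n = lexRange f k := by
  obtain ⟨d, rfl⟩ := Nat.exists_eq_add_of_le hk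
  rw [lexRange_add]
  by_cases h : lexRange f k = 0
  · rw [lexRange_eq_zero] at h
    have : lexRange (fun i => f (k + i)) d = 0 := by
      rw [lexRange_eq_zero]
      intro i hi
      -- The mirror image of position `k + i` lies in the first half because `n ≤ 2 * k`; there
      -- everything vanishes, and `hf` carries this back.
      have := hf (k + d - 1 - (k + i)) (by omega) (h _ (by omega))
      rwa [show k + d - 1 - (k + d - 1 - (k + i)) = k + i by omega] at this
    rw [this, lexThen_zero_right]
  · simp [lexThen, h]

/-! ### Strings made of pairs of letters -/

/-- The string `x₀ y₀ x₁ y₁ … xₙ₋₁ yₙ₋₁`. -/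
def pairStr (x y : ℕ → Letter) (n : ℕ) : List Letter :=
  (List.range n).flatMap fun i => [x i, y i]

theorem pairStr_succ (x y : ℕ → Letter) (n : ℕ) :
    pairStr x y (n + 1) = pairStr x y n ++ [x n, y n] := by
  simp [pairStr, List.range_succ]

@[simp] theorem length_pairStr (x y : ℕ → Letter) (n : ℕ) : (pairStr x y n).length = 2 * n := by
  induction n with
  | zero => rfl
  | succ n ih => rw [pairStr_succ, List.length_append, ih]; simp; ring

theorem lexSign_pairStr (x y x' y' : ℕ → Letter) (n : ℕ) :
    lexSign (pairStr x y n) (pairStr x' y' n) =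
      lexRange (fun i => lexThen (Letter.cmp (x i) (x' i)) (Letter.cmp (y i) (y' i))) n := by
  induction n with
  | zero => rfl
  | succ n ih =>
    rw [pairStr_succ, pairStr_succ, lexSign_append (by simp), ih, lexRange]
    simp [lexSign]

theorem getElem?_pairStr (x y : ℕ → Letter) (n k : ℕ) (h : k < 2 * n) :
    (pairStr x y n)[k]? = some (if k % 2 = 0 then x (k / 2) else y (k / 2)) := by
  induction n with
  | zero => omega
  | succ n ih =>
    rw [pairStr_succ]
    by_cases hk : k < 2 * n
    · rw [List.getElem?_append_left (by simpa using hk), ih hk]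
    · rw [List.getElem?_append_right (by simpa using hk), length_pairStr]
      obtain rfl | rfl : k = 2 * n ∨ k = 2 * n + 1 := by omega
      · simp
      · have : (2 * n + 1) / 2 = n := by omega
        simp [this]

/-- Half of the height of `x₀ y₀ x₁ y₁ …` after `i` pairs. -/
def halfHeight (x y : ℕ → Letter) (i : ℕ) : ℤ :=
  ∑ j ∈ Finset.range i, ((if x j = .L then 1 else 0) - (if y j = .R then 1 else 0) : ℤ)

/-- A pair changes the height by 2, 0 or -2, namely by twice the indicator of `x = L` minus the
indicator of `y = R`. -/
theorem heightAt_pairStr (x y : ℕ → Letter) {n i : ℕ} (h : i ≤ n) :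
    heightAt (pairStr x y n) (2 * i) = 2 * halfHeight x y i := by
  have h1 : (pairStr x y n).take (2 * i) = pairStr x y i := by
    obtain ⟨d, rfl⟩ := Nat.exists_eq_add_of_le h
    rw [pairStr, List.range_add, List.flatMap_append,
      List.take_append_of_le_length (by simpa [pairStr] using (length_pairStr x y i).ge),
      List.take_of_length_le (by simpa [pairStr] using (length_pairStr x y i).le)]
    rfl
  rw [heightAt, h1]
  clear h h1
  induction i with
  | zero => simp [pairStr, halfHeight]
  | succ i ih =>
    rw [halfHeight, Finset.sum_range_succ, ← halfHeight, mul_add, ← ih, pairStr_succ,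
      List.count_append, List.count_append]
    cases x i <;> cases y i <;> simp <;> ring

/-! ### Permutation diagrams -/

namespace PermDiagram

variable {n : ℕ}

/-- The upper letters as a function on the natural numbers. -/
def upper (P : PermDiagram (Fin n) n) (i : ℕ) : Letter :=
  -- The value beyond the last position is arbitrary; all comparisons and heights use positions
  -- below `n` only.
  if h : i < n then P.xLetter ⟨i, h⟩ else .L

/-- The lower letters as a function on the natural numbers. -/
def lower (P : PermDiagram (Fin n) n) (i : ℕ) : Letter :=
  if h : i < n then P.yLetter ⟨i, h⟩ else .L

theorem str_eq_pairStr (P : PermDiagram (Fin n) n) : P.str = pairStr P.upper P.lower n := by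
  have : (List.ofFn fun i : Fin n => [P.xLetter i, P.yLetter i]) =
      (List.range n).map fun i => [P.upper i, P.lower i] := by
    apply List.ext_getElem
    · simp
    · intro i h1 h2
      have hi : i < n := by simpa using h1
      simp [upper, lower, hi]
  rw [str, this, pairStr, List.flatMap_def]

/-- The segment of `v` runs from left to right. -/
def Rightward (P : PermDiagram (Fin n) n) (v : Fin n) : Prop := P.π₁ v < P.π₂ v

theorem upper_eq_L (P : PermDiagram (Fin n) n) (v : Fin n) :
    P.upper (P.π₁ v) = .L ↔ P.Rightward v := by
  simp [upper, xLetter, Rightward]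

theorem lower_eq_R (P : PermDiagram (Fin n) n) (v : Fin n) :
    P.lower (P.π₂ v) = .R ↔ P.Rightward v := by
  simp [lower, yLetter, Rightward]

theorem isDiagramOf_iff {P : PermDiagram (Fin n) n} {G : SimpleGraph (Fin n)} :
    P.IsDiagramOf G ↔ ∀ u v, G.Adj u v ↔
      (P.π₁ u < P.π₁ v ∧ P.π₂ v < P.π₂ u) ∨ (P.π₁ v < P.π₁ u ∧ P.π₂ u < P.π₂ v) := by
  refine forall_congr' fun u => forall_congr' fun v => iff_congr Iff.rfl ?_
  rw [mul_neg_iff, sub_pos, sub_neg, sub_pos, sub_neg]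
  simp only [Fin.lt_def, Nat.cast_lt]
  tauto

theorem IsDiagramOf.flipV {P : PermDiagram (Fin n) n} {G : SimpleGraph (Fin n)}
    (h : P.IsDiagramOf G) : P.flipV.IsDiagramOf G := by
  rw [isDiagramOf_iff] at *
  intro u v
  rw [h]
  simp only [PermDiagram.flipV]
  tauto

theorem IsDiagramOf.flipH {P : PermDiagram (Fin n) n} {G : SimpleGraph (Fin n)}
    (h : P.IsDiagramOf G) : P.flipH.IsDiagramOf G := by
  rw [isDiagramOf_iff] at *
  intro u v
  rw [h]
  simp only [PermDiagram.flipH, Equiv.trans_apply, Fin.revPerm_apply, Fin.rev_lt_rev]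
  tauto

theorem IsDiagramOf.flipR {P : PermDiagram (Fin n) n} {G : SimpleGraph (Fin n)}
    (h : P.IsDiagramOf G) : P.flipR.IsDiagramOf G :=
  h.flipV.flipH

/-! ### Directions of segments in diagrams of connected bipartite graphs -/

/-- Crossing segments run in opposite directions, and no segment is vertical. -/
structure Proper (P : PermDiagram (Fin n) n) : Prop where
  cross : ∀ u v, P.π₁ u < P.π₁ v → P.π₂ v < P.π₂ u → P.π₁ u < P.π₂ u ∧ P.π₂ v < P.π₁ v
  ne : ∀ v, P.π₁ v ≠ P.π₂ v

theorem Proper.flipV {P : PermDiagram (Fin n) n} (h : P.Proper) : P.flipV.Proper where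
  cross u v h1 h2 := (h.cross v u h2 h1).symm
  ne v := (h.ne v).symm

theorem Proper.flipH {P : PermDiagram (Fin n) n} (h : P.Proper) : P.flipH.Proper where
  cross u v h1 h2 := by
    simp only [PermDiagram.flipH, Equiv.trans_apply, Fin.revPerm_apply, Fin.rev_lt_rev] at *
    exact (h.cross v u h1 h2).symm
  ne v := by simpa [PermDiagram.flipH] using h.ne v

theorem card_filter_val_lt (π : Fin n ≃ Fin n) {k : ℕ} (hk : k ≤ n) :
    (Finset.univ.filter fun v => (π v : ℕ) < k).card = k := by
  have : (Finset.univ.filter fun v => (π v : ℕ) < k).card =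
      (Finset.univ.filter fun j : Fin n => (j : ℕ) < k).card := by
    refine Finset.card_bij (fun v _ => π v) (by simp) (by simp) fun j hj => ⟨π.symm j, ?_, by simp⟩
    simpa using hj
  rw [this, Fin.card_filter_val_lt, min_eq_right hk]

/-- If at most as many vertices start before `k` as end before `l`, and one of the former does not
end before `l`, then one of the latter does not start before `k`. -/
theorem exists_of_le (π ρ : Fin n ≃ Fin n) {k l : ℕ} (hkl : k ≤ l) (hl : l ≤ n) {u : Fin n}
    (hu : (π u : ℕ) < k) (hu' : l ≤ ρ u) : ∃ w, (ρ w : ℕ) < l ∧ k ≤ π w := by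
  by_contra! h
  -- Otherwise the `l` vertices with `ρ` below `l` form a proper subset of the `k` vertices with `π`
  -- below `k`, although `k ≤ l`.
  have hss : (Finset.univ.filter fun v => (ρ v : ℕ) < l) ⊂
      Finset.univ.filter fun v => (π v : ℕ) < k := by
    refine ⟨fun w hw => ?_, fun hc => ?_⟩
    · simpa using h w (by simpa using hw)
    · have := hc (by simpa using hu : u ∈ _)
      simp at this
      omega
  have := Finset.card_lt_card hss
  rw [card_filter_val_lt _ hl, card_filter_val_lt _ (hkl.trans hl)] at this
  omega

/-- If `v` did not run leftward, `exists_of_le` would give a segment `w` that starts to the right of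
`v` and ends to the left of it. Then `u`, `v`, `w` cross pairwise, and a bipartite graph has no
triangle. -/
theorem IsDiagramOf.leftward_of_adj {P : PermDiagram (Fin n) n} {G : SimpleGraph (Fin n)}
    (h : P.IsDiagramOf G) (hG : G.IsBipartite) {u v : Fin n} (h1 : P.π₁ u < P.π₁ v)
    (h2 : P.π₂ v < P.π₂ u) : P.π₂ v < P.π₁ v := by
  by_contra! hc
  rw [isDiagramOf_iff] at h
  obtain ⟨w, hw1, hw2⟩ := exists_of_le P.π₁ P.π₂ (k := P.π₁ v) (l := P.π₂ v) hc (by omega)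
    h1 (le_of_lt h2)
  have hvw : P.π₁ v < P.π₁ w := by
    refine lt_of_le_of_ne hw2 fun he => ?_
    rw [P.π₁.injective he] at hw1
    omega
  obtain ⟨c⟩ := hG
  have a1 := c.valid ((h u v).2 (.inl ⟨h1, h2⟩))
  have a2 := c.valid ((h v w).2 (.inl ⟨hvw, hw1⟩))
  have a3 := c.valid ((h u w).2 (.inl ⟨h1.trans hvw, lt_trans hw1 h2⟩))
  revert a1 a2 a3
  generalize c u = x; generalize c v = y; generalize c w = z
  revert x y z
  decide

/-- The second half of the crossing condition is `leftward_of_adj` for the reversed diagram. Every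
vertex has a neighbour because `n ≥ 2`, so no segment is vertical; for `n = 1` the only segment is.
-/
theorem IsDiagramOf.proper {P : PermDiagram (Fin n) n} {G : SimpleGraph (Fin n)}
    (h : P.IsDiagramOf G) (hG : G.IsBipartite) (hc : G.Connected) (hn : 2 ≤ n) : P.Proper := by
  have key : ∀ u v, P.π₁ u < P.π₁ v → P.π₂ v < P.π₂ u → P.π₁ u < P.π₂ u ∧ P.π₂ v < P.π₁ v := by
    intro u v h1 h2
    refine ⟨?_, h.leftward_of_adj hG h1 h2⟩
    have := h.flipH.leftward_of_adj hG (u := v) (v := u)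
    simp only [PermDiagram.flipH, Equiv.trans_apply, Fin.revPerm_apply, Fin.rev_lt_rev] at this
    exact this h1 h2
  refine ⟨key, fun v => ?_⟩
  have : Nontrivial (Fin n) := Fin.nontrivial_iff_two_le.2 hn
  obtain ⟨w, hw⟩ := hc.preconnected.exists_adj_of_nontrivial v
  rcases (isDiagramOf_iff.1 h v w).1 hw with h1 | h1
  · exact ne_of_lt (key _ _ h1.1 h1.2).1
  · exact ne_of_gt (key _ _ h1.1 h1.2).2

/-- If no segment passed the cut rightward, the same vertices would lie before `i` on both lines, by
cardinality. No edge could then leave this set, which contains the first but not all vertices. -/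
theorem IsDiagramOf.exists_cut {P : PermDiagram (Fin n) n} {G : SimpleGraph (Fin n)}
    (h : P.IsDiagramOf G) (hc : G.Connected) {i : ℕ} (h0 : 0 < i) (hi : i < n) :
    ∃ v, (P.π₁ v : ℕ) < i ∧ i ≤ P.π₂ v := by
  by_contra! hcon
  have hss : (Finset.univ.filter fun v => (P.π₁ v : ℕ) < i) =
      Finset.univ.filter fun v => (P.π₂ v : ℕ) < i := by
    refine Finset.eq_of_subset_of_card_le (fun v hv => ?_) ?_
    · simpa using hcon v (by simpa using hv)
    · rw [card_filter_val_lt _ hi.le, card_filter_val_lt _ hi.le]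
  have hmem : ∀ v, (P.π₁ v : ℕ) < i ↔ (P.π₂ v : ℕ) < i := fun v => by
    simpa using Finset.ext_iff.1 hss v
  have hstep : ∀ u v, G.Adj u v → ((P.π₁ u : ℕ) < i ↔ (P.π₁ v : ℕ) < i) := by
    intro u v huv
    have h1 := hmem u
    have h2 := hmem v
    rcases (isDiagramOf_iff.1 h u v).1 huv with h3 | h3 <;> simp only [Fin.lt_def] at h3 <;> omega
  have hwalk : ∀ u v, G.Reachable u v → ((P.π₁ u : ℕ) < i ↔ (P.π₁ v : ℕ) < i) := by
    rintro u v ⟨p⟩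
    induction p with
    | nil => rfl
    | cons hadj _ ih => exact (hstep _ _ hadj).trans ih
  have := hwalk (P.π₁.symm ⟨0, by omega⟩) (P.π₁.symm ⟨i, hi⟩) (hc.preconnected _ _)
  simp at this
  omega

/-- Neighbouring upper positions are joined across the cut between them. Among the segments starting
before the cut take `v` ending last, among the others `w` ending first; these two cross. The segment
just before the cut equals or crosses `v`, the one just behind it equals or crosses `w`. -/
theorem IsDiagramOf.connected {P : PermDiagram (Fin n) n} {G : SimpleGraph (Fin n)}
    (h : P.IsDiagramOf G) (hn : 0 < n)
    (hcut : ∀ i, 0 < i → i < n → ∃ v, (P.π₁ v : ℕ) < i ∧ i ≤ P.π₂ v) : G.Connected := by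
  have : Nonempty (Fin n) := ⟨⟨0, hn⟩⟩
  rw [isDiagramOf_iff] at h
  have hstep : ∀ i (hi : i + 1 < n),
      G.Reachable (P.π₁.symm ⟨i, by omega⟩) (P.π₁.symm ⟨i + 1, hi⟩) := by
    intro i hi
    obtain ⟨v₀, hv₀⟩ := hcut (i + 1) (by omega) hi
    obtain ⟨w₀, hw₀⟩ := exists_of_le P.π₁ P.π₂ le_rfl hi.le hv₀.1 hv₀.2
    obtain ⟨v, hv, hvmax⟩ := Finset.exists_max_image
      (Finset.univ.filter fun v => (P.π₁ v : ℕ) < i + 1) P.π₂ ⟨v₀, by simpa using hv₀.1⟩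
    obtain ⟨w, hw, hwmin⟩ := Finset.exists_min_image
      (Finset.univ.filter fun v => i + 1 ≤ (P.π₁ v : ℕ)) P.π₂ ⟨w₀, by simpa using hw₀.2⟩
    simp only [Finset.mem_filter, Finset.mem_univ, true_and, Fin.le_def] at hv hw hvmax hwmin
    set a := P.π₁.symm ⟨i, by omega⟩ with ha
    set b := P.π₁.symm ⟨i + 1, hi⟩ with hb
    have ha1 : (P.π₁ a : ℕ) = i := by simp [ha]
    have hb1 : (P.π₁ b : ℕ) = i + 1 := by simp [hb]
    have h1 := hvmax v₀ hv₀.1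
    have h2 := hwmin w₀ hw₀.2
    have h3 := hvmax a (by omega)
    have h4 := hwmin b (by omega)
    have hvw : G.Reachable v w := by
      refine SimpleGraph.Adj.reachable ((h v w).2 (.inl ⟨?_, ?_⟩)) <;> rw [Fin.lt_def] <;> omega
    have hne : ∀ {x y : Fin n}, x ≠ y → (P.π₁ x : ℕ) ≠ P.π₁ y ∧ (P.π₂ x : ℕ) ≠ P.π₂ y := by
      intro x y hxy
      exact ⟨fun e => hxy (P.π₁.injective (Fin.ext e)), fun e => hxy (P.π₂.injective (Fin.ext e))⟩
    have hav : G.Reachable a v := by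
      rcases eq_or_ne a v with e | e
      · rw [e]
      · refine SimpleGraph.Adj.reachable ((h a v).2 (.inr ⟨?_, ?_⟩)) <;> rw [Fin.lt_def] <;>
          have := hne e <;> omega
    have hwb : G.Reachable w b := by
      rcases eq_or_ne b w with e | e
      · rw [e]
      · refine SimpleGraph.Adj.reachable ((h w b).2 (.inr ⟨?_, ?_⟩)) <;> rw [Fin.lt_def] <;>
          have := hne e <;> omega
    exact (hav.trans hvw).trans hwb
  have hzero : ∀ i (hi : i < n),
      G.Reachable (P.π₁.symm ⟨0, hn⟩) (P.π₁.symm ⟨i, hi⟩) := by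
    intro i
    induction i with
    | zero => intro _; rfl
    | succ i ih => intro hi; exact (ih (by omega)).trans (hstep i hi)
  refine ⟨fun u v => ?_⟩
  have hu := hzero (P.π₁ u) (P.π₁ u).2
  have hv := hzero (P.π₁ v) (P.π₁ v).2
  simp only [Fin.eta, Equiv.symm_apply_apply] at hu hv
  exact hu.symm.trans hv

/-! ### Uniqueness of the diagram up to flips -/

/-- The segment of `u` lies to the left of the segment of `v`. -/
def Before (P : PermDiagram (Fin n) n) (u v : Fin n) : Prop :=
  P.π₁ u < P.π₁ v ∧ P.π₂ u < P.π₂ v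

theorem before_flipV (P : PermDiagram (Fin n) n) (u v : Fin n) :
    P.flipV.Before u v ↔ P.Before u v := and_comm

theorem before_flipH (P : PermDiagram (Fin n) n) (u v : Fin n) :
    P.flipH.Before u v ↔ P.Before v u := by
  simp [Before, flipH]

theorem Before.not_before {P : PermDiagram (Fin n) n} {u v : Fin n} (h : P.Before u v) :
    ¬ P.Before v u := fun h' => absurd (h.1.trans h'.1) (lt_irrefl _)

theorem IsDiagramOf.before_or {P : PermDiagram (Fin n) n} {G : SimpleGraph (Fin n)}
    (h : P.IsDiagramOf G) {u v : Fin n} (hne : u ≠ v) (hadj : ¬ G.Adj u v) :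
    P.Before u v ∨ P.Before v u := by
  rw [isDiagramOf_iff.1 h] at hadj
  have h1 := lt_or_gt_of_ne (P.π₁.injective.ne hne)
  have h2 := lt_or_gt_of_ne (P.π₂.injective.ne hne)
  simp only [Before]
  tauto

theorem IsDiagramOf.not_adj_of_before {P : PermDiagram (Fin n) n} {G : SimpleGraph (Fin n)}
    (h : P.IsDiagramOf G) {u v : Fin n} (hb : P.Before u v) : ¬ G.Adj u v := by
  rw [isDiagramOf_iff.1 h]
  rintro (h1 | h1)
  · exact lt_asymm hb.2 h1.2
  · exact lt_asymm hb.1 h1.1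

/-- If `w` lay to the left of `u`, transitivity would put it to the left of `v`, and the two would
not cross. -/
theorem IsDiagramOf.before_of_adj {P : PermDiagram (Fin n) n} {G : SimpleGraph (Fin n)}
    (h : P.IsDiagramOf G) {u v w : Fin n} (hvw : G.Adj v w)
    (huw : u ≠ w) (huw' : ¬ G.Adj u w) (hb : P.Before u v) : P.Before u w := by
  refine (h.before_or huw huw').resolve_right fun hc => ?_
  exact h.not_adj_of_before (u := w) (v := v) ⟨hc.1.trans hb.1, hc.2.trans hb.2⟩ hvw.symm

/-- The diagrams `P` and `Q` place `u` and `v` in the same order. -/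
def Agree (P Q : PermDiagram (Fin n) n) (u v : Fin n) : Prop :=
  P.Before u v ↔ Q.Before u v

theorem agree_comm {P Q : PermDiagram (Fin n) n} {G : SimpleGraph (Fin n)}
    (hP : P.IsDiagramOf G) (hQ : Q.IsDiagramOf G) {u v : Fin n} (hne : u ≠ v)
    (hadj : ¬ G.Adj u v) : Agree P Q u v ↔ Agree P Q v u := by
  have key : ∀ {R : PermDiagram (Fin n) n}, R.IsDiagramOf G → (R.Before u v ↔ ¬ R.Before v u) :=
    fun hR => ⟨fun h => h.not_before, fun h => (hR.before_or hne hadj).resolve_right h⟩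
  rw [Agree, Agree, key hP, key hQ, not_iff_not]

/-- The basic move: one partner of a comparison slides along an edge. All links between comparisons
are compositions of this. -/
theorem agree_of_adj {P Q : PermDiagram (Fin n) n} {G : SimpleGraph (Fin n)}
    (hP : P.IsDiagramOf G) (hQ : Q.IsDiagramOf G) {u v w : Fin n} (hvw : G.Adj v w)
    (huv : u ≠ v) (huv' : ¬ G.Adj u v) (huw : u ≠ w) (huw' : ¬ G.Adj u w) :
    Agree P Q u v ↔ Agree P Q u w := by
  have key : ∀ {R : PermDiagram (Fin n) n}, R.IsDiagramOf G → (R.Before u v ↔ R.Before u w) :=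
    fun hR => ⟨hR.before_of_adj hvw huw huw', hR.before_of_adj hvw.symm huv huv'⟩
  rw [Agree, Agree, key hP, key hQ]

theorem Proper.not_adj {P : PermDiagram (Fin n) n} {G : SimpleGraph (Fin n)} (hp : P.Proper)
    (hP : P.IsDiagramOf G) {u v : Fin n} (h : P.Rightward u ↔ P.Rightward v) : ¬ G.Adj u v := by
  rw [isDiagramOf_iff.1 hP]
  simp only [Rightward] at h
  rintro (h1 | h1)
  · obtain ⟨h2, h3⟩ := hp.cross _ _ h1.1 h1.2
    exact lt_asymm h3 (h.1 h2)
  · obtain ⟨h2, h3⟩ := hp.cross _ _ h1.1 h1.2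
    exact lt_asymm h3 (h.2 h2)

theorem Proper.not_rightward {P : PermDiagram (Fin n) n} (hp : P.Proper) {v : Fin n} :
    ¬ P.Rightward v ↔ P.π₂ v < P.π₁ v := by
  rw [Rightward, not_lt, le_iff_lt_or_eq]
  have := hp.ne v
  tauto

/-- With a leftward segment on the left, a rightward segment can be moved to the last one. -/
theorem agree_last {P Q : PermDiagram (Fin n) n} {G : SimpleGraph (Fin n)}
    (hp : P.Proper) (hc : G.Connected) (hP : P.IsDiagramOf G) (hQ : Q.IsDiagramOf G)
    {a b z : Fin n} (hz : (P.π₂ z : ℕ) = n - 1) (hb : ¬ P.Rightward b) (ha : P.Rightward a)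
    (hba : P.Before b a) :
    P.Before b z ∧ P.Rightward z ∧ (Agree P Q b a ↔ Agree P Q b z) := by
  induction hk : n - (P.π₁ a : ℕ) using Nat.strong_induction_on generalizing a with
  | _ k ih =>
    rcases eq_or_ne a z with rfl | haz
    · exact ⟨hba, ha, Iff.rfl⟩
    have hne : (P.π₂ a : ℕ) ≠ n - 1 := fun e =>
      haz (P.π₂.injective (Fin.ext (e.trans hz.symm)))
    -- The cut just behind the lower end of `a` is passed by a rightward `v` further to the right.
    obtain ⟨v, hv1, hv2⟩ := hP.exists_cut hc (i := P.π₂ a + 1) (by omega) (by omega)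
    have hvr : P.Rightward v := by rw [Rightward, Fin.lt_def]; omega
    have hav : P.Before a v := by
      refine (hP.before_or (by rintro rfl; omega) (hp.not_adj hP (by tauto))).resolve_right ?_
      rintro ⟨-, h⟩
      rw [Fin.lt_def] at h
      omega
    -- Counting gives a leftward `w` crossing both `a` and `v`. Since `b` runs leftward too, it is
    -- not adjacent to `w`, so the partner of `b` can move from `a` over `w` to `v`.
    obtain ⟨w, hw1, hw2⟩ := exists_of_le P.π₁ P.π₂ (k := P.π₁ v + 1) (l := P.π₂ a + 1) (u := v)
      (by omega) (by omega) (by omega) (by omega)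
    have h1 := hav.1
    rw [Fin.lt_def] at h1
    have hwa : (P.π₂ w : ℕ) ≠ P.π₂ a := fun e => by
      rw [P.π₂.injective (Fin.ext e)] at hw2
      omega
    have hbw : ¬ P.Rightward w := by
      rw [hp.not_rightward]
      refine (hp.cross v w ?_ ?_).2 <;> rw [Fin.lt_def] <;> omega
    have hadj_a : G.Adj a w := by
      refine (isDiagramOf_iff.1 hP a w).2 (.inl ⟨?_, ?_⟩) <;> rw [Fin.lt_def] <;> omega
    have hadj_v : G.Adj v w := by
      refine (isDiagramOf_iff.1 hP v w).2 (.inl ⟨?_, ?_⟩) <;> rw [Fin.lt_def] <;> omega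
    have hbv : P.Before b v := ⟨hba.1.trans hav.1, hba.2.trans hav.2⟩
    have n1 := hP.not_adj_of_before hba
    have n2 := hP.not_adj_of_before hbv
    have hbw' : b ≠ w := by rintro rfl; exact n1 hadj_a.symm
    have n3 : ¬ G.Adj b w := hp.not_adj hP (by tauto)
    have e1 : b ≠ a := by rintro rfl; exact hb ha
    have e2 : b ≠ v := by rintro rfl; exact hb hvr
    obtain ⟨r1, r2, r3⟩ := ih (n - P.π₁ v) (by omega) hvr hbv rfl
    refine ⟨r1, r2, ?_⟩
    rw [← r3, agree_of_adj hP hQ hadj_a e1 n1 hbw' n3, agree_of_adj hP hQ hadj_v e2 n2 hbw' n3]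

theorem agree_flipH (P Q : PermDiagram (Fin n) n) (u v : Fin n) :
    Agree P.flipH Q.flipH u v ↔ Agree P Q v u := by
  rw [Agree, Agree, before_flipH, before_flipH]

theorem agree_flipV (P Q : PermDiagram (Fin n) n) (u v : Fin n) :
    Agree P.flipV Q.flipV u v ↔ Agree P Q u v := by
  rw [Agree, Agree, before_flipV, before_flipV]

theorem Proper.rightward_flipH {P : PermDiagram (Fin n) n} (hp : P.Proper) (v : Fin n) :
    P.flipH.Rightward v ↔ ¬ P.Rightward v := by
  rw [hp.not_rightward]
  simp [Rightward, PermDiagram.flipH]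

theorem Proper.rightward_flipV {P : PermDiagram (Fin n) n} (hp : P.Proper) (v : Fin n) :
    P.flipV.Rightward v ↔ ¬ P.Rightward v := by
  rw [hp.not_rightward]
  rfl

/-- `agree_last` moves `a` to `z`, the segment ending last; the same statement for the reversed
diagram, where `b` runs rightward, moves `b` to `y`, the segment ending first. -/
theorem agree_corner {P Q : PermDiagram (Fin n) n} {G : SimpleGraph (Fin n)}
    (hp : P.Proper) (hc : G.Connected) (hP : P.IsDiagramOf G) (hQ : Q.IsDiagramOf G)
    {a b y z : Fin n} (hy : (P.π₂ y : ℕ) = 0) (hz : (P.π₂ z : ℕ) = n - 1)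
    (hb : ¬ P.Rightward b) (ha : P.Rightward a) (hba : P.Before b a) :
    P.Before y z ∧ (Agree P Q b a ↔ Agree P Q y z) := by
  obtain ⟨r1, r2, r3⟩ := agree_last hp hc hP hQ hz hb ha hba
  obtain ⟨s1, -, s3⟩ := agree_last (a := b) (b := z) (z := y) hp.flipH hc hP.flipH hQ.flipH
    (by simp [flipH, Fin.val_rev, hy]) (by rw [hp.rightward_flipH]; tauto)
    (by rw [hp.rightward_flipH]; tauto) (by rwa [before_flipH])
  rw [agree_flipH, agree_flipH] at s3
  rw [before_flipH] at s1
  exact ⟨s1, r3.trans s3⟩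

/-- Every non-adjacent pair of opposite directions reduces to one of two corner pairs: `b₁`, `a₂` if
the leftward segment is on the left, and `a₁`, `b₂`, by exchanging the lines, if the rightward one
is. The corner pairs are linked with each other, so agreement has one truth value for all pairs. -/
theorem agree_or {P Q : PermDiagram (Fin n) n} {G : SimpleGraph (Fin n)}
    (hp : P.Proper) (hc : G.Connected) (hP : P.IsDiagramOf G) (hQ : Q.IsDiagramOf G)
    (hn : 2 ≤ n) :
    (∀ a b, P.Rightward a → ¬ P.Rightward b → ¬ G.Adj a b → Agree P Q a b) ∨
    (∀ a b, P.Rightward a → ¬ P.Rightward b → ¬ G.Adj a b → ¬ Agree P Q a b) := by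
  set a₁ := P.π₁.symm ⟨0, by omega⟩ with ha₁
  set b₁ := P.π₂.symm ⟨0, by omega⟩ with hb₁
  set a₂ := P.π₂.symm ⟨n - 1, by omega⟩ with ha₂
  set b₂ := P.π₁.symm ⟨n - 1, by omega⟩ with hb₂
  have e1 : (P.π₁ a₁ : ℕ) = 0 := by simp [ha₁]
  have e2 : (P.π₂ b₁ : ℕ) = 0 := by simp [hb₁]
  have e3 : (P.π₂ a₂ : ℕ) = n - 1 := by simp [ha₂]
  have e4 : (P.π₁ b₂ : ℕ) = n - 1 := by simp [hb₂]
  have hne : ∀ v, (P.π₁ v : ℕ) ≠ P.π₂ v := fun v e => hp.ne v (Fin.ext e)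
  have ra₁ : P.Rightward a₁ := by have := hne a₁; rw [Rightward, Fin.lt_def]; omega
  have ra₂ : P.Rightward a₂ := by have := hne a₂; rw [Rightward, Fin.lt_def]; omega
  have rb₁ : ¬ P.Rightward b₁ := by
    have := hne b₁; rw [hp.not_rightward, Fin.lt_def]; omega
  have rb₂ : ¬ P.Rightward b₂ := by
    have := hne b₂; rw [hp.not_rightward, Fin.lt_def]; omega
  have hA := ra₁; have hB := ra₂; have hC := rb₁; have hD := rb₂
  rw [hp.not_rightward, Fin.lt_def] at hC hD
  rw [Rightward, Fin.lt_def] at hA hB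
  have adj₁ : G.Adj a₁ b₁ := by
    refine (isDiagramOf_iff.1 hP _ _).2 (.inl ⟨?_, ?_⟩) <;> rw [Fin.lt_def] <;> omega
  have adj₂ : G.Adj a₂ b₂ := by
    refine (isDiagramOf_iff.1 hP _ _).2 (.inl ⟨?_, ?_⟩) <;> rw [Fin.lt_def] <;> omega
  have low : ∀ a b, P.Rightward a → ¬ P.Rightward b → P.Before b a →
      P.Before b₁ a₂ ∧ (Agree P Q a b ↔ Agree P Q b₁ a₂) := by
    intro a b ha hb hba
    obtain ⟨h1, h2⟩ := agree_corner hp hc hP hQ e2 e3 hb ha hba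
    refine ⟨h1, ?_⟩
    rw [← h2, agree_comm hP hQ (by rintro rfl; exact hb ha)
      fun h => hP.not_adj_of_before hba h.symm]
  have high : ∀ a b, P.Rightward a → ¬ P.Rightward b → P.Before a b →
      P.Before a₁ b₂ ∧ (Agree P Q a b ↔ Agree P Q a₁ b₂) := by
    intro a b ha hb hab
    have := agree_corner (a := b) (b := a) (y := a₁) (z := b₂) hp.flipV hc hP.flipV hQ.flipV
      e1 e4 (by rw [hp.rightward_flipV]; tauto) (by rw [hp.rightward_flipV]; tauto)
      (by rwa [before_flipV])
    rwa [agree_flipV, agree_flipV, before_flipV] at this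
  -- The path is `b₁ a₂`, then `a₁ a₂` along the edge `a₁ b₁`, then `a₁ b₂` along the edge `a₂ b₂`.
  have link : P.Before b₁ a₂ → P.Before a₁ b₂ → (Agree P Q b₁ a₂ ↔ Agree P Q a₁ b₂) := by
    intro h1 h2
    have m1 := hP.not_adj_of_before h1
    have m2 := hP.not_adj_of_before h2
    have m3 : ¬ G.Adj a₁ a₂ := hp.not_adj hP (by tauto)
    have m4 : a₁ ≠ a₂ := by rintro h; rw [h] at adj₁; exact m1 adj₁.symm
    have m5 : a₂ ≠ b₁ := by rintro h; rw [h] at ra₂; exact rb₁ ra₂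
    have m6 : a₁ ≠ b₂ := by rintro h; rw [h] at ra₁; exact rb₂ ra₁
    rw [agree_comm hP hQ m5.symm m1, ← agree_of_adj hP hQ adj₁ m4.symm (fun h => m3 h.symm) m5
      (fun h => m1 h.symm), agree_comm hP hQ m4.symm (fun h => m3 h.symm),
      agree_of_adj hP hQ adj₂ m4 m3 m6 m2]
  have all : ∀ a b a' b', P.Rightward a → ¬ P.Rightward b → ¬ G.Adj a b → P.Rightward a' →
      ¬ P.Rightward b' → ¬ G.Adj a' b' → (Agree P Q a b ↔ Agree P Q a' b') := by
    intro a b a' b' ha hb hab ha' hb' hab'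
    have d1 : a ≠ b := by rintro rfl; exact hb ha
    have d2 : a' ≠ b' := by rintro rfl; exact hb' ha'
    rcases hP.before_or d1 hab with h1 | h1 <;> rcases hP.before_or d2 hab' with h2 | h2
    · rw [(high a b ha hb h1).2, (high a' b' ha' hb' h2).2]
    · rw [(high a b ha hb h1).2, (low a' b' ha' hb' h2).2,
        link (low a' b' ha' hb' h2).1 (high a b ha hb h1).1]
    · rw [(low a b ha hb h1).2, (high a' b' ha' hb' h2).2,
        link (low a b ha hb h1).1 (high a' b' ha' hb' h2).1]
    · rw [(low a b ha hb h1).2, (low a' b' ha' hb' h2).2]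
  by_contra! hcon
  obtain ⟨⟨a, b, h1, h2, h3, h4⟩, a', b', h1', h2', h3', h4'⟩ := hcon
  exact h4 ((all a b a' b' h1 h2 h3 h1' h2' h3').2 h4')

/-- The places of a set `A` in a linear arrangement are determined by its comparisons with the
elements outside `A`. -/
theorem mem_symm_iff_of_cross {A : Fin n → Prop} {π ρ : Fin n ≃ Fin n}
    (h : ∀ a b, A a → ¬ A b → (π b < π a ↔ ρ b < ρ a)) (i : Fin n) :
    A (π.symm i) ↔ A (ρ.symm i) := by
  classical
  have main : ∀ {π ρ : Fin n ≃ Fin n}, (∀ a b, A a → ¬ A b → (π b < π a ↔ ρ b < ρ a)) →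
      ∀ k ≤ n, (Finset.univ.filter fun v => A v ∧ (π v : ℕ) < k).card ≤
        (Finset.univ.filter fun v => A v ∧ (ρ v : ℕ) < k).card := by
    intro π ρ h k hk
    by_contra! hcon
    have split : ∀ τ : Fin n ≃ Fin n, (Finset.univ.filter fun v => A v ∧ (τ v : ℕ) < k).card +
        (Finset.univ.filter fun v => ¬ A v ∧ (τ v : ℕ) < k).card = k := by
      intro τ
      conv_rhs => rw [← card_filter_val_lt τ hk,
        ← Finset.card_filter_add_card_filter_not (fun v => A v)]
      rw [Finset.filter_filter, Finset.filter_filter]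
      simp only [and_comm]
    have h1 := split π
    have h2 := split ρ
    have hsub : (Finset.univ.filter fun v => A v ∧ (π v : ℕ) < k) ⊆
        Finset.univ.filter fun v => A v ∧ (ρ v : ℕ) < k := by
      intro a ha
      simp only [Finset.mem_filter, Finset.mem_univ, true_and] at ha ⊢
      refine ⟨ha.1, ?_⟩
      by_contra! hak
      -- An element `a` of `A` before `k` under `π` but not under `ρ` follows, in both arrangements,
      -- every element outside `A` that is before `k` under `ρ`. So `π` has at least as many outside
      -- elements before `k` as `ρ`, contrary to `hcon`.
      have : (Finset.univ.filter fun v => ¬ A v ∧ (ρ v : ℕ) < k) ⊆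
          Finset.univ.filter fun v => ¬ A v ∧ (π v : ℕ) < k := by
        intro b hb
        simp only [Finset.mem_filter, Finset.mem_univ, true_and] at hb ⊢
        refine ⟨hb.1, ?_⟩
        have := (h a b ha.1 hb.1).2 (by rw [Fin.lt_def]; omega)
        rw [Fin.lt_def] at this
        omega
      have := Finset.card_le_card this
      omega
    have := Finset.card_le_card hsub
    omega
  have heq : ∀ k ≤ n, (Finset.univ.filter fun v => A v ∧ (π v : ℕ) < k).card =
      (Finset.univ.filter fun v => A v ∧ (ρ v : ℕ) < k).card := fun k hk =>
    le_antisymm (main h k hk) (main (fun a b ha hb => (h a b ha hb).symm) k hk)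
  have step : ∀ τ : Fin n ≃ Fin n, (Finset.univ.filter fun v => A v ∧ (τ v : ℕ) < i + 1).card =
      (Finset.univ.filter fun v => A v ∧ (τ v : ℕ) < i).card + if A (τ.symm i) then 1 else 0 := by
    intro τ
    have hτ : ∀ v, (τ v : ℕ) = i ↔ v = τ.symm i := fun v => by
      rw [← Fin.ext_iff, Equiv.eq_symm_apply]
    split_ifs with hA
    · rw [← Finset.card_insert_of_notMem (a := τ.symm i) (by simp)]
      congr 1
      ext v
      have := hτ v
      simp only [Finset.mem_filter, Finset.mem_univ, true_and, Finset.mem_insert]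
      rcases eq_or_ne v (τ.symm i) with rfl | hv
      · simp [hA]
      · have : (τ v : ℕ) ≠ i := by tauto
        simp only [hv, false_or]
        constructor <;> rintro ⟨h1, h2⟩ <;> exact ⟨h1, by omega⟩
    · refine (congrArg Finset.card ?_).trans (Nat.add_zero _).symm
      ext v
      have := hτ v
      simp only [Finset.mem_filter, Finset.mem_univ, true_and]
      rcases eq_or_ne v (τ.symm i) with rfl | hv
      · simp [hA]
      · have : (τ v : ℕ) ≠ i := by tauto
        constructor <;> rintro ⟨h1, h2⟩ <;> exact ⟨h1, by omega⟩
  have h1 := heq i (by omega)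
  have h2 := heq (i + 1) (by omega)
  rw [step, step, h1] at h2
  by_cases hA : A (π.symm i) <;> by_cases hB : A (ρ.symm i) <;> simp_all

/-- On either line, the order of a rightward `a` and a leftward `b` depends only on their adjacency
and on whether `a` is before `b`, since `Proper` excludes one of the two ways of crossing. So
`mem_symm_iff_of_cross` applies to the set of rightward segments on each line. -/
theorem str_eq_of_agree {P Q : PermDiagram (Fin n) n} {G : SimpleGraph (Fin n)}
    (hP : P.IsDiagramOf G) (hQ : Q.IsDiagramOf G) (hp : P.Proper) (hq : Q.Proper)
    (hr : ∀ v, P.Rightward v ↔ Q.Rightward v)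
    (ha : ∀ a b, P.Rightward a → ¬ P.Rightward b → ¬ G.Adj a b → Agree P Q a b) :
    P.str = Q.str := by
  have cross : ∀ (R : PermDiagram (Fin n) n), R.IsDiagramOf G → R.Proper → ∀ a b,
      R.Rightward a → ¬ R.Rightward b →
      (R.π₁ b < R.π₁ a ↔ ¬ G.Adj a b ∧ ¬ R.Before a b) ∧
      (R.π₂ b < R.π₂ a ↔ G.Adj a b ∨ ¬ R.Before a b) := by
    intro R hR hr a b ha hb
    have hne : a ≠ b := by rintro rfl; exact hb ha
    have h1 := lt_or_gt_of_ne (R.π₁.injective.ne hne)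
    have h2 := lt_or_gt_of_ne (R.π₂.injective.ne hne)
    have h3 := lt_asymm (a := R.π₁ a) (b := R.π₁ b)
    have h4 := lt_asymm (a := R.π₂ a) (b := R.π₂ b)
    have h5 : ¬ (R.π₁ b < R.π₁ a ∧ R.π₂ a < R.π₂ b) := fun h =>
      hb (hr.cross _ _ h.1 h.2).1
    rw [isDiagramOf_iff.1 hR, Before]
    tauto
  have hx : ∀ i, P.xLetter i = Q.xLetter i := by
    intro i
    have := mem_symm_iff_of_cross (A := P.Rightward) (π := P.π₁) (ρ := Q.π₁)
      (fun a b h1 h2 => by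
        rw [(cross P hP hp a b h1 h2).1,
          (cross Q hQ hq a b ((hr a).1 h1) fun h => h2 ((hr b).2 h)).1]
        refine and_congr_right fun h3 => not_congr ?_
        exact ha a b h1 h2 h3) i
    rw [hr (Q.π₁.symm i)] at this
    simp only [Rightward, Equiv.apply_symm_apply] at this
    simp only [xLetter, this]
  have hy : ∀ i, P.yLetter i = Q.yLetter i := by
    intro i
    have := mem_symm_iff_of_cross (A := P.Rightward) (π := P.π₂) (ρ := Q.π₂)
      (fun a b h1 h2 => by
        rw [(cross P hP hp a b h1 h2).2,
          (cross Q hQ hq a b ((hr a).1 h1) fun h => h2 ((hr b).2 h)).2]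
        by_cases h3 : G.Adj a b
        · simp [h3]
        · simp only [h3, false_or]
          exact not_congr (ha a b h1 h2 h3)) i
    rw [hr (Q.π₂.symm i)] at this
    simp only [Rightward, Equiv.apply_symm_apply] at this
    simp only [yLetter, this]
  simp only [str, hx, hy]

/-- Rotation keeps all directions and reverses all left-right comparisons. The case of disagreement
in `agree_or` is therefore agreement with `Q.flipR`. -/
theorem str_eq_or_of_rightward {P Q : PermDiagram (Fin n) n} {G : SimpleGraph (Fin n)}
    (hP : P.IsDiagramOf G) (hQ : Q.IsDiagramOf G) (hp : P.Proper) (hq : Q.Proper)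
    (hc : G.Connected) (hn : 2 ≤ n) (hr : ∀ v, P.Rightward v ↔ Q.Rightward v) :
    P.str = Q.str ∨ P.str = Q.flipR.str := by
  rcases agree_or hp hc hP hQ hn with h | h
  · exact .inl (str_eq_of_agree hP hQ hp hq hr h)
  · refine .inr (str_eq_of_agree hP hQ.flipR hp hq.flipV.flipH (fun v => ?_) fun a b h1 h2 h3 => ?_)
    · change _ ↔ Q.flipV.flipH.Rightward v
      rw [hr, hq.flipV.rightward_flipH, hq.rightward_flipV, not_not]
    · have h4 := h a b h1 h2 h3
      have h5 := agree_comm hQ hQ (by rintro rfl; exact h2 h1) h3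
      have h6 := hQ.before_or (by rintro rfl; exact h2 h1 : a ≠ b) h3
      have h7 : Q.Before a b → ¬ Q.Before b a := fun h => h.not_before
      change P.Before a b ↔ Q.flipV.flipH.Before a b
      rw [before_flipH, before_flipV]
      rw [Agree] at h4
      tauto

/-- The string representations of a connected bipartite permutation graph are flips of each
other. -/
theorem str_eq_flip {P Q : PermDiagram (Fin n) n} {G : SimpleGraph (Fin n)}
    (hP : P.IsDiagramOf G) (hQ : Q.IsDiagramOf G) (hb : G.IsBipartite) (hc : G.Connected) :
    P.str = Q.str ∨ P.str = Q.flipV.str ∨ P.str = Q.flipH.str ∨ P.str = Q.flipR.str := by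
  have hpos : 0 < n := Fin.pos_iff_nonempty.2 hc.nonempty
  obtain rfl | hn : n = 1 ∨ 2 ≤ n := by omega
  · left
    have h1 : P.π₁ = Q.π₁ := Subsingleton.elim _ _
    have h2 : P.π₂ = Q.π₂ := Subsingleton.elim _ _
    simp only [str, xLetter, yLetter, h1, h2]
  have hp := hP.proper hb hc hn
  have hq := hQ.proper hb hc hn
  -- Each edge joins opposite directions in both diagrams, so having the same direction in `P` and
  -- `Q` is constant on the connected graph. If it fails, it holds for `Q.flipV`.
  have hstep : ∀ u v, G.Adj u v →
      ((P.Rightward u ↔ Q.Rightward u) ↔ (P.Rightward v ↔ Q.Rightward v)) := by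
    intro u v huv
    have h1 := mt (hp.not_adj hP (u := u) (v := v)) (not_not.2 huv)
    have h2 := mt (hq.not_adj hQ (u := u) (v := v)) (not_not.2 huv)
    tauto
  have hwalk : ∀ u v, G.Reachable u v →
      ((P.Rightward u ↔ Q.Rightward u) ↔ (P.Rightward v ↔ Q.Rightward v)) := by
    rintro u v ⟨p⟩
    induction p with
    | nil => rfl
    | cons hadj _ ih => exact (hstep _ _ hadj).trans ih
  have hall := fun v => hwalk ⟨0, hpos⟩ v (hc.preconnected _ _)
  by_cases h0 : P.Rightward ⟨0, hpos⟩ ↔ Q.Rightward ⟨0, hpos⟩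
  · rcases str_eq_or_of_rightward hP hQ hp hq hc hn (fun v => (hall v).1 h0) with h | h
    · exact .inl h
    · exact .inr (.inr (.inr h))
  · have hr : ∀ v, P.Rightward v ↔ Q.flipV.Rightward v := fun v => by
      rw [hq.rightward_flipV]
      have := hall v
      tauto
    rcases str_eq_or_of_rightward hP hQ.flipV hp hq.flipV hc hn hr with h | h
    · exact .inr (.inl h)
    -- Rotating after exchanging the lines is the reversal `flipH`, by definition.
    · exact .inr (.inr (.inl h))

end PermDiagram

theorem pairStr_inj {x y x' y' : ℕ → Letter} {n : ℕ} :
    pairStr x y n = pairStr x' y' n ↔ ∀ i < n, x i = x' i ∧ y i = y' i := by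
  rw [← lexSign_eq_zero (by simp), lexSign_pairStr, lexRange_eq_zero]
  simp only [lexThen_eq_zero, Letter.cmp_eq_zero]

/-- Two permutations that increase on `A` and off `A` agree if they have the same image of `A`. -/
theorem perm_eq_of_monotone {n : ℕ} {A : Fin n → Prop} {σ τ : Fin n ≃ Fin n}
    (h1 : ∀ i j, (A i ↔ A j) → i < j → σ i < σ j) (h2 : ∀ i j, (A i ↔ A j) → i < j → τ i < τ j)
    (h : ∀ k, A (σ.symm k) ↔ A (τ.symm k)) : σ = τ := by
  have key : ∀ B : Fin n → Prop, (∀ i j, B i → B j → (A i ↔ A j)) →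
      (∀ k, B (σ.symm k) ↔ B (τ.symm k)) → ∀ i, B i → σ i = τ i := by
    intro B hB hk i hi
    have m1 : StrictMono fun i : {i // B i} => σ i := fun i j hij => h1 i j (hB _ _ i.2 j.2) hij
    have m2 : StrictMono fun i : {i // B i} => τ i := fun i j hij => h2 i j (hB _ _ i.2 j.2) hij
    have : (fun i : {i // B i} => σ i) = fun i : {i // B i} => τ i := by
      rw [← m1.range_inj m2]
      ext k
      simp only [Set.mem_range, Subtype.exists, exists_prop]
      constructor
      · rintro ⟨j, hj, rfl⟩
        exact ⟨τ.symm (σ j), (hk _).1 (by simpa using hj), by simp⟩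
      · rintro ⟨j, hj, rfl⟩
        exact ⟨σ.symm (τ j), (hk _).2 (by simpa using hj), by simp⟩
    exact congrFun this ⟨i, hi⟩
  ext i
  by_cases hi : A i
  · rw [key A (by tauto) h i hi]
  · rw [key (fun i => ¬ A i) (by tauto) (fun k => not_congr (h k)) i hi]

/-! ### Canonical representations and isomorphism -/

namespace PermDiagram

variable {n : ℕ}

@[simp] theorem length_str (P : PermDiagram (Fin n) n) : P.str.length = 2 * n := by
  rw [str_eq_pairStr, length_pairStr]

theorem str_inj {P Q : PermDiagram (Fin n) n} :
    P.str = Q.str ↔ ∀ i, P.xLetter i = Q.xLetter i ∧ P.yLetter i = Q.yLetter i := by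
  rw [str_eq_pairStr, str_eq_pairStr, pairStr_inj]
  constructor
  · intro h i
    simpa [upper, lower] using h i i.2
  · intro h i hi
    simpa [upper, lower, hi] using h ⟨i, hi⟩

theorem flipH_flipH (P : PermDiagram (Fin n) n) : P.flipH.flipH = P := by
  obtain ⟨π, ρ⟩ := P
  simp only [flipH, mk.injEq]
  constructor <;> ext <;> simp

/-- Among the flips of a diagram, one is canonical. -/
theorem exists_canonical {P : PermDiagram (Fin n) n} {G : SimpleGraph (Fin n)}
    (hP : P.IsDiagramOf G) : ∃ Q : PermDiagram (Fin n) n, Q.IsDiagramOf G ∧ Q.Canonical := by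
  -- The two bits record whether the lines are exchanged and whether they are reversed. Every flip
  -- negates bits, so the four diagrams are closed under flips and one with maximal binary value is
  -- canonical.
  let f : Bool × Bool → PermDiagram (Fin n) n := fun a =>
    match a with
    | (false, false) => P
    | (true, false) => P.flipV
    | (false, true) => P.flipH
    | (true, true) => P.flipR
  obtain ⟨a, -, ha⟩ := Finset.exists_max_image Finset.univ (fun a => binaryValue (f a).str)
    ⟨(false, false), Finset.mem_univ _⟩
  have hV : ∀ a, (f a).flipV = f (!a.1, a.2) := by rintro ⟨_ | _, _ | _⟩ <;> rfl
  have hH : ∀ a, (f a).flipH = f (a.1, !a.2) := by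
    rintro ⟨_ | _, _ | _⟩
    · rfl
    · exact flipH_flipH P
    · rfl
    · exact flipH_flipH P.flipV
  have hR : ∀ a, (f a).flipR = f (!a.1, !a.2) := fun a => by
    change (f a).flipV.flipH = _
    rw [hV, hH]
  refine ⟨f a, ?_, ?_, ?_, ?_⟩
  · rcases a with ⟨_ | _, _ | _⟩
    exacts [hP, hP.flipH, hP.flipV, hP.flipR]
  · rw [largerEq_iff_binaryValue (by simp), hV]
    exact ha _ (Finset.mem_univ _)
  · rw [largerEq_iff_binaryValue (by simp), hH]
    exact ha _ (Finset.mem_univ _)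
  · rw [largerEq_iff_binaryValue (by simp), hR]
    exact ha _ (Finset.mem_univ _)

theorem Canonical.largerEq {P Q : PermDiagram (Fin n) n} (h : P.Canonical)
    (hQ : Q.str = P.str ∨ Q.str = P.flipV.str ∨ Q.str = P.flipH.str ∨ Q.str = P.flipR.str) :
    LargerEq P.str Q.str := by
  rcases hQ with e | e | e | e <;> rw [e]
  exacts [.inr rfl, h.1, h.2.1, h.2.2]

/-- Each string is a flip of the other, so each canonical string is at least the other. -/
theorem Canonical.str_eq {P Q : PermDiagram (Fin n) n} {G : SimpleGraph (Fin n)}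
    (hG : IsConnBipPerm G) (hP : P.IsDiagramOf G) (hQ : Q.IsDiagramOf G) (hp : P.Canonical)
    (hq : Q.Canonical) : P.str = Q.str :=
  LargerEq.antisymm (by simp) (hp.largerEq (str_eq_flip hQ hP hG.2.1 hG.1))
    (hq.largerEq (str_eq_flip hP hQ hG.2.1 hG.1))

/-- Transport of a diagram along a relabelling of the vertices. -/
def relabel (P : PermDiagram (Fin n) n) (e : Fin n ≃ Fin n) : PermDiagram (Fin n) n :=
  ⟨e.trans P.π₁, e.trans P.π₂⟩

theorem str_relabel (P : PermDiagram (Fin n) n) (e : Fin n ≃ Fin n) :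
    (P.relabel e).str = P.str := by
  rw [str_inj]
  intro i
  simp [xLetter, yLetter, relabel]

theorem canonical_relabel {P : PermDiagram (Fin n) n} {e : Fin n ≃ Fin n} :
    (P.relabel e).Canonical ↔ P.Canonical := by
  have h1 : (P.relabel e).flipV.str = P.flipV.str := str_relabel P.flipV e
  have h2 : (P.relabel e).flipH.str = P.flipH.str := str_relabel P.flipH e
  have h3 : (P.relabel e).flipR.str = P.flipR.str := str_relabel P.flipR e
  rw [Canonical, Canonical, h1, h2, h3, str_relabel]

/-- Segments of equal direction do not cross, so the permutation from upper to lower positions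
increases on the rightward segments and on the leftward ones. The letters say which positions these
occupy on each line, and `perm_eq_of_monotone` applies. -/
theorem perm_eq_of_str_eq {P Q : PermDiagram (Fin n) n} (hp : P.Proper) (hq : Q.Proper)
    (h : P.str = Q.str) : P.π₁.symm.trans P.π₂ = Q.π₁.symm.trans Q.π₂ := by
  rw [str_inj] at h
  have hR : ∀ (R : PermDiagram (Fin n) n), R.Proper → ∀ i j,
      (R.Rightward (R.π₁.symm i) ↔ R.Rightward (R.π₁.symm j)) → i < j →
      R.π₁.symm.trans R.π₂ i < R.π₁.symm.trans R.π₂ j := by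
    intro R hR i j hij hlt
    simp only [Equiv.trans_apply]
    by_contra! hc
    have hc' : R.π₂ (R.π₁.symm j) < R.π₂ (R.π₁.symm i) := by
      refine lt_of_le_of_ne hc fun e => ?_
      have := R.π₁.symm.injective (R.π₂.injective e)
      exact hlt.ne' this
    obtain ⟨h1, h2⟩ := hR.cross (R.π₁.symm i) (R.π₁.symm j) (by simpa using hlt) hc'
    exact lt_asymm h2 (hij.1 h1)
  have h1 : ∀ i, P.Rightward (P.π₁.symm i) ↔ Q.Rightward (Q.π₁.symm i) := by
    intro i
    have := (h i).1
    simp only [xLetter] at this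
    simp only [Rightward, Equiv.apply_symm_apply]
    split_ifs at this <;> tauto
  have h2 : ∀ i, P.Rightward (P.π₂.symm i) ↔ Q.Rightward (Q.π₂.symm i) := by
    intro i
    have := (h i).2
    simp only [yLetter] at this
    simp only [Rightward, Equiv.apply_symm_apply]
    split_ifs at this <;> tauto
  refine perm_eq_of_monotone (A := fun i => P.Rightward (P.π₁.symm i)) (hR P hp) ?_ ?_
  · intro i j hij
    rw [h1, h1] at hij
    exact hR Q hq i j hij
  · intro k
    simp only [Equiv.symm_trans_apply, Equiv.symm_symm]
    rw [h1 (Q.π₁ (Q.π₂.symm k))]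
    simpa using h2 k

theorem nonempty_iso_of_str_eq {P Q : PermDiagram (Fin n) n} {G H : SimpleGraph (Fin n)}
    (hG : IsConnBipPerm G) (hH : IsConnBipPerm H) (hP : P.IsDiagramOf G) (hQ : Q.IsDiagramOf H)
    (h : P.str = Q.str) : Nonempty (G ≃g H) := by
  have hpos : 0 < n := Fin.pos_iff_nonempty.2 hG.1.nonempty
  obtain rfl | hn : n = 1 ∨ 2 ≤ n := by omega
  · obtain rfl : G = H := Subsingleton.elim _ _
    exact ⟨.refl⟩
  have hσ := perm_eq_of_str_eq (hP.proper hG.2.1 hG.1 hn) (hQ.proper hH.2.1 hH.1 hn) h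
  refine ⟨⟨P.π₁.trans Q.π₁.symm, ?_⟩⟩
  intro u v
  have key : ∀ w, Q.π₂ (Q.π₁.symm (P.π₁ w)) = P.π₂ w := fun w => by
    have := DFunLike.congr_fun hσ (P.π₁ w)
    simpa using this.symm
  rw [isDiagramOf_iff.1 hP, isDiagramOf_iff.1 hQ]
  simp [key]

theorem iso_invariance (G H : SimpleGraph (Fin n)) {s s' : List Letter}
    (hG : IsConnBipPerm G) (hH : IsConnBipPerm H)
    (hs : IsCanonicalRep G s) (hs' : IsCanonicalRep H s') : s = s' ↔ Nonempty (G ≃g H) := by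
  obtain ⟨P, hP, hp, rfl⟩ := hs
  obtain ⟨Q, hQ, hq, rfl⟩ := hs'
  refine ⟨nonempty_iso_of_str_eq hG hH hP hQ, fun ⟨e⟩ => ?_⟩
  have hQ' : (Q.relabel e.toEquiv).IsDiagramOf G := by
    rw [isDiagramOf_iff] at hQ ⊢
    intro u v
    rw [← e.map_adj_iff, hQ]
    rfl
  rw [← str_relabel Q e.toEquiv]
  exact Canonical.str_eq hG hP hQ' hp (canonical_relabel.2 hq)

/-! ### Heights and edges -/

theorem sum_range_eq (π : Fin n ≃ Fin n) {i : ℕ} (hi : i ≤ n) (f : ℕ → ℤ) :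
    ∑ j ∈ Finset.range i, f j = ∑ v, if (π v : ℕ) < i then f (π v) else 0 := by
  rw [← Finset.sum_filter]
  symm
  refine Finset.sum_bij (fun v _ => (π v : ℕ)) (by simp) (fun a _ b _ h => ?_) (fun j hj => ?_)
    (by simp)
  · exact π.injective (Fin.ext h)
  · have : j < n := by rw [Finset.mem_range] at hj; omega
    exact ⟨π.symm ⟨j, this⟩, by simpa using hj, by simp⟩

/-- Each rightward segment contributes an `L` at its upper end and an `R` at its lower end. Before
the cut these cancel unless the segment passes it; leftward segments contribute nothing. -/
theorem halfHeight_eq_sum (P : PermDiagram (Fin n) n) {i : ℕ} (hi : i ≤ n) :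
    halfHeight P.upper P.lower i =
      ∑ v, if (P.π₁ v : ℕ) < i ∧ i ≤ P.π₂ v then 1 else 0 := by
  rw [halfHeight, Finset.sum_sub_distrib, sum_range_eq P.π₁ hi fun j => if P.upper j = .L then 1 else 0,
    sum_range_eq P.π₂ hi fun j => if P.lower j = .R then 1 else 0, ← Finset.sum_sub_distrib]
  refine Finset.sum_congr rfl fun v _ => ?_
  simp only [upper_eq_L, lower_eq_R, Rightward, Fin.lt_def]
  split_ifs <;> omega

/-- Double counting of pairs of a cut and a segment passing it rightward. Truncated subtraction
discards the other segments. -/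
theorem sum_halfHeight (P : PermDiagram (Fin n) n) :
    ∑ i ∈ Finset.Icc 1 n, halfHeight P.upper P.lower i =
      ∑ v, (((P.π₂ v : ℕ) - (P.π₁ v : ℕ) : ℕ) : ℤ) := by
  rw [Finset.sum_congr rfl fun i hi => P.halfHeight_eq_sum (Finset.mem_Icc.1 hi).2,
    Finset.sum_comm]
  refine Finset.sum_congr rfl fun v _ => ?_
  rw [← Finset.sum_filter, Finset.sum_const, nsmul_eq_mul, mul_one]
  have : (Finset.Icc 1 n).filter (fun i => (P.π₁ v : ℕ) < i ∧ i ≤ P.π₂ v) =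
      Finset.Ioc (P.π₁ v : ℕ) (P.π₂ v) := by
    ext i
    simp only [Finset.mem_filter, Finset.mem_Icc, Finset.mem_Ioc]
    omega
  rw [this, Nat.card_Ioc]

/-- A segment that starts to the left of `v` also ends to the left of it, since otherwise the
crossing would force `v` to run leftward. The neighbours are thus the `π₂ v` segments ending before
`v` minus the `π₁ v` segments starting before it. -/
theorem Proper.degree_eq [DecidableEq (Fin n)] {P : PermDiagram (Fin n) n}
    {G : SimpleGraph (Fin n)} [DecidableRel G.Adj]
    (hp : P.Proper) (hP : P.IsDiagramOf G) {v : Fin n} (hv : P.Rightward v) :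
    G.degree v = (P.π₂ v : ℕ) - (P.π₁ v : ℕ) := by
  have h1 : ∀ w, (P.π₁ w : ℕ) < P.π₁ v → (P.π₂ w : ℕ) < P.π₂ v := by
    intro w hw
    by_contra! hc
    have hne : P.π₂ w ≠ P.π₂ v := fun e => by rw [P.π₂.injective e] at hw; omega
    have := (hp.cross w v hw (by rw [Fin.lt_def]; have := Fin.val_ne_of_ne hne; omega)).2
    exact lt_asymm this hv
  have h2 : G.neighborFinset v = (Finset.univ.filter fun w => (P.π₂ w : ℕ) < P.π₂ v) \
      Finset.univ.filter fun w => (P.π₁ w : ℕ) < P.π₁ v := by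
    ext w
    have h3 := h1 w
    have h4 : (P.π₁ w : ℕ) = P.π₁ v → (P.π₂ w : ℕ) = P.π₂ v := fun e => by
      rw [P.π₁.injective (Fin.ext e)]
    simp only [SimpleGraph.mem_neighborFinset, isDiagramOf_iff.1 hP, Finset.mem_sdiff,
      Finset.mem_filter, Finset.mem_univ, true_and, Fin.lt_def]
    omega
  rw [← SimpleGraph.card_neighborFinset_eq_degree, h2, Finset.card_sdiff_of_subset,
    card_filter_val_lt _ (by omega), card_filter_val_lt _ (by omega)]
  intro w hw
  simpa using h1 w (by simpa using hw)

theorem IsDiagramOf.sum_halfHeight {P : PermDiagram (Fin n) n} {G : SimpleGraph (Fin n)}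
    (hG : IsConnBipPerm G) (hP : P.IsDiagramOf G) :
    ∑ i ∈ Finset.Icc 1 n, halfHeight P.upper P.lower i = G.edgeSet.ncard := by
  classical
  rw [P.sum_halfHeight]
  have hpos : 0 < n := Fin.pos_iff_nonempty.2 hG.1.nonempty
  obtain rfl | hn : n = 1 ∨ 2 ≤ n := by omega
  · obtain rfl : G = ⊥ := Subsingleton.elim _ _
    simp
  have hp := hP.proper hG.2.1 hG.1 hn
  have hbip : G.IsBipartiteWith (Finset.univ.filter fun v => P.Rightward v : Finset (Fin n))
      (Finset.univ.filter fun v => ¬ P.Rightward v : Finset (Fin n)) := by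
    refine ⟨Finset.disjoint_coe.2 (Finset.disjoint_filter_filter_not _ _ _), fun u v huv => ?_⟩
    have := mt (hp.not_adj hP (u := u) (v := v)) (not_not.2 huv)
    simp only [Finset.coe_filter, Finset.mem_univ, true_and, Set.mem_ofPred_eq]
    tauto
  rw [← SimpleGraph.coe_edgeFinset, Set.ncard_coe_finset,
    ← SimpleGraph.isBipartiteWith_sum_degrees_eq_card_edges hbip, Nat.cast_sum, Finset.sum_filter]
  refine Finset.sum_congr rfl fun v _ => ?_
  split_ifs with hv
  · rw [hp.degree_eq hP hv]
  · rw [hp.not_rightward, Fin.lt_def] at hv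
    simp only [Nat.cast_eq_zero]
    omega

theorem IsDiagramOf.sum_heightAt {P : PermDiagram (Fin n) n} {G : SimpleGraph (Fin n)}
    (hG : IsConnBipPerm G) (hP : P.IsDiagramOf G) :
    ∑ i ∈ Finset.Icc 1 n, heightAt P.str (2 * i) = 2 * (G.edgeSet.ncard : ℤ) := by
  rw [← hP.sum_halfHeight hG, Finset.mul_sum]
  refine Finset.sum_congr rfl fun i hi => ?_
  rw [str_eq_pairStr, heightAt_pairStr _ _ (Finset.mem_Icc.1 hi).2]

end PermDiagram

/-! ### Diagrams with prescribed letters -/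

/-- A permutation mapping one set onto another that increases on the set and on its complement. -/
theorem exists_monotone_perm {n : ℕ} (p q : Fin n → Prop) [DecidablePred p] [DecidablePred q]
    (h : (Finset.univ.filter p).card = (Finset.univ.filter q).card) :
    ∃ σ : Fin n ≃ Fin n, (∀ i, q (σ i) ↔ p i) ∧ ∀ i j, (p i ↔ p j) → i < j → σ i < σ j := by
  have build : ∀ (p q : Fin n → Prop) [DecidablePred p] [DecidablePred q],
      (Finset.univ.filter p).card = (Finset.univ.filter q).card →
      ∃ e : {i // p i} ≃ {i // q i}, ∀ i j, i < j → e i < e j := by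
    intro p q _ _ h
    have e1 := (Finset.univ.filter p).orderIsoOfFin rfl
    have e2 := (Finset.univ.filter q).orderIsoOfFin h.symm
    refine ⟨(Equiv.subtypeEquivRight (by simp)).trans
      ((e1.symm.trans e2).toEquiv.trans (Equiv.subtypeEquivRight (by simp))), fun i j hij => ?_⟩
    have := (e1.symm.trans e2).strictMono
      (show (⟨i.1, by simpa using i.2⟩ : {x // x ∈ Finset.univ.filter p}) <
        ⟨j.1, by simpa using j.2⟩ from hij)
    exact this
  obtain ⟨e, he⟩ := build p q h
  obtain ⟨f, hf⟩ := build (fun i => ¬ p i) (fun i => ¬ q i) (by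
    have h1 := Finset.card_filter_add_card_filter_not (s := (Finset.univ : Finset (Fin n))) p
    have h2 := Finset.card_filter_add_card_filter_not (s := (Finset.univ : Finset (Fin n))) q
    omega)
  have hp : ∀ i (hi : p i), Equiv.subtypeCongr e f i = e ⟨i, hi⟩ := fun i hi => by
    simp [Equiv.subtypeCongr, Equiv.sumCompl_symm_apply_of_pos hi]
  have hn : ∀ i (hi : ¬ p i), Equiv.subtypeCongr e f i = f ⟨i, hi⟩ := fun i hi => by
    simp [Equiv.subtypeCongr, Equiv.sumCompl_symm_apply_of_neg hi]
  refine ⟨Equiv.subtypeCongr e f, fun i => ?_, fun i j hij hlt => ?_⟩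
  · by_cases hi : p i
    · rw [hp i hi]
      exact iff_of_true (e _).2 hi
    · rw [hn i hi]
      exact iff_of_false (f _).2 hi
  · by_cases hi : p i
    · rw [hp i hi, hp j (hij.1 hi)]
      exact he _ _ hlt
    · rw [hn i hi, hn j (by tauto)]
      exact hf _ _ hlt

/-- The heights at even positions are positive inside and vanish at the end. -/
def ValidHeights (x y : ℕ → Letter) (n : ℕ) : Prop :=
  (∀ i, 0 < i → i < n → 0 < halfHeight x y i) ∧ halfHeight x y n = 0

/-- An increasing bijection preserves ranks. -/
theorem card_filter_rank {n : ℕ} {p q : Fin n → Prop} [DecidablePred p] [DecidablePred q]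
    {σ : Fin n ≃ Fin n} (hq : ∀ i, q (σ i) ↔ p i)
    (hσ : ∀ i j, p i → p j → i < j → σ i < σ j) {i : Fin n} (hi : p i) :
    (Finset.univ.filter fun j : Fin n => p j ∧ (j : ℕ) < i).card =
      (Finset.univ.filter fun j : Fin n => q j ∧ (j : ℕ) < σ i).card := by
  refine Finset.card_bij (fun j _ => σ j) (fun j hj => ?_) (fun a _ b _ h => σ.injective h)
    (fun k hk => ?_)
  · simp only [Finset.mem_filter, Finset.mem_univ, true_and] at hj ⊢
    exact ⟨(hq j).2 hj.1, hσ j i hj.1 hi hj.2⟩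
  · simp only [Finset.mem_filter, Finset.mem_univ, true_and] at hk
    obtain ⟨j, rfl⟩ := σ.surjective k
    refine ⟨j, ?_, rfl⟩
    have hj := (hq j).1 hk.1
    simp only [Finset.mem_filter, Finset.mem_univ, true_and]
    refine ⟨hj, ?_⟩
    by_contra! hc
    rcases (Fin.le_def.2 hc).lt_or_eq with h | h
    · exact absurd (hσ i j hi hj h) (not_lt.2 (le_of_lt hk.2))
    · rw [h] at hk
      exact lt_irrefl _ hk.2

theorem card_filter_succ {n : ℕ} (p : Fin n → Prop) [DecidablePred p] (i : Fin n) :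
    (Finset.univ.filter fun j : Fin n => p j ∧ (j : ℕ) < i + 1).card =
      (Finset.univ.filter fun j : Fin n => p j ∧ (j : ℕ) < i).card + if p i then 1 else 0 := by
  split_ifs with h
  · rw [← Finset.card_insert_of_notMem (a := i) (by simp)]
    refine congrArg Finset.card (Finset.ext fun j => ?_)
    simp only [Finset.mem_filter, Finset.mem_univ, true_and, Finset.mem_insert]
    rcases eq_or_ne j i with rfl | hj
    · simp [h]
    · have := Fin.val_ne_of_ne hj
      simp only [hj, false_or]
      exact and_congr_right fun _ => by omega
  · refine (congrArg Finset.card (Finset.ext fun j => ?_)).trans (Nat.add_zero _).symm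
    simp only [Finset.mem_filter, Finset.mem_univ, true_and]
    rcases eq_or_ne j i with rfl | hj
    · simp [h]
    · have := Fin.val_ne_of_ne hj
      exact and_congr_right fun _ => by omega

theorem halfHeight_eq_card (x y : ℕ → Letter) {n k : ℕ} (hk : k ≤ n) :
    halfHeight x y k =
      ((Finset.univ.filter fun j : Fin n => x j = .L ∧ (j : ℕ) < k).card : ℤ) -
      (Finset.univ.filter fun j : Fin n => y j = .R ∧ (j : ℕ) < k).card := by
  rw [halfHeight, Finset.sum_sub_distrib,
    PermDiagram.sum_range_eq (Equiv.refl (Fin n)) hk fun j => if x j = .L then 1 else 0,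
    PermDiagram.sum_range_eq (Equiv.refl (Fin n)) hk fun j => if y j = .R then 1 else 0,
    Finset.card_filter, Finset.card_filter, Nat.cast_sum, Nat.cast_sum]
  congr 1 <;> refine Finset.sum_congr rfl fun j _ => ?_ <;> rw [Equiv.refl_apply]
  · by_cases h1 : x j = .L <;> by_cases h2 : (j : ℕ) < k <;> simp [h1, h2]
  · by_cases h1 : y j = .R <;> by_cases h2 : (j : ℕ) < k <;> simp [h1, h2]

theorem card_filter_not_add {n k : ℕ} (p : Fin n → Prop) [DecidablePred p] (hk : k ≤ n) :
    (Finset.univ.filter fun j : Fin n => p j ∧ (j : ℕ) < k).card +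
      (Finset.univ.filter fun j : Fin n => ¬ p j ∧ (j : ℕ) < k).card = k := by
  conv_rhs => rw [← PermDiagram.card_filter_val_lt (Equiv.refl (Fin n)) hk,
    ← Finset.card_filter_add_card_filter_not p]
  rw [Finset.filter_filter, Finset.filter_filter]
  simp only [and_comm, Equiv.refl_apply]

theorem card_filter_mono {n k l : ℕ} (p : Fin n → Prop) [DecidablePred p] (h : k ≤ l) :
    (Finset.univ.filter fun j : Fin n => p j ∧ (j : ℕ) < k).card ≤
      (Finset.univ.filter fun j : Fin n => p j ∧ (j : ℕ) < l).card := by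
  refine Finset.card_le_card fun j hj => ?_
  simp only [Finset.mem_filter, Finset.mem_univ, true_and] at hj ⊢
  exact ⟨hj.1, by omega⟩

/-- Valid heights are realized by a diagram of a connected bipartite graph. -/
theorem ValidHeights.exists_diagram {x y : ℕ → Letter} {n : ℕ} (hn : 2 ≤ n)
    (h : ValidHeights x y n) : ∃ (G : SimpleGraph (Fin n)) (P : PermDiagram (Fin n) n),
      IsConnBipPerm G ∧ P.IsDiagramOf G ∧ ∀ i < n, P.upper i = x i ∧ P.lower i = y i := by
  obtain ⟨hpos, hend⟩ := h
  have hend' := hend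
  rw [halfHeight_eq_card x y le_rfl] at hend'
  have hcard : (Finset.univ.filter fun j : Fin n => x j = .L).card =
      (Finset.univ.filter fun j : Fin n => y j = .R).card := by
    simp only [Fin.is_lt, and_true] at hend'
    omega
  -- The upper occurrences of `L` are matched in order with the lower occurrences of `R`, and the
  -- remaining upper positions in order with the remaining lower ones.
  obtain ⟨σ, hσ, hmono⟩ := exists_monotone_perm (fun j : Fin n => x j = .L)
    (fun j : Fin n => y j = .R) hcard
  -- If `σ i ≤ i`, equality of ranks makes the height after position `σ i` at most zero, which is
  -- possible only at the end. Then `i = σ i` is the last position, and the height just before it is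
  -- zero as well, impossible for `n ≥ 2`.
  have up : ∀ i : Fin n, x i = .L → i < σ i := by
    intro i hi
    by_contra! hc
    have r1 := card_filter_rank (p := fun j : Fin n => x j = .L) (q := fun j : Fin n => y j = .R)
      hσ (fun a b ha hb => hmono a b (by tauto)) hi
    have r2 := card_filter_succ (fun j : Fin n => y j = .R) (σ i)
    rw [if_pos ((hσ i).2 hi)] at r2
    have r3 := card_filter_succ (fun j : Fin n => x j = .L) i
    rw [if_pos hi] at r3
    rw [Fin.le_def] at hc
    have r4 := card_filter_mono (fun j : Fin n => x j = .L) (show (σ i : ℕ) + 1 ≤ i + 1 by omega)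
    have h1 : (σ i : ℕ) + 1 = n := by
      by_contra hne
      have := hpos (σ i + 1) (by omega) (by omega)
      rw [halfHeight_eq_card x y (n := n) (by omega)] at this
      omega
    have h2 : (i : ℕ) = σ i := by omega
    have := hpos i (by omega) (by omega)
    rw [halfHeight_eq_card x y (n := n) (by omega)] at this
    rw [← h2] at r1
    omega
  -- The same argument for the complementary letters; `card_filter_not_add` translates their counts
  -- into heights.
  have down : ∀ i : Fin n, ¬ x i = .L → σ i < i := by
    intro i hi
    by_contra! hc
    have r1 := card_filter_rank (p := fun j : Fin n => ¬ x j = .L)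
      (q := fun j : Fin n => ¬ y j = .R) (fun j => not_congr (hσ j))
      (fun a b ha hb => hmono a b (by tauto)) hi
    have r2 := card_filter_succ (fun j : Fin n => ¬ y j = .R) (σ i)
    rw [if_pos (by simpa using (not_congr (hσ i)).2 hi)] at r2
    have r3 := card_filter_succ (fun j : Fin n => ¬ x j = .L) i
    rw [if_pos hi] at r3
    rw [Fin.le_def] at hc
    have r4 := card_filter_mono (fun j : Fin n => ¬ y j = .R)
      (show (i : ℕ) + 1 ≤ σ i + 1 by omega)
    have c1 := card_filter_not_add (n := n) (k := i + 1) (fun j : Fin n => x j = .L) (by omega)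
    have c2 := card_filter_not_add (n := n) (k := i + 1) (fun j : Fin n => y j = .R) (by omega)
    have c3 := card_filter_not_add (n := n) (k := i) (fun j : Fin n => x j = .L) (by omega)
    have c4 := card_filter_not_add (n := n) (k := i) (fun j : Fin n => y j = .R) (by omega)
    have h1 : (i : ℕ) + 1 = n := by
      by_contra hne
      have := hpos (i + 1) (by omega) (by omega)
      rw [halfHeight_eq_card x y (n := n) (by omega)] at this
      omega
    have h2 : (i : ℕ) = σ i := by omega
    have := hpos i (by omega) (by omega)
    rw [halfHeight_eq_card x y (n := n) (by omega)] at this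
    rw [← h2] at r1
    omega
  let P : PermDiagram (Fin n) n := ⟨Equiv.refl _, σ⟩
  let G : SimpleGraph (Fin n) :=
    { Adj := fun u v => (u < v ∧ σ v < σ u) ∨ (v < u ∧ σ u < σ v)
      symm := ⟨fun u v h => h.symm⟩
      loopless := ⟨fun u h => by simp at h⟩ }
  have hP : P.IsDiagramOf G := PermDiagram.isDiagramOf_iff.2 fun u v => Iff.rfl
  have hx : ∀ i < n, P.upper i = x i := by
    intro i hi
    have h1 := P.upper_eq_L ⟨i, hi⟩
    have h2 := up ⟨i, hi⟩
    have h3 := down ⟨i, hi⟩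
    change P.upper i = .L ↔ (⟨i, hi⟩ : Fin n) < σ ⟨i, hi⟩ at h1
    rcases hxi : x i with _ | _
    · exact h1.2 (h2 hxi)
    · have h4 := h3 (by simp [hxi])
      have h5 : ¬ P.upper i = .L := fun h => lt_asymm h4 (h1.1 h)
      cases hu : P.upper i <;> simp_all
  have hy : ∀ i < n, P.lower i = y i := by
    intro i hi
    obtain ⟨j, hj⟩ := σ.surjective ⟨i, hi⟩
    have h1 := P.lower_eq_R j
    change P.lower (σ j) = .R ↔ j < σ j at h1
    have h2 := up j
    have h3 := down j
    have h4 := hσ j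
    rw [hj] at h1 h2 h3 h4
    simp only at h1 h4
    rcases hyi : y i with _ | _
    · rw [hyi] at h4
      have h5 := h3 fun h => by simpa using h4.2 h
      have h6 : ¬ P.lower i = .R := fun h => lt_asymm h5 (h1.1 h)
      cases hu : P.lower i <;> simp_all
    · exact h1.2 (h2 (h4.1 hyi))
  -- The upper letter is the colour: `σ` increases on each colour class, so no two segments of a
  -- class cross.
  have hbip : G.IsBipartite := by
    refine ⟨SimpleGraph.Coloring.mk (fun v => if x v = .L then 0 else 1) fun {u v} huv he => ?_⟩
    have hxx : x u = .L ↔ x v = .L := by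
      split_ifs at he <;> simp_all
    rcases huv with h | h
    · exact lt_asymm (hmono u v hxx h.1) h.2
    · exact lt_asymm (hmono v u hxx.symm h.1) h.2
  refine ⟨G, P, ⟨hP.connected (by omega) fun i h0 hi => ?_, hbip, P, hP⟩, hP,
    fun i hi => ⟨hx i hi, hy i hi⟩⟩
  have h1 := hpos i h0 hi
  have h2 : halfHeight x y i = halfHeight P.upper P.lower i := by
    rw [halfHeight, halfHeight]
    refine Finset.sum_congr rfl fun j hj => ?_
    rw [Finset.mem_range] at hj
    rw [hx j (by omega), hy j (by omega)]
  rw [h2, P.halfHeight_eq_sum hi.le] at h1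
  obtain ⟨v, -, hv⟩ := Finset.exists_ne_zero_of_sum_ne_zero h1.ne'
  exact ⟨v, by simpa using hv⟩

namespace PermDiagram

variable {n : ℕ}

theorem IsDiagramOf.validHeights {P : PermDiagram (Fin n) n} {G : SimpleGraph (Fin n)}
    (hP : P.IsDiagramOf G) (hc : G.Connected) : ValidHeights P.upper P.lower n := by
  constructor
  · intro i h0 hi
    rw [P.halfHeight_eq_sum hi.le]
    obtain ⟨v, hv⟩ := hP.exists_cut hc h0 hi
    refine Finset.sum_pos' (fun w _ => by split_ifs <;> simp) ⟨v, Finset.mem_univ _, ?_⟩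
    simp [hv]
  · rw [P.halfHeight_eq_sum le_rfl]
    refine Finset.sum_eq_zero fun v _ => if_neg fun h => ?_
    omega

/-! ### Canonical diagrams -/

/-- The absence of vertical segments matters: a vertical segment has upper letter `R` and lower
letter `L` both before and after the exchange. -/
theorem Proper.upper_flipV {P : PermDiagram (Fin n) n} (hp : P.Proper) {i : ℕ} (hi : i < n) :
    P.flipV.upper i = P.lower i := by
  have := hp.ne (P.π₂.symm ⟨i, hi⟩)
  rw [Equiv.apply_symm_apply] at this
  simp only [upper, lower, hi, dite_true, xLetter, yLetter, PermDiagram.flipV]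
  rcases lt_or_gt_of_ne this with h | h
  · exact (if_neg (not_lt.2 h.le)).trans (if_pos h).symm
  · exact (if_pos h).trans (if_neg (not_lt.2 h.le)).symm

theorem Proper.lower_flipV {P : PermDiagram (Fin n) n} (hp : P.Proper) {i : ℕ} (hi : i < n) :
    P.flipV.lower i = P.upper i :=
  (hp.flipV.upper_flipV hi).symm

theorem Proper.upper_flipH {P : PermDiagram (Fin n) n} (hp : P.Proper) {i : ℕ} (hi : i < n) :
    P.flipH.upper i = (P.upper (n - 1 - i)).swap := by
  have hi' : n - 1 - i < n := by omega
  have := hp.ne (P.π₁.symm ⟨n - 1 - i, hi'⟩)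
  have hrev : Fin.rev (⟨i, hi⟩ : Fin n) = ⟨n - 1 - i, hi'⟩ := by
    ext; simp [Fin.val_rev]; omega
  rw [Equiv.apply_symm_apply] at this
  simp only [upper, hi, hi', dite_true, xLetter, PermDiagram.flipH, Equiv.symm_trans_apply,
    Fin.revPerm_symm, Fin.revPerm_apply, Equiv.trans_apply, hrev]
  have hiff := Fin.lt_rev_iff (i := ⟨i, hi⟩) (j := P.π₂ (P.π₁.symm ⟨n - 1 - i, hi'⟩))
  rw [hrev] at hiff
  rcases lt_or_gt_of_ne this with h | h
  · rw [if_pos h, if_neg fun h' => lt_asymm h (hiff.1 h')]; rfl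
  · rw [if_pos (hiff.2 h), if_neg (not_lt.2 h.le)]; rfl

theorem Proper.lower_flipH {P : PermDiagram (Fin n) n} (hp : P.Proper) {i : ℕ} (hi : i < n) :
    P.flipH.lower i = (P.lower (n - 1 - i)).swap := by
  rw [← hp.flipH.upper_flipV hi, ← hp.upper_flipV (by omega)]
  exact hp.flipV.upper_flipH hi

end PermDiagram

/-- The comparison of `x₀ y₀ x₁ y₁ …` with the string of the diagram with exchanged lines, at the
`i`-th pair. -/
def cmpV (x y : ℕ → Letter) (i : ℕ) : SignType := Letter.cmp (x i) (y i)

/-- The comparison with the string of the reversed diagram, at the `i`-th pair. -/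
def cmpH (x y : ℕ → Letter) (n i : ℕ) : SignType :=
  lexThen (Letter.cmp (x i) (x (n - 1 - i)).swap) (Letter.cmp (y i) (y (n - 1 - i)).swap)

/-- The comparison with the string of the rotated diagram, at the `i`-th pair. -/
def cmpR (x y : ℕ → Letter) (n i : ℕ) : SignType :=
  lexThen (Letter.cmp (x i) (y (n - 1 - i)).swap) (Letter.cmp (y i) (x (n - 1 - i)).swap)

/-- No flip gives a larger string. -/
def CanonicalLetters (x y : ℕ → Letter) (n : ℕ) : Prop :=
  lexRange (cmpV x y) n ≠ -1 ∧ lexRange (cmpH x y n) n ≠ -1 ∧ lexRange (cmpR x y n) n ≠ -1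

theorem PermDiagram.Proper.canonical_iff {n : ℕ} {P : PermDiagram (Fin n) n} (hp : P.Proper) :
    P.Canonical ↔ CanonicalLetters P.upper P.lower n := by
  have key : ∀ Q : PermDiagram (Fin n) n, LargerEq P.str Q.str ↔ lexRange (fun i =>
      lexThen (Letter.cmp (P.upper i) (Q.upper i)) (Letter.cmp (P.lower i) (Q.lower i))) n ≠ -1 := by
    intro Q
    rw [largerEq_iff_lexSign (by simp), P.str_eq_pairStr, Q.str_eq_pairStr, lexSign_pairStr]
  rw [Canonical, CanonicalLetters, key, key, key]
  refine and_congr (not_congr (Eq.congr_left (lexRange_congr fun i hi => ?_)))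
    (and_congr (not_congr (Eq.congr_left (lexRange_congr fun i hi => ?_)))
      (not_congr (Eq.congr_left (lexRange_congr fun i hi => ?_))))
  · rw [hp.upper_flipV hi, hp.lower_flipV hi, cmpV]
    -- The lower letters would be compared only if the upper comparison is a tie, and then they tie
    -- too.
    generalize P.upper i = a; generalize P.lower i = b
    revert a b; decide
  · rw [hp.upper_flipH hi, hp.lower_flipH hi, cmpH]
  · change lexThen (Letter.cmp _ (P.flipV.flipH.upper i)) (Letter.cmp _ (P.flipV.flipH.lower i)) = _
    rw [hp.flipV.upper_flipH hi, hp.flipV.lower_flipH hi, hp.upper_flipV (by omega),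
      hp.lower_flipV (by omega), cmpR]

theorem halfHeight_congr {x y x' y' : ℕ → Letter} {n i : ℕ} (hi : i ≤ n)
    (h : ∀ i < n, x i = x' i ∧ y i = y' i) : halfHeight x y i = halfHeight x' y' i := by
  refine Finset.sum_congr rfl fun j hj => ?_
  rw [Finset.mem_range] at hj
  rw [(h j (by omega)).1, (h j (by omega)).2]

theorem canonicalLetters_congr {x y x' y' : ℕ → Letter} {n : ℕ}
    (h : ∀ i < n, x i = x' i ∧ y i = y' i) :
    CanonicalLetters x y n ↔ CanonicalLetters x' y' n := by
  have h' : ∀ i < n, x (n - 1 - i) = x' (n - 1 - i) ∧ y (n - 1 - i) = y' (n - 1 - i) :=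
    fun i hi => h _ (by omega)
  refine and_congr (not_congr (Eq.congr_left (lexRange_congr fun i hi => ?_)))
    (and_congr (not_congr (Eq.congr_left (lexRange_congr fun i hi => ?_)))
      (not_congr (Eq.congr_left (lexRange_congr fun i hi => ?_))))
  · rw [cmpV, cmpV, (h i hi).1, (h i hi).2]
  · rw [cmpH, cmpH, (h i hi).1, (h i hi).2, (h' i hi).1, (h' i hi).2]
  · rw [cmpR, cmpR, (h i hi).1, (h i hi).2, (h' i hi).1, (h' i hi).2]

/-! ### Letters of canonical representations -/

/-- The letters `x₀ y₀ … xₙ₋₁ yₙ₋₁` form the canonical representation of a connected bipartite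
permutation graph whose number of edges, multiplied by `w`, is `m`. -/
def CanonicalCode (n w m : ℕ) (x y : ℕ → Letter) : Prop :=
  -- A single vertex has a vertical segment, whose letters are `R` above and `L` below; the
  -- criterion by heights does not cover it.
  if n = 1 then x 0 = .R ∧ y 0 = .L ∧ m = 0
  else ValidHeights x y n ∧ CanonicalLetters x y n ∧
    w * ∑ i ∈ Finset.Icc 1 n, halfHeight x y i = m

/-- The interface between graphs and strings. Weight one prescribes the number of edges; weight zero
together with `m = 0` imposes no condition on it. -/
theorem canonicalCode_iff {n : ℕ} (hn : 1 ≤ n) (w m : ℕ) (x y : ℕ → Letter) :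
    CanonicalCode n w m x y ↔ ∃ G : SimpleGraph (Fin n), (IsConnBipPerm G ∧
      w * G.edgeSet.ncard = m) ∧ ∃ P : PermDiagram (Fin n) n, P.IsDiagramOf G ∧ P.Canonical ∧
        ∀ i < n, P.upper i = x i ∧ P.lower i = y i := by
  rw [CanonicalCode]
  split_ifs with h1
  · subst h1
    have hnc : ∀ G : SimpleGraph (Fin 1), G.edgeSet.ncard = 0 := fun G => by
      obtain rfl : G = ⊥ := Subsingleton.elim _ _
      simp
    have hup : ∀ P : PermDiagram (Fin 1) 1, P.upper 0 = .R ∧ P.lower 0 = .L := fun P => by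
      have e1 := Subsingleton.elim P.π₁ (Equiv.refl _)
      have e2 := Subsingleton.elim P.π₂ (Equiv.refl _)
      simp [PermDiagram.upper, PermDiagram.lower, PermDiagram.xLetter, PermDiagram.yLetter, e1, e2]
    constructor
    · rintro ⟨hx, hy, rfl⟩
      let P : PermDiagram (Fin 1) 1 := ⟨Equiv.refl _, Equiv.refl _⟩
      have hP : P.IsDiagramOf ⊥ := PermDiagram.isDiagramOf_iff.2 fun u v => by
        simp [Subsingleton.elim u v]
      have hconn : IsConnBipPerm (⊥ : SimpleGraph (Fin 1)) :=
        ⟨⟨SimpleGraph.Preconnected.of_subsingleton⟩,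
          ⟨SimpleGraph.Coloring.mk (fun _ => 0) (by simp)⟩, P, hP⟩
      obtain ⟨Q, hQ, hc⟩ := PermDiagram.exists_canonical hP
      refine ⟨⊥, ⟨hconn, by simp⟩, Q, hQ, hc, fun i hi => ?_⟩
      obtain rfl : i = 0 := by omega
      rw [hx, hy]
      exact hup Q
    · rintro ⟨G, ⟨-, h⟩, P, -, -, hxy⟩
      rw [hnc] at h
      have := hxy 0 (by omega)
      rw [(hup P).1, (hup P).2] at this
      exact ⟨this.1.symm, this.2.symm, by omega⟩
  · have hn2 : 2 ≤ n := by omega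
    constructor
    · rintro ⟨hv, hc, hm⟩
      obtain ⟨G, P, hG, hP, hxy⟩ := hv.exists_diagram hn2
      refine ⟨G, ⟨hG, ?_⟩, P, hP, ?_, hxy⟩
      · have := hP.sum_halfHeight hG
        rw [Finset.sum_congr rfl fun i hi => halfHeight_congr (Finset.mem_Icc.1 hi).2 hxy] at this
        rw [this] at hm
        exact_mod_cast hm
      · rw [(hP.proper hG.2.1 hG.1 hn2).canonical_iff, canonicalLetters_congr hxy]
        exact hc
    · rintro ⟨G, ⟨hG, hm⟩, P, hP, hc, hxy⟩
      refine ⟨?_, ?_, ?_⟩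
      · have := hP.validHeights hG.1
        rw [ValidHeights, halfHeight_congr le_rfl hxy] at this
        exact ⟨fun i h0 hi => by rw [← halfHeight_congr hi.le hxy]; exact this.1 i h0 hi, this.2⟩
      · rwa [← canonicalLetters_congr hxy, ← (hP.proper hG.2.1 hG.1 hn2).canonical_iff]
      · have := hP.sum_halfHeight hG
        rw [Finset.sum_congr rfl fun i hi => halfHeight_congr (Finset.mem_Icc.1 hi).2 hxy] at this
        rw [this]
        exact_mod_cast hm

/-! ### Alternate strings -/

theorem getElem?_alternate (s : List Letter) {k : ℕ} (hk : k < s.length) :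
    (alternate s)[k]? = s[if k % 2 = 0 then k / 2 else s.length - 1 - k / 2]? := by
  rw [alternate, List.getElem?_ofFn, dif_pos hk]
  split_ifs with h <;> rw [List.getElem?_eq_getElem]

@[simp] theorem length_alternate (s : List Letter) : (alternate s).length = s.length := by
  simp [alternate]

theorem alternate_injective {s s' : List Letter} (h : s.length = s'.length)
    (he : alternate s = alternate s') : s = s' := by
  apply List.ext_getElem? fun k => ?_
  by_cases hk : k < s.length
  · by_cases h2 : 2 * k < s.length
    · have := getElem?_alternate s h2
      rw [he, getElem?_alternate s' (h ▸ h2), if_pos (by omega), if_pos (by omega)] at this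
      rw [show 2 * k / 2 = k by omega] at this
      exact this.symm
    · have h3 : 2 * (s.length - 1 - k) + 1 < s.length := by omega
      have := getElem?_alternate s h3
      rw [he, getElem?_alternate s' (h ▸ h3), if_neg (by omega), if_neg (by omega), ← h,
        show s.length - 1 - (2 * (s.length - 1 - k) + 1) / 2 = k by omega] at this
      exact this.symm
  · rw [List.getElem?_eq_none (by omega), List.getElem?_eq_none (by omega)]

theorem exists_pairStr {n : ℕ} (s : List Letter) (h : s.length = 2 * n) :
    ∃ x y, s = pairStr x y n := by
  refine ⟨fun i => s.getD (2 * i) .L, fun i => s.getD (2 * i + 1) .L, ?_⟩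
  apply List.ext_getElem? fun k => ?_
  by_cases hk : k < 2 * n
  · rw [getElem?_pairStr _ _ _ _ hk]
    split_ifs with h2
    · rw [show 2 * (k / 2) = k by omega, List.getD_eq_getElem _ _ (by omega),
        List.getElem?_eq_getElem]
    · rw [show 2 * (k / 2) + 1 = k by omega, List.getD_eq_getElem _ _ (by omega),
        List.getElem?_eq_getElem]
  · rw [List.getElem?_eq_none (by omega), List.getElem?_eq_none (by simp; omega)]

theorem exists_alternate (w : List Letter) : ∃ s, s.length = w.length ∧ w = alternate s := by
  refine ⟨List.ofFn fun k : Fin w.length => if h : 2 * k.val < w.length then w[2 * k.val]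
    else w[2 * (w.length - 1 - k) + 1]'(by omega), by simp, ?_⟩
  apply List.ext_getElem? fun k => ?_
  by_cases hk : k < w.length
  · rw [getElem?_alternate _ (by simpa using hk), List.getElem?_ofFn, List.length_ofFn]
    rcases Nat.mod_two_eq_zero_or_one k with h1 | h1
    · have e : 2 * (k / 2) = k := by omega
      rw [if_pos h1, dif_pos (by omega)]
      simp only [e, hk, dite_true]
      rw [List.getElem?_eq_getElem]
    · have e : 2 * (w.length - 1 - (w.length - 1 - k / 2)) + 1 = k := by omega
      rw [if_neg (by omega), dif_pos (by omega)]
      simp only [e]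
      rw [dif_neg (by omega), List.getElem?_eq_getElem]
  · rw [List.getElem?_eq_none (by omega), List.getElem?_eq_none (by simp; omega)]

/-- The first `k` groups of four letters of the alternate string of `x₀ y₀ … xₙ₋₁ yₙ₋₁`. -/
def quadStr (x y : ℕ → Letter) (n k : ℕ) : List Letter :=
  (List.range k).flatMap fun i => [x i, y (n - 1 - i), y i, x (n - 1 - i)]

theorem quadStr_succ (x y : ℕ → Letter) (n k : ℕ) :
    quadStr x y n (k + 1) = quadStr x y n k ++ [x k, y (n - 1 - k), y k, x (n - 1 - k)] := by
  simp [quadStr, List.range_succ]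

@[simp] theorem length_quadStr (x y : ℕ → Letter) (n k : ℕ) : (quadStr x y n k).length = 4 * k := by
  induction k with
  | zero => rfl
  | succ k ih => rw [quadStr_succ, List.length_append, ih]; simp; ring

theorem getElem?_quadStr (x y : ℕ → Letter) (n k j : ℕ) (h : j < 4 * k) :
    (quadStr x y n k)[j]? = some (if j % 4 = 0 then x (j / 4) else if j % 4 = 1 then
      y (n - 1 - j / 4) else if j % 4 = 2 then y (j / 4) else x (n - 1 - j / 4)) := by
  induction k with
  | zero => omega
  | succ k ih =>
    rw [quadStr_succ]
    by_cases hk : j < 4 * k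
    · rw [List.getElem?_append_left (by simpa using hk), ih hk]
    · rw [List.getElem?_append_right (by simpa using hk), length_quadStr]
      have h1 : j / 4 = k := by omega
      obtain h2 | h2 | h2 | h2 : j = 4 * k ∨ j = 4 * k + 1 ∨ j = 4 * k + 2 ∨ j = 4 * k + 3 := by
        omega
      all_goals
        rw [h1]
        subst h2
        simp [Nat.add_mod]

theorem getElem?_alternate_pairStr (x y : ℕ → Letter) {n j : ℕ} (h : j < 2 * n) :
    (alternate (pairStr x y n))[j]? = some (if j % 4 = 0 then x (j / 4) else if j % 4 = 1 then
      y (n - 1 - j / 4) else if j % 4 = 2 then y (j / 4) else x (n - 1 - j / 4)) := by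
  rw [getElem?_alternate _ (by simpa using h), length_pairStr]
  rw [getElem?_pairStr _ _ _ _ (by split_ifs <;> omega)]
  obtain h4 | h4 | h4 | h4 : j % 4 = 0 ∨ j % 4 = 1 ∨ j % 4 = 2 ∨ j % 4 = 3 := by omega
  · rw [if_pos (show j % 2 = 0 by omega), if_pos (by omega), if_pos h4,
      show j / 2 / 2 = j / 4 by omega]
  · rw [if_neg (show ¬ j % 2 = 0 by omega), if_neg (by omega), if_neg (by omega), if_pos h4,
      show (2 * n - 1 - j / 2) / 2 = n - 1 - j / 4 by omega]
  · rw [if_pos (show j % 2 = 0 by omega), if_neg (by omega), if_neg (by omega),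
      if_neg (by omega), if_pos h4, show j / 2 / 2 = j / 4 by omega]
  · rw [if_neg (show ¬ j % 2 = 0 by omega), if_pos (by omega), if_neg (by omega),
      if_neg (by omega), if_neg (by omega), show (2 * n - 1 - j / 2) / 2 = n - 1 - j / 4 by omega]

theorem alternate_pairStr_even (x y : ℕ → Letter) (k : ℕ) :
    alternate (pairStr x y (2 * k)) = quadStr x y (2 * k) k := by
  apply List.ext_getElem? fun j => ?_
  by_cases hj : j < 4 * k
  · rw [getElem?_quadStr _ _ _ _ _ hj, getElem?_alternate_pairStr _ _ (by omega)]
  · rw [List.getElem?_eq_none (by simp; omega), List.getElem?_eq_none (by simp; omega)]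

theorem alternate_pairStr_odd (x y : ℕ → Letter) (k : ℕ) :
    alternate (pairStr x y (2 * k + 1)) = quadStr x y (2 * k + 1) k ++ [x k, y k] := by
  apply List.ext_getElem? fun j => ?_
  by_cases hj : j < 4 * k
  · rw [List.getElem?_append_left (by simpa using hj), getElem?_quadStr _ _ _ _ _ hj,
      getElem?_alternate_pairStr _ _ (by omega)]
  · by_cases hj2 : j < 2 * (2 * k + 1)
    · rw [List.getElem?_append_right (by simpa using hj), getElem?_alternate_pairStr _ _ hj2,
        length_quadStr]
      have h1 : j / 4 = k := by omega
      obtain h2 | h2 : j = 4 * k ∨ j = 4 * k + 1 := by omega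
      all_goals
        rw [h1]
        subst h2
        simp [Nat.add_mod]
      rw [show 2 * k - k = k by omega]
    · rw [List.getElem?_eq_none (by simp; omega), List.getElem?_eq_none (by simp; omega)]

theorem alternate_eq_iff {x y x' y' : ℕ → Letter} {n : ℕ} :
    alternate (pairStr x y n) = alternate (pairStr x' y' n) ↔
      ∀ i < n, x i = x' i ∧ y i = y' i := by
  rw [← pairStr_inj]
  exact ⟨fun h => alternate_injective (by simp) h, fun h => by rw [h]⟩

/-- A function on strings that decides the codes of canonical representations decides the alternate
strings of canonical representations. -/
theorem represents_of_code {n : ℕ} (hn : 1 ≤ n) {w m : ℕ} {D : BDD (2 * n)}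
    (hD : ∀ x y, D.Accepts (alternate (pairStr x y n)) ↔ CanonicalCode n w m x y) :
    D.Represents {G | IsConnBipPerm G ∧ w * G.edgeSet.ncard = m} := by
  intro u hu
  obtain ⟨s, hs, rfl⟩ := exists_alternate u
  obtain ⟨x, y, rfl⟩ := exists_pairStr (n := n) s (by rw [hs, hu])
  rw [hD, canonicalCode_iff hn]
  constructor
  · rintro ⟨G, hG, P, hP, hc, hxy⟩
    refine ⟨G, hG, P.str, ⟨P, hP, hc, rfl⟩, ?_⟩
    rw [P.str_eq_pairStr, alternate_eq_iff]
    exact fun i hi => ⟨(hxy i hi).1.symm, (hxy i hi).2.symm⟩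
  · rintro ⟨G, hG, s, ⟨P, hP, hc, rfl⟩, he⟩
    refine ⟨G, hG, P, hP, hc, ?_⟩
    rw [P.str_eq_pairStr, alternate_eq_iff] at he
    exact fun i hi => ⟨(he i hi).1.symm, (he i hi).2.symm⟩

/-! ### An automaton for the alternate canonical strings -/

namespace Letter

/-- `1` for `L`, `0` for `R`. -/
def countL : Letter → ℕ
  | L => 1
  | R => 0

/-- `0` for `L`, `1` for `R`. -/
def countR : Letter → ℕ
  | L => 0
  | R => 1

theorem countL_swap (a : Letter) : a.swap.countL = a.countR := by cases a <;> rfl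

end Letter

/-- The finite part of a state: the outcomes of the comparison of the upper with the lower letters
on the front part and on the back part, of the comparisons with the reversed and the rotated string,
and the letters read since the last complete group of four. -/
structure Control where
  front : SignType
  back : SignType
  rev : SignType
  rot : SignType
  buffer : Option (Letter × Option (Letter × Option Letter))

instance : Finite Control :=
  Finite.of_injective (fun q : Control => (q.front, q.back, q.rev, q.rot, q.buffer)) fun p q h => by
    cases p
    cases q
    simpa using h

/-- A state: half the heights of the front and the back part, and the number of edges so far. -/
structure AutState where
  control : Control
  front : ℕ
  back : ℕ
  edges : ℕ

/-- The control after reading a letter. -/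
def Control.next (q : Control) (c : Letter) : Control :=
  match q.buffer with
  | none => { q with buffer := some (c, none) }
  | some (a, none) => { q with buffer := some (a, some (c, none)) }
  | some (a, some (b, none)) => { q with buffer := some (a, some (b, some c)) }
  -- The group is `a = x k`, `b = y (n - 1 - k)`, `d = y k`, `c = x (n - 1 - k)`. A new front pair
  -- is less significant than the earlier ones, a new back pair more significant, so the two
  -- comparisons are combined in opposite orders.
  | some (a, some (b, some d)) =>
    { front := lexThen q.front (Letter.cmp a d)
      back := lexThen (Letter.cmp c b) q.back
      rev := lexThen q.rev (lexThen (Letter.cmp a c.swap) (Letter.cmp d b.swap))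
      rot := lexThen q.rot (lexThen (Letter.cmp a b.swap) (Letter.cmp d c.swap))
      buffer := none }

/-- The new height, from the old one and a number of letters in a pair; at most `n`. -/
def stepHeight (n k l : ℕ) : ℕ := min n (k + l - 1)

/-- The new number of edges; `m + 1` if it exceeds `m` or a height vanishes. -/
def stepEdges (w m f b e : ℕ) : ℕ :=
  -- The last summand reaches `m + 1` as soon as a height is zero. The value `m + 1` is absorbing
  -- and marks failure.
  min (m + 1) (e + w * (f + b) + (m + 1) * ((1 - f) + (1 - b)))

/-- The height of the front part after reading a letter. -/
def Control.nextFront (n : ℕ) (q : Control) (f : ℕ) : ℕ :=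
  match q.buffer with
  | some (a, some (_, some d)) => stepHeight n f (a.countL + d.countL)
  | _ => f

/-- The height of the back part after reading a letter. -/
def Control.nextBack (n : ℕ) (q : Control) (c : Letter) (b : ℕ) : ℕ :=
  match q.buffer with
  | some (_, some (b', some _)) => stepHeight n b (b'.countR + c.countR)
  | _ => b

/-- The number of edges after reading a letter. -/
def Control.nextEdges (n w m : ℕ) (q : Control) (c : Letter) (f b e : ℕ) : ℕ :=
  match q.buffer with
  | some (_, some (_, some _)) => stepEdges w m (q.nextFront n f) (q.nextBack n c b) e
  | _ => e

/-- The state after reading a letter. -/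
def AutState.next (n w m : ℕ) (S : AutState) (c : Letter) : AutState where
  control := S.control.next c
  front := S.control.nextFront n S.front
  back := S.control.nextBack n c S.back
  edges := S.control.nextEdges n w m c S.front S.back S.edges

/-- No comparison has been lost at the end. -/
def Control.Wins (q : Control) : Prop :=
  lexThen q.front q.back ≠ -1 ∧ q.rev ≠ -1 ∧ q.rot ≠ -1

/-- The control after the two letters in the middle. -/
def Control.middle (q : Control) (a c : Letter) : Control :=
  { front := lexThen q.front (Letter.cmp a c)
    back := q.back
    rev := lexThen q.rev (lexThen (Letter.cmp a a.swap) (Letter.cmp c c.swap))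
    rot := lexThen q.rot (lexThen (Letter.cmp a c.swap) (Letter.cmp c a.swap))
    buffer := none }

/-- Acceptance when the last letter `c` is read. -/
def Control.Final (n w m : ℕ) (q : Control) (c : Letter) (f b e : ℕ) : Prop :=
  match q.buffer with
  -- For even `n` the last letter completes a group. Front and back heights then belong to the same
  -- middle cut, which is counted once.
  | some (_, some (_, some _)) =>
    (q.next c).Wins ∧ 0 < q.nextFront n f ∧ q.nextFront n f = q.nextBack n c b ∧
      e + w * q.nextFront n f = m
  -- For odd `n` two letters remain. The middle pair must lead from the front height to the back
  -- height, and both of these heights are already in the edge count.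
  | some (a, none) =>
    (n = 1 ∧ (a = .R ∧ c = .L) ∧ m = 0) ∨
      (n ≠ 1 ∧ (q.middle a c).Wins ∧ f + (a.countL + c.countL) = b + 1 ∧ e = m)
  | _ => False

/-- Acceptance of a string from a state. -/
def AutState.Accepts (n w m : ℕ) : AutState → List Letter → Prop
  | _, [] => False
  | S, [c] => S.control.Final n w m c S.front S.back S.edges
  | S, c :: d :: u => (S.next n w m c).Accepts n w m (d :: u)

theorem AutState.accepts_append (n w m : ℕ) (S : AutState) (u : List Letter) (c : Letter) :
    S.Accepts n w m (u ++ [c]) ↔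
      let T := u.foldl (AutState.next n w m) S
      T.control.Final n w m c T.front T.back T.edges := by
  induction u generalizing S with
  | nil => rfl
  | cons d u ih =>
    rw [List.foldl_cons, ← ih]
    cases u <;> rfl

/-- The initial state. -/
def AutState.start : AutState := ⟨⟨0, 0, 0, 0, none⟩, 0, 0, 0⟩

/-- The height computed by the automaton after `k` pairs. -/
def autHeight (n : ℕ) (x y : ℕ → Letter) : ℕ → ℕ
  | 0 => 0
  | k + 1 => stepHeight n (autHeight n x y k) ((x k).countL + (y k).countL)

/-- The upper letters of the rotated string. -/
def rotUpper (y : ℕ → Letter) (n i : ℕ) : Letter := (y (n - 1 - i)).swap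

/-- The height of the back part after `k` pairs, read backwards. -/
def autBack (n : ℕ) (x y : ℕ → Letter) : ℕ → ℕ := autHeight n (rotUpper y n) (rotUpper x n)

/-- The number of edges computed by the automaton after `k` groups. -/
def autEdges (n w m : ℕ) (x y : ℕ → Letter) : ℕ → ℕ
  | 0 => 0
  | k + 1 => stepEdges w m (autHeight n x y (k + 1)) (autBack n x y (k + 1)) (autEdges n w m x y k)

/-- The control after `k` groups. -/
def autControl (n : ℕ) (x y : ℕ → Letter) (k : ℕ) : Control where
  front := lexRange (cmpV x y) k
  back := lexRange (fun i => cmpV x y (n - k + i)) k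
  rev := lexRange (cmpH x y n) k
  rot := lexRange (cmpR x y n) k
  buffer := none

theorem back_succ (x y : ℕ → Letter) {n k : ℕ} (hk : k + 1 ≤ n) :
    lexThen (Letter.cmp (x (n - 1 - k)) (y (n - 1 - k)))
      (lexRange (fun i => cmpV x y (n - k + i)) k) =
      lexRange (fun i => cmpV x y (n - (k + 1) + i)) (k + 1) := by
  rw [lexRange_succ']
  simp only [cmpV, show n - 1 - k = n - (k + 1) + 0 by omega]
  congr 1
  refine lexRange_congr fun i hi => ?_
  rw [show n - (k + 1) + (i + 1) = n - k + i by omega]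

theorem foldl_quadStr (n w m : ℕ) (x y : ℕ → Letter) {k : ℕ} (hk : k ≤ n) :
    (quadStr x y n k).foldl (AutState.next n w m) AutState.start =
      ⟨autControl n x y k, autHeight n x y k, autBack n x y k, autEdges n w m x y k⟩ := by
  induction k with
  | zero => rfl
  | succ k ih =>
    rw [quadStr_succ, List.foldl_append, ih (by omega)]
    have hb := back_succ x y hk
    simp only [List.foldl_cons, List.foldl_nil, AutState.next, Control.next, autControl,
      Control.nextFront, Control.nextBack, Control.nextEdges, hb]
    simp only [autEdges, autHeight, autBack, rotUpper, Letter.countL_swap]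
    rfl

/-! ### Correctness of the automaton -/

/-- The height of the rotated string. -/
theorem halfHeight_rot (x y : ℕ → Letter) {n k : ℕ} (hk : k ≤ n) :
    halfHeight (rotUpper y n) (rotUpper x n) k =
      halfHeight x y (n - k) - halfHeight x y n := by
  induction k with
  | zero => simp [halfHeight]
  | succ k ih =>
    have h1 : halfHeight x y (n - k) = halfHeight x y (n - (k + 1)) +
        ((if x (n - 1 - k) = .L then 1 else 0) - (if y (n - 1 - k) = .R then 1 else 0)) := by
      rw [show n - k = n - (k + 1) + 1 by omega, halfHeight, Finset.sum_range_succ,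
        show n - (k + 1) = n - 1 - k by omega]
      rfl
    rw [halfHeight, Finset.sum_range_succ, ← halfHeight, ih (by omega), h1]
    have h2 : ∀ a b : Letter, ((if b.swap = .L then 1 else 0) - (if a.swap = .R then 1 else 0) : ℤ) =
        -((if a = .L then 1 else 0) - (if b = .R then 1 else 0)) := by
      rintro (_ | _) (_ | _) <;> simp [Letter.swap]
    have h3 : ((if rotUpper y n k = .L then 1 else 0) - (if rotUpper x n k = .R then 1 else 0) : ℤ) =
        -((if x (n - 1 - k) = .L then 1 else 0) - (if y (n - 1 - k) = .R then 1 else 0)) := h2 _ _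
    rw [h3]
    ring

theorem halfHeight_succ (x y : ℕ → Letter) (k : ℕ) : halfHeight x y (k + 1) =
    halfHeight x y k + ((x k).countL + (y k).countL : ℕ) - 1 := by
  rw [halfHeight, Finset.sum_range_succ, ← halfHeight]
  cases x k <;> cases y k <;> simp [Letter.countL] <;> ring

theorem halfHeight_le (x y : ℕ → Letter) (k : ℕ) : halfHeight x y k ≤ k := by
  induction k with
  | zero => simp [halfHeight]
  | succ k ih =>
    rw [halfHeight_succ]
    cases x k <;> cases y k <;> simp [Letter.countL] <;> omega

/-- The cap at `n` never acts on true heights, which are at most `k`. Truncation at zero acts only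
on a negative height, so the computed height is exact as long as all earlier ones are positive and
the true one is not negative; this suffices to recognize the first failure. -/
theorem autHeight_spec (n : ℕ) (x y : ℕ → Letter) {k : ℕ} (hk : k ≤ n) :
    ((∀ j, 0 < j → j ≤ k → 0 < autHeight n x y j) ↔
      ∀ j, 0 < j → j ≤ k → 0 < halfHeight x y j) ∧
    ((∀ j, 0 < j → j < k → 0 < autHeight n x y j) → 0 ≤ halfHeight x y k →
      (autHeight n x y k : ℤ) = halfHeight x y k) := by
  induction k with
  | zero =>
    exact ⟨iff_of_true (fun j h0 hj => by omega) (fun j h0 hj => by omega), fun _ _ => by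
      simp [autHeight, halfHeight]⟩
  | succ k ih =>
    obtain ⟨ih1, ih2⟩ := ih (by omega)
    have h0 := halfHeight_succ x y k
    have h1 := halfHeight_le x y (k + 1)
    have h2 : autHeight n x y (k + 1) =
      min n (autHeight n x y k + ((x k).countL + (y k).countL) - 1) := rfl
    have heq : (∀ j, 0 < j → j ≤ k → 0 < autHeight n x y j) →
        (autHeight n x y k : ℤ) = halfHeight x y k := by
      intro h
      refine ih2 (fun j h0 hj => h j h0 hj.le) ?_
      rcases Nat.eq_zero_or_pos k with rfl | hk0
      · simp [halfHeight]
      · exact (ih1.1 h k hk0 le_rfl).le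
    refine ⟨?_, fun h hnn => ?_⟩
    · have split : ∀ p : ℕ → Prop, (∀ j, 0 < j → j ≤ k + 1 → p j) ↔
          (∀ j, 0 < j → j ≤ k → p j) ∧ p (k + 1) := by
        intro p
        refine ⟨fun h => ⟨fun j h0 hj => h j h0 (by omega), h _ (by omega) le_rfl⟩, ?_⟩
        rintro ⟨h1, h2⟩ j h0 hj
        rcases Nat.lt_or_ge k j with h3 | h3
        · rwa [show j = k + 1 by omega]
        · exact h1 j h0 h3
      rw [split, split, ← ih1]
      refine and_congr_right fun h => ?_
      have := heq h
      omega
    · have := heq fun j h0 hj => h j h0 (by omega)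
      omega

/-- Since `m + 1` is absorbing, a count of at most `m` certifies that no height has vanished and
that nothing was cut off. -/
theorem autEdges_spec (n w m : ℕ) (x y : ℕ → Letter) (k : ℕ) :
    (autEdges n w m x y k ≤ m ↔
      (∀ j, 0 < j → j ≤ k → 0 < autHeight n x y j ∧ 0 < autBack n x y j) ∧
      w * ∑ j ∈ Finset.range k, (autHeight n x y (j + 1) + autBack n x y (j + 1)) ≤ m) ∧
    (autEdges n w m x y k ≤ m → autEdges n w m x y k =
      w * ∑ j ∈ Finset.range k, (autHeight n x y (j + 1) + autBack n x y (j + 1))) := by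
  induction k with
  | zero =>
    simp only [autEdges, Finset.range_zero, Finset.sum_empty, mul_zero, Nat.zero_le, and_true,
      true_iff, implies_true]
    exact fun j h0 hj => by omega
  | succ k ih =>
    obtain ⟨ih1, ih2⟩ := ih
    have hE : autEdges n w m x y (k + 1) = stepEdges w m (autHeight n x y (k + 1))
      (autBack n x y (k + 1)) (autEdges n w m x y k) := rfl
    rw [stepEdges] at hE
    rw [Finset.sum_range_succ, mul_add]
    set f := autHeight n x y (k + 1) with hf
    set b := autBack n x y (k + 1) with hb
    set s := w * ∑ j ∈ Finset.range k, (autHeight n x y (j + 1) + autBack n x y (j + 1)) with hs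
    set t := w * (f + b) with ht
    by_cases hpos : 0 < f ∧ 0 < b
    · have h0 : (1 - f) + (1 - b) = 0 := by omega
      rw [h0, mul_zero, add_zero] at hE
      constructor
      · constructor
        · intro h
          have h1 : autEdges n w m x y k ≤ m := by omega
          have h2 := ih2 h1
          refine ⟨fun j hj0 hj => ?_, by omega⟩
          rcases Nat.lt_or_ge k j with h3 | h3
          · rwa [show j = k + 1 by omega]
          · exact (ih1.1 h1).1 j hj0 h3
        · rintro ⟨h1, h2⟩
          have h3 := ih1.2 ⟨fun j hj0 hj => h1 j hj0 (by omega), by omega⟩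
          have := ih2 h3
          omega
      · intro h
        have := ih2 (by omega)
        omega
    · have h0 : 1 ≤ (1 - f) + (1 - b) := by omega
      have h1 : m + 1 ≤ (m + 1) * ((1 - f) + (1 - b)) := Nat.le_mul_of_pos_right _ h0
      have h2 : autEdges n w m x y (k + 1) = m + 1 := by omega
      rw [h2]
      refine ⟨iff_of_false (by omega) fun h => hpos (h.1 (k + 1) (by omega) le_rfl), ?_⟩
      omega

/-- Cuts are paired as the groups of four meet them. The uses leave exactly the middle cut for even
`n` and nothing for odd `n`. -/
theorem sum_Ico_symm (f : ℕ → ℤ) {n k : ℕ} (h : 2 * k + 1 ≤ n) :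
    ∑ j ∈ Finset.Ico 1 n, f j = ∑ j ∈ Finset.range k, (f (j + 1) + f (n - (j + 1))) +
      ∑ j ∈ Finset.Ico (k + 1) (n - k), f j := by
  induction k with
  | zero => simp
  | succ k ih =>
    rw [ih (by omega), Finset.sum_range_succ, Finset.sum_eq_sum_Ico_succ_bot (by omega),
      show n - k = n - (k + 1) + 1 by omega, Finset.sum_Ico_succ_top (by omega)]
    ring

theorem sum_Icc_eq (f : ℕ → ℤ) {n : ℕ} (hn : 1 ≤ n) :
    ∑ i ∈ Finset.Icc 1 n, f i = ∑ i ∈ Finset.Ico 1 n, f i + f n := by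
  rw [← Finset.sum_Ico_succ_top hn]
  rfl

theorem cmp_swap_eq_zero {a b : Letter} : Letter.cmp a b.swap = 0 ↔ Letter.cmp b a.swap = 0 := by
  revert a b; decide

/-- Reversal is an involution, so a tie at pair `i` is a tie at the mirror pair, and the outer pairs
decide. -/
theorem lexRange_cmpH (x y : ℕ → Letter) {n k : ℕ} (hk : k ≤ n) (hn : n ≤ 2 * k) :
    lexRange (cmpH x y n) n = lexRange (cmpH x y n) k := by
  refine lexRange_of_symm hk hn fun i hi h => ?_
  rw [cmpH, lexThen_eq_zero] at h ⊢
  rw [show n - 1 - (n - 1 - i) = i by omega]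
  exact ⟨cmp_swap_eq_zero.1 h.1, cmp_swap_eq_zero.1 h.2⟩

theorem lexRange_cmpR (x y : ℕ → Letter) {n k : ℕ} (hk : k ≤ n) (hn : n ≤ 2 * k) :
    lexRange (cmpR x y n) n = lexRange (cmpR x y n) k := by
  refine lexRange_of_symm hk hn fun i hi h => ?_
  rw [cmpR, lexThen_eq_zero] at h ⊢
  rw [show n - 1 - (n - 1 - i) = i by omega]
  exact ⟨cmp_swap_eq_zero.1 h.2, cmp_swap_eq_zero.1 h.1⟩

/-- After `k` groups, the automaton has computed the heights and the edges of the outer pairs. -/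
theorem autEdges_eq_iff (n w m : ℕ) (x y : ℕ → Letter) {k : ℕ} (hk : k ≤ n)
    (h0 : halfHeight x y n = 0) (t : ℕ) :
    autEdges n w m x y k + t = m ↔
      (∀ j, 0 < j → j ≤ k → 0 < halfHeight x y j ∧ 0 < halfHeight x y (n - j)) ∧
      w * ∑ j ∈ Finset.range k, (halfHeight x y (j + 1) + halfHeight x y (n - (j + 1))) + t
        = (m : ℤ) := by
  have hrot : ∀ j ≤ n, halfHeight (rotUpper y n) (rotUpper x n) j = halfHeight x y (n - j) :=
    fun j hj => by rw [halfHeight_rot _ _ hj, h0, sub_zero]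
  obtain ⟨e1, e2⟩ := autEdges_spec n w m x y k
  have hpos : (∀ j, 0 < j → j ≤ k → 0 < autHeight n x y j ∧ 0 < autBack n x y j) ↔
      ∀ j, 0 < j → j ≤ k → 0 < halfHeight x y j ∧ 0 < halfHeight x y (n - j) := by
    have f1 := (autHeight_spec n x y hk).1
    have f2 := (autHeight_spec n (rotUpper y n) (rotUpper x n) hk).1
    simp only [forall_and]
    rw [f1]
    refine and_congr_right fun _ => f2.trans ?_
    refine forall_congr' fun j => forall_congr' fun _ => forall_congr' fun hj => ?_
    rw [hrot j (by omega)]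
  have hsum : (∀ j, 0 < j → j ≤ k → 0 < autHeight n x y j ∧ 0 < autBack n x y j) →
      ((w * ∑ j ∈ Finset.range k, (autHeight n x y (j + 1) + autBack n x y (j + 1)) : ℕ) : ℤ) =
      w * ∑ j ∈ Finset.range k, (halfHeight x y (j + 1) + halfHeight x y (n - (j + 1))) := by
    intro h
    have h' := hpos.1 h
    push_cast
    congr 1
    refine Finset.sum_congr rfl fun j hj => ?_
    rw [Finset.mem_range] at hj
    have g := h' (j + 1) (by omega) (by omega)
    have g1 := (autHeight_spec n x y (k := j + 1) (by omega)).2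
      (fun i hi hij => (h i hi (by omega)).1) g.1.le
    have g2 := (autHeight_spec n (rotUpper y n) (rotUpper x n) (k := j + 1) (by omega)).2
      (fun i hi hij => (h i hi (by omega)).2) (by rw [hrot _ (by omega)]; exact g.2.le)
    rw [hrot _ (by omega)] at g2
    rw [g1, autBack, g2]
  rw [← hpos]
  constructor
  · intro h
    have h1 : autEdges n w m x y k ≤ m := by omega
    have h2 := (e1.1 h1).1
    refine ⟨h2, ?_⟩
    rw [← hsum h2, ← e2 h1]
    exact_mod_cast h
  · rintro ⟨h1, h2⟩
    rw [← hsum h1] at h2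
    have h3 : w * ∑ j ∈ Finset.range k, (autHeight n x y (j + 1) + autBack n x y (j + 1)) + t = m := by
      exact_mod_cast h2
    have := e2 (e1.2 ⟨h1, by omega⟩)
    omega

/-- The total height stays in the formula because it is known to vanish only after front and back
have been matched. -/
theorem autBack_spec (n : ℕ) (x y : ℕ → Letter) {k : ℕ} (hk : k ≤ n) :
    ((∀ j, 0 < j → j ≤ k → 0 < autBack n x y j) ↔
      ∀ j, 0 < j → j ≤ k → 0 < halfHeight x y (n - j) - halfHeight x y n) ∧
    ((∀ j, 0 < j → j < k → 0 < autBack n x y j) →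
      0 ≤ halfHeight x y (n - k) - halfHeight x y n →
      (autBack n x y k : ℤ) = halfHeight x y (n - k) - halfHeight x y n) := by
  obtain ⟨h1, h2⟩ := autHeight_spec n (rotUpper y n) (rotUpper x n) hk
  rw [halfHeight_rot x y hk] at h2
  refine ⟨h1.trans ?_, h2⟩
  refine forall_congr' fun j => forall_congr' fun _ => forall_congr' fun hj => ?_
  rw [halfHeight_rot x y (by omega)]

theorem autControl_wins_even (x y : ℕ → Letter) (k : ℕ) :
    (autControl (2 * k) x y k).Wins ↔ CanonicalLetters x y (2 * k) := by
  have h : lexRange (cmpV x y) (2 * k) =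
      lexThen (lexRange (cmpV x y) k) (lexRange (fun i => cmpV x y (2 * k - k + i)) k) := by
    rw [show 2 * k - k = k by omega, ← lexRange_add, two_mul]
  rw [Control.Wins, CanonicalLetters, h, lexRange_cmpH x y (k := k) (by omega) (by omega),
    lexRange_cmpR x y (k := k) (by omega) (by omega)]
  rfl

theorem autControl_wins_odd (x y : ℕ → Letter) (k : ℕ) :
    ((autControl (2 * k + 1) x y k).middle (x k) (y k)).Wins ↔
      CanonicalLetters x y (2 * k + 1) := by
  have h : lexRange (cmpV x y) (2 * k + 1) = lexThen (lexThen (lexRange (cmpV x y) k)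
      (Letter.cmp (x k) (y k))) (lexRange (fun i => cmpV x y (2 * k + 1 - k + i)) k) := by
    rw [show 2 * k + 1 - k = k + 1 by omega, show 2 * k + 1 = k + 1 + k by omega, lexRange_add]
    rfl
  rw [Control.Wins, CanonicalLetters, h, lexRange_cmpH x y (k := k + 1) (by omega) (by omega),
    lexRange_cmpR x y (k := k + 1) (by omega) (by omega), lexRange, lexRange, cmpH, cmpR,
    show 2 * k + 1 - 1 - k = k by omega]
  rfl

theorem accepts_even (w m : ℕ) (x y : ℕ → Letter) (j : ℕ) :
    AutState.start.Accepts (2 * (j + 1)) w m (alternate (pairStr x y (2 * (j + 1)))) ↔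
      CanonicalCode (2 * (j + 1)) w m x y := by
  set n := 2 * (j + 1) with hn
  have hrun : AutState.start.Accepts n w m (alternate (pairStr x y n)) ↔
      (autControl n x y (j + 1)).Wins ∧ 0 < autHeight n x y (j + 1) ∧
        autHeight n x y (j + 1) = autBack n x y (j + 1) ∧
        autEdges n w m x y j + w * autHeight n x y (j + 1) = m := by
    have hsplit : quadStr x y n (j + 1) =
        (quadStr x y n j ++ [x j, y (n - 1 - j), y j]) ++ [x (n - 1 - j)] := by
      rw [quadStr_succ]
      simp
    have hb := back_succ x y (n := n) (k := j) (by omega)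
    rw [hn, alternate_pairStr_even, ← hn, hsplit, AutState.accepts_append, List.foldl_append,
      foldl_quadStr n w m x y (by omega)]
    simp only [List.foldl_cons, List.foldl_nil, AutState.next, Control.next, autControl,
      Control.nextFront, Control.nextBack, Control.nextEdges, Control.Final, hb]
    simp only [autHeight, autBack, rotUpper, Letter.countL_swap]
    rfl
  rw [hrun, hn, autControl_wins_even, ← hn, CanonicalCode, if_neg (by omega)]
  have hsum := sum_Ico_symm (halfHeight x y) (n := n) (k := j) (by omega)
  rw [show n - j = j + 1 + 1 by omega, Nat.Ico_succ_singleton, Finset.sum_singleton] at hsum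
  rw [sum_Icc_eq _ (by omega), hsum]
  have hmid : n - (j + 1) = j + 1 := by omega
  obtain ⟨f1, f2⟩ := autHeight_spec n x y (k := j + 1) (by omega)
  obtain ⟨b1, b2⟩ := autBack_spec n x y (k := j + 1) (by omega)
  rw [hmid] at b2
  constructor
  · rintro ⟨hw, hpos, heq, he⟩
    have hle := ((autEdges_spec n w m x y j).1.1 (by omega)).1
    have hf : ∀ i, 0 < i → i ≤ j + 1 → 0 < autHeight n x y i := by
      intro i hi hij
      rcases Nat.lt_or_ge j i with h | h
      · rwa [show i = j + 1 by omega]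
      · exact (hle i hi h).1
    have hbk : ∀ i, 0 < i → i ≤ j + 1 → 0 < autBack n x y i := by
      intro i hi hij
      rcases Nat.lt_or_ge j i with h | h
      · rwa [show i = j + 1 by omega, ← heq]
      · exact (hle i hi h).2
    have hf' := f1.1 hf
    have hb' := b1.1 hbk
    have e1 := f2 (fun i h0 hi => hf i h0 hi.le) (hf' _ (by omega) le_rfl).le
    have e2 := b2 (fun i h0 hi => hbk i h0 hi.le) (by
      have := hb' (j + 1) (by omega) le_rfl
      rw [hmid] at this
      exact this.le)
    -- The back height is the height at the middle minus the total height, and the front height is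
    -- the height at the middle; their equality makes the total zero.
    have hend : halfHeight x y n = 0 := by omega
    have he' := ((autEdges_eq_iff n w m x y (k := j) (by omega) hend _).1 he).2
    refine ⟨⟨fun i h0 hi => ?_, hend⟩, hw, ?_⟩
    · rcases Nat.lt_or_ge (j + 1) i with h | h
      · have := hb' (n - i) (by omega) (by omega)
        rw [hend, show n - (n - i) = i by omega] at this
        omega
      · exact hf' i h0 h
    · rw [hend, add_zero, mul_add, ← he', ← e1]
      push_cast
      ring
  · rintro ⟨⟨hpos, hend⟩, hw, hm⟩
    have hf' : ∀ i, 0 < i → i ≤ j + 1 → 0 < halfHeight x y i := fun i h0 hi =>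
      hpos i h0 (by omega)
    have hb' : ∀ i, 0 < i → i ≤ j + 1 → 0 < halfHeight x y (n - i) - halfHeight x y n := by
      intro i h0 hi
      rw [hend, sub_zero]
      exact hpos _ (by omega) (by omega)
    have hf := f1.2 hf'
    have hbk := b1.2 hb'
    have e1 := f2 (fun i h0 hi => hf i h0 hi.le) (hf' _ (by omega) le_rfl).le
    have e2 := b2 (fun i h0 hi => hbk i h0 hi.le) (by
      have := hpos (j + 1) (by omega) (by omega)
      omega)
    refine ⟨hw, hf _ (by omega) le_rfl, by omega, ?_⟩
    refine (autEdges_eq_iff n w m x y (k := j) (by omega) hend _).2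
      ⟨fun i h0 hi => ⟨hpos _ h0 (by omega), hpos _ (by omega) (by omega)⟩, ?_⟩
    rw [← hm, hend, add_zero, mul_add, ← e1]
    push_cast
    ring

theorem accepts_odd (w m : ℕ) (x y : ℕ → Letter) (k : ℕ) :
    AutState.start.Accepts (2 * k + 1) w m (alternate (pairStr x y (2 * k + 1))) ↔
      CanonicalCode (2 * k + 1) w m x y := by
  set n := 2 * k + 1 with hn
  have hrun : AutState.start.Accepts n w m (alternate (pairStr x y n)) ↔
      (n = 1 ∧ (x k = .R ∧ y k = .L) ∧ m = 0) ∨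
      (n ≠ 1 ∧ ((autControl n x y k).middle (x k) (y k)).Wins ∧
        autHeight n x y k + ((x k).countL + (y k).countL) = autBack n x y k + 1 ∧
        autEdges n w m x y k = m) := by
    have hsplit : quadStr x y n k ++ [x k, y k] = (quadStr x y n k ++ [x k]) ++ [y k] := by simp
    rw [hn, alternate_pairStr_odd, ← hn, hsplit, AutState.accepts_append, List.foldl_append,
      foldl_quadStr n w m x y (by omega)]
    rfl
  rw [hrun, CanonicalCode]
  split_ifs with h1
  · obtain rfl : k = 0 := by omega
    simp [h1, and_assoc]
  simp only [h1, false_and, false_or, ne_eq, not_false_eq_true, true_and]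
  rw [hn, autControl_wins_odd, ← hn]
  have hsum := sum_Ico_symm (halfHeight x y) (n := n) (k := k) (by omega)
  rw [show n - k = k + 1 by omega, Finset.Ico_self, Finset.sum_empty, add_zero] at hsum
  rw [sum_Icc_eq _ (by omega), hsum]
  have hmid : n - k = k + 1 := by omega
  obtain ⟨f1, f2⟩ := autHeight_spec n x y (k := k) (by omega)
  obtain ⟨b1, b2⟩ := autBack_spec n x y (k := k) (by omega)
  rw [hmid] at b2
  have hs := halfHeight_succ x y k
  constructor
  · rintro ⟨hw, heq, he⟩
    have hle := ((autEdges_spec n w m x y k).1.1 (by omega)).1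
    have hf' := f1.1 fun i h0 hi => (hle i h0 hi).1
    have hb' := b1.1 fun i h0 hi => (hle i h0 hi).2
    have e1 := f2 (fun i h0 hi => (hle i h0 hi.le).1) (hf' _ (by omega) le_rfl).le
    have e2 := b2 (fun i h0 hi => (hle i h0 hi.le).2) (by
      have := hb' k (by omega) le_rfl
      rw [hmid] at this
      exact this.le)
    -- By `heq`, the height after the middle pair equals the back height, which is that same height
    -- minus the total.
    have hend : halfHeight x y n = 0 := by omega
    have he' := ((autEdges_eq_iff n w m x y (k := k) (by omega) hend 0).1 he).2
    refine ⟨⟨fun i h0 hi => ?_, hend⟩, hw, ?_⟩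
    · rcases Nat.lt_or_ge k i with h | h
      · have := hb' (n - i) (by omega) (by omega)
        rw [hend, show n - (n - i) = i by omega] at this
        omega
      · exact hf' i h0 h
    · rw [hend, add_zero, ← he']
      simp
  · rintro ⟨⟨hpos, hend⟩, hw, hm⟩
    have hf' : ∀ i, 0 < i → i ≤ k → 0 < halfHeight x y i := fun i h0 hi =>
      hpos i h0 (by omega)
    have hb' : ∀ i, 0 < i → i ≤ k → 0 < halfHeight x y (n - i) - halfHeight x y n := by
      intro i h0 hi
      rw [hend, sub_zero]
      exact hpos _ (by omega) (by omega)
    have hf := f1.2 hf'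
    have hbk := b1.2 hb'
    have e1 := f2 (fun i h0 hi => hf i h0 hi.le) (hf' _ (by omega) le_rfl).le
    have e2 := b2 (fun i h0 hi => hbk i h0 hi.le) (by
      have := hpos (k + 1) (by omega) (by omega)
      omega)
    refine ⟨hw, by omega, ?_⟩
    refine (autEdges_eq_iff n w m x y (k := k) (by omega) hend 0).2
      ⟨fun i h0 hi => ⟨hpos _ h0 (by omega), hpos _ (by omega) (by omega)⟩, ?_⟩
    rw [← hm, hend, add_zero]
    simp

/-- The automaton accepts the alternate strings of the canonical representations. -/
theorem accepts_iff_canonicalCode {n : ℕ} (hn : 1 ≤ n) (w m : ℕ) (x y : ℕ → Letter) :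
    AutState.start.Accepts n w m (alternate (pairStr x y n)) ↔ CanonicalCode n w m x y := by
  rcases Nat.even_or_odd' n with ⟨k, rfl | rfl⟩
  · obtain ⟨j, rfl⟩ : ∃ j, k = j + 1 := ⟨k - 1, by omega⟩
    exact accepts_even w m x y j
  · exact accepts_odd w m x y k

/-! ### The BDD of the automaton -/

theorem Control.nextFront_le {n f : ℕ} (q : Control) (h : f ≤ n) : q.nextFront n f ≤ n := by
  rw [Control.nextFront]
  split
  · exact min_le_left _ _
  · exact h

theorem Control.nextBack_le {n b : ℕ} (q : Control) (c : Letter) (h : b ≤ n) :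
    q.nextBack n c b ≤ n := by
  rw [Control.nextBack]
  split
  · exact min_le_left _ _
  · exact h

theorem Control.nextEdges_le {n w m f b e : ℕ} (q : Control) (c : Letter) (h : e ≤ m + 1) :
    q.nextEdges n w m c f b e ≤ m + 1 := by
  rw [Control.nextEdges]
  split
  · exact min_le_left _ _
  · exact h

instance : Nonempty Control := ⟨AutState.start.control⟩

/-- The number of controls. -/
noncomputable def numControls : ℕ := Nat.card Control

theorem numControls_pos : 0 < numControls := Nat.card_pos

/-- A numbering of the controls. -/
noncomputable def controlEquiv : Control ≃ Fin numControls := Finite.equivFin Control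

/-- The control with a given number. -/
noncomputable def controlOfNat (i : ℕ) : Control :=
  -- Reduction extracts the control directly from the number of a node, whose last digit it is.
  controlEquiv.symm ⟨i % numControls, Nat.mod_lt _ numControls_pos⟩

/-- The number of the block of the nodes at level `r + 2` with the given heights and edges. -/
def blockIndex (n m r f b e : ℕ) : ℕ := ((r * (n + 1) + f) * (n + 1) + b) * (m + 2) + e

/-- The number of nodes. -/
noncomputable def numNodes (n m : ℕ) : ℕ :=
  -- The root, and on each of the other `2 * n - 1` levels one node for each control, each pair of
  -- heights up to `n` and each edge count up to `m + 1`, reachable or not.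
  1 + (2 * n - 1) * (n + 1) * (n + 1) * (m + 2) * numControls

/-- The node at level `r + 2` for a given state. -/
noncomputable def nodeIndex (n m r : ℕ) (S : AutState) : ℕ :=
  1 + (blockIndex n m r S.front S.back S.edges * numControls + controlEquiv S.control)

/-- The level, minus two, of the nodes of a block. -/
def blockLevel (n m i : ℕ) : ℕ := i / (m + 2) / (n + 1) / (n + 1)

/-- The state of a node of a block. -/
def blockState (n m i : ℕ) (q : Control) : AutState :=
  ⟨q, i / (m + 2) / (n + 1) % (n + 1), i / (m + 2) % (n + 1), i % (m + 2)⟩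

/-- The level of a node, minus one. -/
noncomputable def nodeDepth (n m : ℕ) : ℕ → ℕ
  | 0 => 0
  | u + 1 => blockLevel n m (u / numControls) + 1

/-- The state of a node. -/
noncomputable def nodeState (n m : ℕ) : ℕ → AutState
  | 0 => AutState.start
  | u + 1 => blockState n m (u / numControls) (controlOfNat u)

/-- The counters of a state are in range. -/
structure AutState.InRange (n m : ℕ) (S : AutState) : Prop where
  front_le : S.front ≤ n
  back_le : S.back ≤ n
  edges_le : S.edges ≤ m + 1

theorem AutState.InRange.next {n m : ℕ} {S : AutState} (h : S.InRange n m) (w : ℕ) (c : Letter) :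
    (S.next n w m c).InRange n m :=
  ⟨S.control.nextFront_le h.1, S.control.nextBack_le c h.2, S.control.nextEdges_le c h.3⟩

theorem nodeState_inRange (n m u : ℕ) : (nodeState n m u).InRange n m := by
  cases u with
  | zero => exact ⟨Nat.zero_le _, Nat.zero_le _, Nat.zero_le _⟩
  | succ u =>
    exact ⟨Nat.le_of_lt_succ (Nat.mod_lt _ (Nat.succ_pos _)),
      Nat.le_of_lt_succ (Nat.mod_lt _ (Nat.succ_pos _)),
      Nat.le_of_lt_succ (Nat.mod_lt _ (Nat.succ_pos _))⟩

theorem mul_add_div_of_lt {a k b : ℕ} (h : b < k) : (a * k + b) / k = a := by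
  rw [Nat.add_comm, Nat.add_mul_div_right _ _ (by omega), Nat.div_eq_of_lt h, Nat.zero_add]

theorem mul_add_mod_of_lt {a k b : ℕ} (h : b < k) : (a * k + b) % k = b := by
  rw [Nat.add_comm, Nat.add_mul_mod_self_right, Nat.mod_eq_of_lt h]

theorem blockLevel_blockIndex {n m r f b e : ℕ} (hf : f ≤ n) (hb : b ≤ n) (he : e ≤ m + 1) :
    blockLevel n m (blockIndex n m r f b e) = r := by
  rw [blockLevel, blockIndex, mul_add_div_of_lt (by omega), mul_add_div_of_lt (by omega),
    mul_add_div_of_lt (by omega)]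

theorem blockState_blockIndex {n m r f b e : ℕ} (hf : f ≤ n) (hb : b ≤ n) (he : e ≤ m + 1)
    (q : Control) : blockState n m (blockIndex n m r f b e) q = ⟨q, f, b, e⟩ := by
  rw [blockState, blockIndex, mul_add_div_of_lt (by omega), mul_add_div_of_lt (by omega),
    mul_add_mod_of_lt (by omega), mul_add_mod_of_lt (by omega), mul_add_mod_of_lt (by omega)]

theorem nodeDepth_nodeIndex {n m r : ℕ} {S : AutState} (h : S.InRange n m) :
    nodeDepth n m (nodeIndex n m r S) = r + 1 := by
  rw [nodeIndex, Nat.add_comm 1, nodeDepth, mul_add_div_of_lt (controlEquiv S.control).2,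
    blockLevel_blockIndex h.1 h.2 h.3]

theorem nodeState_nodeIndex {n m r : ℕ} {S : AutState} (h : S.InRange n m) :
    nodeState n m (nodeIndex n m r S) = S := by
  have : controlOfNat (blockIndex n m r S.front S.back S.edges * numControls +
      controlEquiv S.control) = S.control := by
    rw [controlOfNat, Equiv.symm_apply_eq]
    exact Fin.ext (mul_add_mod_of_lt (controlEquiv S.control).2)
  rw [nodeIndex, Nat.add_comm 1, nodeState, mul_add_div_of_lt (controlEquiv S.control).2, this,
    blockState_blockIndex h.1 h.2 h.3]

theorem mul_add_lt_mul {a b k l : ℕ} (ha : a < l) (hb : b < k) : a * k + b < l * k := by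
  calc a * k + b < a * k + k := by omega
    _ = (a + 1) * k := by ring
    _ ≤ l * k := Nat.mul_le_mul_right _ ha

theorem nodeIndex_lt {n m r : ℕ} {S : AutState} (h : S.InRange n m) (hr : r < 2 * n - 1) :
    nodeIndex n m r S < numNodes n m := by
  rw [nodeIndex, numNodes]
  refine Nat.add_lt_add_left (mul_add_lt_mul ?_ (controlEquiv S.control).2) 1
  refine mul_add_lt_mul (mul_add_lt_mul (mul_add_lt_mul hr ?_) ?_) ?_
  exacts [Nat.lt_succ_of_le h.1, Nat.lt_succ_of_le h.2, Nat.lt_succ_of_le h.3]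

theorem nodeDepth_lt {n m u : ℕ} (hn : 1 ≤ n) (hu : u < numNodes n m) :
    nodeDepth n m u < 2 * n := by
  cases u with
  | zero => rw [nodeDepth]; omega
  | succ u =>
    have hu' : u < (2 * n - 1) * (n + 1) * (n + 1) * (m + 2) * numControls := by
      rw [numNodes] at hu
      omega
    rw [nodeDepth, blockLevel]
    have : u / numControls / (m + 2) / (n + 1) / (n + 1) < 2 * n - 1 := by
      refine Nat.div_lt_of_lt_mul ?_
      rw [Nat.mul_comm]
      refine Nat.div_lt_of_lt_mul ?_
      rw [Nat.mul_comm]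
      refine Nat.div_lt_of_lt_mul ?_
      rw [Nat.mul_comm]
      refine Nat.div_lt_of_lt_mul ?_
      rwa [Nat.mul_comm]
    omega

open Classical in
/-- The BDD of the automaton. -/
noncomputable def autBDD (n w m : ℕ) (hn : 1 ≤ n) : BDD (2 * n) where
  size := numNodes n m
  level u := nodeDepth n m u + 1
  root := ⟨0, by rw [numNodes]; omega⟩
  arc u c :=
    if h : nodeDepth n m u + 1 = 2 * n then
      Sum.inr (decide ((nodeState n m u).Accepts n w m [c]))
    else Sum.inl ⟨nodeIndex n m (nodeDepth n m u) ((nodeState n m u).next n w m c),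
      nodeIndex_lt ((nodeState_inRange n m u).next w c) (by
        have := nodeDepth_lt hn u.2
        omega)⟩
  one_le_level u := Nat.le_add_left _ _
  level_le u := nodeDepth_lt hn u.2
  level_eq_one_iff u := by
    obtain ⟨u, hu⟩ := u
    rw [Fin.mk.injEq]
    cases u <;> simp [nodeDepth]
  level_arc u c v h := by
    split_ifs at h
    rw [← Sum.inl.inj h, nodeDepth_nodeIndex ((nodeState_inRange n m u).next w c)]

/-- The length of the unread string is tied to the depth of the node, so the last letter is read
exactly at the last level, where the arcs lead to terminals. -/
theorem autBDD_follow {n w m : ℕ} (hn : 1 ≤ n) (s : List Letter) (u : Fin (numNodes n m))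
    (hs : s.length + nodeDepth n m u = 2 * n) :
    (autBDD n w m hn).follow (Sum.inl u) s = true ↔ (nodeState n m u).Accepts n w m s := by
  induction s generalizing u with
  | nil =>
    have := nodeDepth_lt hn u.2
    simp only [List.length_nil] at hs
    omega
  | cons c s ih =>
    have hstep : (autBDD n w m hn).follow (Sum.inl u) (c :: s) =
        (autBDD n w m hn).follow ((autBDD n w m hn).arc u c) s := rfl
    rw [hstep]
    simp only [List.length_cons] at hs
    cases s with
    | nil =>
      have h : nodeDepth n m u + 1 = 2 * n := by simpa [Nat.add_comm] using hs
      simp [autBDD, h, BDD.follow]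
    | cons d s =>
      have h : ¬ nodeDepth n m u + 1 = 2 * n := by simp only [List.length_cons] at hs; omega
      have hr := (nodeState_inRange n m u).next w c
      have harc : (autBDD n w m hn).arc u c =
          Sum.inl ⟨nodeIndex n m (nodeDepth n m u) ((nodeState n m u).next n w m c),
            nodeIndex_lt hr (by have := nodeDepth_lt hn u.2; omega)⟩ := by
        simp only [autBDD]
        rw [dif_neg h]
      rw [harc]
      refine (ih _ ?_).trans ?_
      · rw [nodeDepth_nodeIndex hr]
        omega
      · rw [nodeState_nodeIndex hr]
        rfl

theorem autBDD_represents {n : ℕ} (hn : 1 ≤ n) (w m : ℕ) :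
    (autBDD n w m hn).Represents {G | IsConnBipPerm G ∧ w * G.edgeSet.ncard = m} := by
  refine represents_of_code hn fun x y => ?_
  rw [← accepts_iff_canonicalCode hn]
  exact autBDD_follow hn (alternate (pairStr x y n)) ⟨0, by rw [numNodes]; omega⟩
    (by simp [nodeDepth])

/-! ### The table of the BDD as a sequence of words -/

open Classical in
/-- The word that describes the arc of a node in a given depth. -/
noncomputable def arcWord (n w m r : ℕ) (S : AutState) (c : Letter) : ℕ :=
  if r + 1 = 2 * n then if S.Accepts n w m [c] then 1 else 0
  else nodeIndex n m r (S.next n w m c) + 2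

/-- The three words that describe a node. -/
noncomputable def nodeWord (n w m r : ℕ) (S : AutState) (j : ℕ) : ℕ :=
  if j = 0 then r + 1 else arcWord n w m r S (if j = 1 then .L else .R)

/-- The table of the BDD. -/
noncomputable def tableWord (n w m a : ℕ) : ℕ :=
  nodeWord n w m (nodeDepth n m (a / 3)) (nodeState n m (a / 3)) (a % 3)

theorem targetWord_autBDD {n : ℕ} (hn : 1 ≤ n) (w m : ℕ) (u : Fin (numNodes n m)) (c : Letter) :
    (autBDD n w m hn).targetWord ((autBDD n w m hn).arc u c) =
      arcWord n w m (nodeDepth n m u) (nodeState n m u) c := by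
  simp only [autBDD, arcWord]
  split_ifs with h1 h2
  · simp [h2, BDD.targetWord]
  · simp [h2, BDD.targetWord]
  · rfl

theorem holds_autBDD {n : ℕ} (hn : 1 ≤ n) (w m : ℕ) {σ : RAMState} (h0 : σ.reg 0 = numNodes n m)
    (h1 : σ.reg 1 = 0) (h2 : σ.reg 2 = 0)
    (hmem : ∀ a < 3 * numNodes n m, σ.mem a = tableWord n w m a) : σ.Holds (autBDD n w m hn) := by
  refine ⟨h0, h2, fun u => ?_⟩
  have hu : u.val < numNodes n m := u.2
  have e1 : 3 * u.val / 3 = u := by omega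
  have e2 : (3 * u.val + 1) / 3 = u := by omega
  have e3 : (3 * u.val + 2) / 3 = u := by omega
  rw [h1, Nat.zero_add]
  refine ⟨(hmem _ (by omega)).trans ?_,
    ((hmem _ (by omega)).trans ?_).trans (targetWord_autBDD hn w m u .L).symm,
    ((hmem _ (by omega)).trans ?_).trans (targetWord_autBDD hn w m u .R).symm⟩
  · rw [tableWord, e1, show 3 * u.val % 3 = 0 by omega]
    rfl
  · rw [tableWord, e2, show (3 * u.val + 1) % 3 = 1 by omega]
    rfl
  · rw [tableWord, e3, show (3 * u.val + 2) % 3 = 2 by omega]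
    rfl

/-! ### Straight-line programs from expressions -/

/-- Arithmetic expressions over the registers; subtraction is truncated. -/
inductive RAMExp : Type
  | const (k : ℕ)
  | reg (r : ℕ)
  | add (a b : RAMExp)
  | sub (a b : RAMExp)
  | mul (a b : RAMExp)

namespace RAMExp

/-- The value of an expression. -/
def eval (ρ : ℕ → ℕ) : RAMExp → ℕ
  | const k => k
  | reg r => ρ r
  | add a b => a.eval ρ + b.eval ρ
  | sub a b => a.eval ρ - b.eval ρ
  | mul a b => a.eval ρ * b.eval ρ

/-- Only registers below `d` occur. -/
def Below (d : ℕ) : RAMExp → Prop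
  | const _ => True
  | reg r => r < d
  | add a b => a.Below d ∧ b.Below d
  | sub a b => a.Below d ∧ b.Below d
  | mul a b => a.Below d ∧ b.Below d

theorem Below.mono {d d' : ℕ} {e : RAMExp} (h : e.Below d) (hd : d ≤ d') : e.Below d' := by
  induction e with
  | const k => trivial
  | reg r => exact lt_of_lt_of_le h hd
  | add a b iha ihb => exact ⟨iha h.1, ihb h.2⟩
  | sub a b iha ihb => exact ⟨iha h.1, ihb h.2⟩
  | mul a b iha ihb => exact ⟨iha h.1, ihb h.2⟩

/-- The values of all subexpressions are smaller than `W`. -/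
def Small (W : ℕ) (ρ : ℕ → ℕ) : RAMExp → Prop
  | const k => k < W
  | reg r => ρ r < W
  | add a b => a.Small W ρ ∧ b.Small W ρ ∧ a.eval ρ + b.eval ρ < W
  | sub a b => a.Small W ρ ∧ b.Small W ρ
  | mul a b => a.Small W ρ ∧ b.Small W ρ ∧ a.eval ρ * b.eval ρ < W

/-- The program that evaluates an expression into register `d`, with the registers from `d` on as
scratch space. -/
def code : ℕ → RAMExp → RAMProg
  | d, const k => .instr (.const d k)
  | d, reg r => .instr (.copy d r)
  | d, add a b => .seq (.seq (a.code d) (b.code (d + 1))) (.instr (.add d d (d + 1)))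
  | d, sub a b => .seq (.seq (a.code d) (b.code (d + 1))) (.instr (.sub d d (d + 1)))
  | d, mul a b => .seq (.seq (a.code d) (b.code (d + 1))) (.instr (.mul d d (d + 1)))

/-- The running time of the code of an expression. -/
def time : RAMExp → ℕ
  | const _ => 1
  | reg _ => 1
  | add a b => a.time + b.time + 1
  | sub a b => a.time + b.time + 1
  | mul a b => a.time + b.time + 1

/-- An exponent that bounds the values of the subexpressions, see `small_of_lt`. -/
def cost : RAMExp → ℕ
  -- The additional one keeps the cost positive for the constant zero, so that `B ^ cost` is always
  -- at least 2.
  | const k => k + 1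
  | reg _ => 1
  | add a b => a.cost + b.cost
  | sub a b => a.cost + b.cost
  | mul a b => a.cost + b.cost

theorem cost_pos (e : RAMExp) : 1 ≤ e.cost := by
  induction e with
  | const k => exact Nat.le_add_left _ _
  | reg r => exact le_rfl
  | add a b iha ihb => exact le_add_right iha
  | sub a b iha ihb => exact le_add_right iha
  | mul a b iha ihb => exact le_add_right iha

theorem eval_congr {d : ℕ} {ρ ρ' : ℕ → ℕ} {e : RAMExp} (he : e.Below d)
    (h : ∀ r < d, ρ r = ρ' r) : e.eval ρ = e.eval ρ' := by
  induction e with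
  | const k => rfl
  | reg r => exact h r he
  | add a b iha ihb => rw [eval, eval, iha he.1, ihb he.2]
  | sub a b iha ihb => rw [eval, eval, iha he.1, ihb he.2]
  | mul a b iha ihb => rw [eval, eval, iha he.1, ihb he.2]

theorem small_congr {W d : ℕ} {ρ ρ' : ℕ → ℕ} {e : RAMExp} (he : e.Below d)
    (h : ∀ r < d, ρ r = ρ' r) : e.Small W ρ ↔ e.Small W ρ' := by
  induction e with
  | const k => rfl
  | reg r => rw [Small, Small, h r he]
  | add a b iha ihb =>
    rw [Small, Small, iha he.1, ihb he.2, eval_congr he.1 h, eval_congr he.2 h]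
  | sub a b iha ihb => rw [Small, Small, iha he.1, ihb he.2]
  | mul a b iha ihb =>
    rw [Small, Small, iha he.1, ihb he.2, eval_congr he.1 h, eval_congr he.2 h]

theorem Small.eval_lt {W : ℕ} {ρ : ℕ → ℕ} {e : RAMExp} (h : e.Small W ρ) : e.eval ρ < W := by
  induction e with
  | const k => exact h
  | reg r => exact h
  | add a b iha ihb => exact h.2.2
  | sub a b iha ihb => exact lt_of_le_of_lt (Nat.sub_le _ _) (iha h.1)
  | mul a b iha ihb => exact h.2.2

theorem Small.mono {W W' : ℕ} {ρ : ℕ → ℕ} {e : RAMExp} (h : e.Small W ρ) (hW : W ≤ W') :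
    e.Small W' ρ := by
  induction e with
  | const k => exact lt_of_lt_of_le h hW
  | reg r => exact lt_of_lt_of_le h hW
  | add a b iha ihb => exact ⟨iha h.1, ihb h.2.1, h.2.2.trans_le hW⟩
  | sub a b iha ihb => exact ⟨iha h.1, ihb h.2⟩
  | mul a b iha ihb => exact ⟨iha h.1, ihb h.2.1, h.2.2.trans_le hW⟩

/-- Values are polynomial in the contents of the registers. -/
theorem small_of_lt {B d : ℕ} (hB : 2 ≤ B) {ρ : ℕ → ℕ} (hρ : ∀ r < d, ρ r < B) {e : RAMExp}
    (he : e.Below d) : e.Small (B ^ e.cost) ρ := by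
  have hmono : ∀ {a b : ℕ}, a ≤ b → B ^ a ≤ B ^ b := fun h => Nat.pow_le_pow_right (by omega) h
  have htwo : ∀ e : RAMExp, 2 ≤ B ^ e.cost := fun e =>
    hB.trans (by simpa using hmono e.cost_pos)
  induction e with
  | const k =>
    exact lt_of_lt_of_le (Nat.lt_pow_self (by omega)) (hmono (Nat.le_succ k))
  | reg r => simpa [Small, cost] using hρ r he
  | add a b iha ihb =>
    have ha := iha he.1
    have hb := ihb he.2
    refine ⟨ha.mono (hmono (Nat.le_add_right _ _)), hb.mono (hmono (Nat.le_add_left _ _)), ?_⟩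
    have h1 := ha.eval_lt
    have h2 := hb.eval_lt
    rw [cost, pow_add]
    -- For bounds that are at least 2, the sum is at most the product.
    nlinarith [htwo a, htwo b]
  | sub a b iha ihb =>
    exact ⟨(iha he.1).mono (hmono (Nat.le_add_right _ _)),
      (ihb he.2).mono (hmono (Nat.le_add_left _ _))⟩
  | mul a b iha ihb =>
    have ha := iha he.1
    have hb := ihb he.2
    refine ⟨ha.mono (hmono (Nat.le_add_right _ _)), hb.mono (hmono (Nat.le_add_left _ _)), ?_⟩
    rw [cost, pow_add]
    exact Nat.mul_lt_mul'' ha.eval_lt hb.eval_lt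

theorem bounded_update {W d v : ℕ} {σ : RAMState} (hσ : σ.Bounded W) (hv : v < W) :
    RAMState.Bounded W ⟨Function.update σ.reg d v, σ.mem⟩ := by
  refine ⟨fun r => ?_, hσ.2⟩
  rcases eq_or_ne r d with rfl | h
  · simpa using hv
  · simpa [h] using hσ.1 r

/-- The code of the right operand runs with scratch space from `d + 1` on, so it leaves the left
operand in register `d` intact. The three binary operations share the argument `binary`. -/
theorem code_exec {W d : ℕ} {e : RAMExp} {σ : RAMState} (hσ : σ.Bounded W) (he : e.Below d)
    (hs : e.Small W σ.reg) : ∃ σ', (e.code d).Exec W σ e.time σ' ∧ σ'.Bounded W ∧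
      σ'.mem = σ.mem ∧ σ'.reg d = e.eval σ.reg ∧ ∀ r < d, σ'.reg r = σ.reg r := by
  have binary : ∀ (a b : RAMExp) (i : ℕ → RAMInstr) (op : ℕ → ℕ → ℕ),
      (∀ d τ, (i d).apply τ =
        ⟨Function.update τ.reg d (op (τ.reg d) (τ.reg (d + 1))), τ.mem⟩) →
      (∀ {d σ}, RAMState.Bounded W σ → a.Below d → a.Small W σ.reg →
        ∃ σ', (a.code d).Exec W σ a.time σ' ∧ σ'.Bounded W ∧ σ'.mem = σ.mem ∧
          σ'.reg d = a.eval σ.reg ∧ ∀ r < d, σ'.reg r = σ.reg r) →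
      (∀ {d σ}, RAMState.Bounded W σ → b.Below d → b.Small W σ.reg →
        ∃ σ', (b.code d).Exec W σ b.time σ' ∧ σ'.Bounded W ∧ σ'.mem = σ.mem ∧
          σ'.reg d = b.eval σ.reg ∧ ∀ r < d, σ'.reg r = σ.reg r) →
      ∀ {d σ}, RAMState.Bounded W σ → a.Below d → b.Below d → a.Small W σ.reg →
        b.Small W σ.reg → op (a.eval σ.reg) (b.eval σ.reg) < W →
        ∃ σ', RAMProg.Exec W (.seq (.seq (a.code d) (b.code (d + 1))) (.instr (i d))) σ
            (a.time + b.time + 1) σ' ∧ σ'.Bounded W ∧ σ'.mem = σ.mem ∧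
          σ'.reg d = op (a.eval σ.reg) (b.eval σ.reg) ∧ ∀ r < d, σ'.reg r = σ.reg r := by
    intro a b i op hi iha ihb d σ hσ ha hb hsa hsb hop
    obtain ⟨σ₁, x1, b1, m1, v1, r1⟩ := iha hσ ha hsa
    obtain ⟨σ₂, x2, b2, m2, v2, r2⟩ := ihb b1 (hb.mono (Nat.le_succ d))
      ((small_congr hb fun r hr => r1 r hr).2 hsb)
    rw [eval_congr hb r1] at v2
    have v1' : σ₂.reg d = a.eval σ.reg := by rw [r2 d (Nat.lt_succ_self d), v1]
    have hap := hi d σ₂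
    rw [v1', v2] at hap
    have hbd : ((i d).apply σ₂).Bounded W := by
      rw [hap]
      exact bounded_update b2 hop
    refine ⟨_, (x1.seq x2).seq (.instr _ _ hbd), hbd, ?_, ?_, ?_⟩
    · rw [hap, m2, m1]
    · rw [hap]
      simp
    · intro r hr
      rw [hap]
      simp only [Function.update_of_ne hr.ne]
      rw [r2 r (Nat.lt_succ_of_lt hr), r1 r hr]
  induction e generalizing d σ with
  | const k =>
    refine ⟨_, .instr _ _ (bounded_update hσ hs), bounded_update hσ hs, rfl, ?_, fun r hr => ?_⟩
    · simp [RAMInstr.apply, eval]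
    · simp [RAMInstr.apply, hr.ne]
  | reg r =>
    refine ⟨_, .instr _ _ (bounded_update hσ hs), bounded_update hσ hs, rfl, ?_, fun r hr => ?_⟩
    · simp [RAMInstr.apply, eval]
    · simp [RAMInstr.apply, hr.ne]
  | add a b iha ihb =>
    exact binary a b (fun d => .add d d (d + 1)) (· + ·) (fun _ _ => rfl) iha ihb hσ he.1 he.2
      hs.1 hs.2.1 hs.2.2
  | sub a b iha ihb =>
    exact binary a b (fun d => .sub d d (d + 1)) (· - ·) (fun _ _ => rfl) iha ihb hσ he.1 he.2
      hs.1 hs.2 (lt_of_le_of_lt (Nat.sub_le _ _) hs.1.eval_lt)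
  | mul a b iha ihb =>
    exact binary a b (fun d => .mul d d (d + 1)) (· * ·) (fun _ _ => rfl) iha ihb hσ he.1 he.2
      hs.1 hs.2.1 hs.2.2

end RAMExp

/-! ### Effects of assignments, stores and loops -/

namespace RAMProg

/-- From every bounded state with memory `μ` and with registers below `d` given by `ρ`, the program
reaches in `t` steps a bounded state with memory `μ'` and registers below `d` given by `ρ'`. -/
def Reaches (W d : ℕ) (p : RAMProg) (ρ μ : ℕ → ℕ) (t : ℕ) (ρ' μ' : ℕ → ℕ) : Prop :=
  ∀ σ : RAMState, σ.Bounded W → (∀ r < d, σ.reg r = ρ r) → σ.mem = μ →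
    ∃ σ', p.Exec W σ t σ' ∧ σ'.Bounded W ∧ (∀ r < d, σ'.reg r = ρ' r) ∧ σ'.mem = μ'

variable {W d : ℕ}

theorem Reaches.seq {p q : RAMProg} {ρ μ ρ' μ' ρ'' μ'' : ℕ → ℕ} {t t' : ℕ}
    (hp : Reaches W d p ρ μ t ρ' μ') (hq : Reaches W d q ρ' μ' t' ρ'' μ'') :
    Reaches W d (.seq p q) ρ μ (t + t') ρ'' μ'' := by
  intro σ hσ hr hm
  obtain ⟨σ₁, x1, b1, r1, m1⟩ := hp σ hσ hr hm
  obtain ⟨σ₂, x2, b2, r2, m2⟩ := hq σ₁ b1 r1 m1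
  exact ⟨σ₂, x1.seq x2, b2, r2, m2⟩

theorem Reaches.congr {p : RAMProg} {ρ μ ρ' ρ'' μ' μ'' : ℕ → ℕ} {t : ℕ}
    (hp : Reaches W d p ρ μ t ρ' μ') (hρ : ∀ r < d, ρ' r = ρ'' r) (hμ : μ' = μ'') :
    Reaches W d p ρ μ t ρ'' μ'' := by
  intro σ hσ hr hm
  obtain ⟨σ₁, x1, b1, r1, m1⟩ := hp σ hσ hr hm
  exact ⟨σ₁, x1, b1, fun r h => (r1 r h).trans (hρ r h), m1.trans hμ⟩

/-- Assign the value of an expression to a register. -/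
def assign (d r : ℕ) (e : RAMExp) : RAMProg := .seq (e.code d) (.instr (.copy r d))

theorem reaches_assign {r : ℕ} {e : RAMExp} {ρ : ℕ → ℕ} (μ : ℕ → ℕ) (he : e.Below d)
    (hs : e.Small W ρ) :
    Reaches W d (assign d r e) ρ μ (e.time + 1) (Function.update ρ r (e.eval ρ)) μ := by
  intro σ hσ hr hm
  obtain ⟨σ₁, x1, b1, m1, v1, r1⟩ :=
    RAMExp.code_exec hσ he ((RAMExp.small_congr he hr).2 hs)
  have hbd : ((RAMInstr.copy r d).apply σ₁).Bounded W := RAMExp.bounded_update b1 (b1.1 d)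
  refine ⟨_, x1.seq (.instr _ _ hbd), hbd, fun s hsd => ?_, m1.trans hm⟩
  rcases eq_or_ne s r with rfl | h
  · simp [RAMInstr.apply, v1, RAMExp.eval_congr he hr]
  · simp [RAMInstr.apply, h, r1 s hsd, hr s hsd]

/-- Store the value of an expression. -/
def storeAt (d : ℕ) (a e : RAMExp) : RAMProg :=
  .seq (.seq (a.code d) (e.code (d + 1))) (.instr (.store d (d + 1)))

theorem reaches_storeAt {a e : RAMExp} {ρ : ℕ → ℕ} (μ : ℕ → ℕ) (ha : a.Below d) (he : e.Below d)
    (hsa : a.Small W ρ) (hse : e.Small W ρ) :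
    Reaches W d (storeAt d a e) ρ μ (a.time + e.time + 1) ρ
      (Function.update μ (a.eval ρ) (e.eval ρ)) := by
  intro σ hσ hr hm
  obtain ⟨σ₁, x1, b1, m1, v1, r1⟩ :=
    RAMExp.code_exec hσ ha ((RAMExp.small_congr ha hr).2 hsa)
  obtain ⟨σ₂, x2, b2, m2, v2, r2⟩ := RAMExp.code_exec (d := d + 1) b1
    (he.mono (Nat.le_succ d))
    ((RAMExp.small_congr he fun r h => (r1 r h).trans (hr r h)).2 hse)
  have v1' : σ₂.reg d = a.eval ρ := by
    rw [r2 d (Nat.lt_succ_self d), v1, RAMExp.eval_congr ha hr]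
  have v2' : σ₂.reg (d + 1) = e.eval ρ := by
    rw [v2, RAMExp.eval_congr he fun r h => (r1 r h).trans (hr r h)]
  have hap : (RAMInstr.store d (d + 1)).apply σ₂ =
      ⟨σ₂.reg, Function.update μ (a.eval ρ) (e.eval ρ)⟩ := by
    rw [RAMInstr.apply, v1', v2', m2, m1, hm]
  have hbd : ((RAMInstr.store d (d + 1)).apply σ₂).Bounded W := by
    rw [hap]
    refine ⟨b2.1, fun x => ?_⟩
    rcases eq_or_ne x (a.eval ρ) with rfl | h
    · simpa using hse.eval_lt
    · simp only [Function.update_of_ne h]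
      rw [← hm]
      exact hσ.2 x
  refine ⟨_, (x1.seq x2).seq (.instr _ _ hbd), hbd, fun r h => ?_, ?_⟩
  · rw [hap]
    exact ((r2 r (Nat.lt_succ_of_lt h)).trans (r1 r h)).trans (hr r h)
  · rw [hap]

/-- Store the values of expressions in consecutive words, from `k` words behind the address in
register `p` on. -/
def storeList (d p : ℕ) : ℕ → List RAMExp → RAMProg
  | _, [] => .skip
  | k, e :: l => .seq (storeAt d (.add (.reg p) (.const k)) e) (storeList d p (k + 1) l)

/-- The running time of `storeList`. -/
def storeListTime : List RAMExp → ℕ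
  | [] => 1
  | e :: l => 3 + e.time + 1 + storeListTime l

/-- Memory with consecutive words overwritten. -/
def overwrite (μ : ℕ → ℕ) (a : ℕ) (l : List ℕ) (x : ℕ) : ℕ :=
  if a ≤ x ∧ x < a + l.length then l.getD (x - a) 0 else μ x

theorem overwrite_cons (μ : ℕ → ℕ) (a v : ℕ) (l : List ℕ) :
    overwrite (Function.update μ a v) (a + 1) l = overwrite μ a (v :: l) := by
  ext x
  simp only [overwrite, List.length_cons]
  rcases eq_or_ne x a with rfl | h
  · simp
  · by_cases hx : a + 1 ≤ x ∧ x < a + 1 + l.length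
    · rw [if_pos hx, if_pos (by omega), show x - a = x - (a + 1) + 1 by omega, List.getD_cons_succ]
    · rw [if_neg hx, if_neg (by omega), Function.update_of_ne h]

theorem reaches_storeList {p : ℕ} (hp : p < d) {ρ : ℕ → ℕ} (l : List RAMExp) (k : ℕ)
    (μ : ℕ → ℕ) (hb : ∀ e ∈ l, e.Below d) (hs : ∀ e ∈ l, e.Small W ρ)
    (hW : ρ p + k + l.length < W) :
    Reaches W d (storeList d p k l) ρ μ (storeListTime l) ρ
      (overwrite μ (ρ p + k) (l.map fun e => e.eval ρ)) := by
  induction l generalizing k μ with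
  | nil =>
    intro σ hσ hr hm
    refine ⟨σ, .skip σ, hσ, hr, ?_⟩
    rw [hm]
    ext x
    rw [overwrite, if_neg]
    simp
  | cons e l ih =>
    simp only [List.length_cons] at hW
    refine (Reaches.seq (reaches_storeAt (a := .add (.reg p) (.const k)) (e := e) μ ⟨hp, trivial⟩
      (hb e (by simp)) ⟨?_, ?_, ?_⟩ (hs e (by simp)))
      (ih (k + 1) _ (fun e he => hb e (by simp [he])) (fun e he => hs e (by simp [he]))
        (by omega))).congr (fun _ _ => rfl) ?_
    · simp only [RAMExp.Small]; omega
    · simp only [RAMExp.Small]; omega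
    · simp only [RAMExp.eval]; omega
    · rw [List.map_cons, ← overwrite_cons]
      rfl

/-- The sequences `ρ` and `μ` are the loop invariant, and the induction is on the number of
remaining rounds. Each round costs the body and one test; the last step is the failing test. -/
theorem reaches_while {a b N T : ℕ} {p : RAMProg} (ha : a < d) (hb : b < d)
    (ρ μ : ℕ → ℕ → ℕ) (hlt : ∀ i < N, ρ i a < ρ i b) (hN : ¬ ρ N a < ρ N b)
    (hp : ∀ i < N, Reaches W d p (ρ i) (μ i) T (ρ (i + 1)) (μ (i + 1))) :
    Reaches W d (.while (.lt a b) p) (ρ 0) (μ 0) (N * (T + 1) + 1) (ρ N) (μ N) := by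
  have key : ∀ k ≤ N, Reaches W d (.while (.lt a b) p) (ρ (N - k)) (μ (N - k)) (k * (T + 1) + 1)
      (ρ N) (μ N) := by
    intro k hk
    induction k with
    | zero =>
      intro σ hσ hr hm
      have hc : ¬ (RAMTest.lt a b).Holds σ := by
        rw [RAMTest.Holds, hr a ha, hr b hb]
        exact hN
      simp only [Nat.zero_mul, Nat.zero_add]
      exact ⟨σ, .while_false hc, hσ, hr, hm⟩
    | succ k ih =>
      intro σ hσ hr hm
      have hc : (RAMTest.lt a b).Holds σ := by
        rw [RAMTest.Holds, hr a ha, hr b hb]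
        exact hlt _ (by omega)
      obtain ⟨σ₁, x1, b1, r1, m1⟩ := hp (N - (k + 1)) (by omega) σ hσ hr hm
      rw [show N - (k + 1) + 1 = N - k by omega] at r1 m1
      obtain ⟨σ₂, x2, b2, r2, m2⟩ := ih (by omega) σ₁ b1 r1 m1
      refine ⟨σ₂, ?_, b2, r2, m2⟩
      have := RAMProg.Exec.while_true hc x1 x2
      rwa [show T + (k * (T + 1) + 1) + 1 = (k + 1) * (T + 1) + 1 by ring] at this
  simpa using key N le_rfl

end RAMProg

/-! ### Case distinctions by truncated arithmetic -/

namespace RAMExp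

/-- The minimum. -/
def minE (a b : RAMExp) : RAMExp := .sub a (.sub a b)

/-- `1` if the values agree, `0` otherwise. -/
def eqE (a b : RAMExp) : RAMExp := .sub (.const 1) (.add (.sub a b) (.sub b a))

/-- `1` if the value is positive, `0` otherwise. -/
def posE (a : RAMExp) : RAMExp := .sub (.const 1) (.sub (.const 1) a)

open Classical in
/-- `1` if `p` holds, `0` otherwise. -/
noncomputable def boolE (p : Prop) : RAMExp := .const (if p then 1 else 0)

theorem eval_minE (ρ : ℕ → ℕ) (a b : RAMExp) : (minE a b).eval ρ = min (a.eval ρ) (b.eval ρ) := by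
  simp only [minE, eval]
  omega

theorem eval_eqE (ρ : ℕ → ℕ) (a b : RAMExp) :
    (eqE a b).eval ρ = if a.eval ρ = b.eval ρ then 1 else 0 := by
  simp only [eqE, eval]
  split_ifs <;> omega

theorem eval_posE (ρ : ℕ → ℕ) (a : RAMExp) :
    (posE a).eval ρ = if 0 < a.eval ρ then 1 else 0 := by
  simp only [posE, eval]
  split_ifs <;> omega

theorem boole_mul_four {p q r s t : Prop} {_ : Decidable p} {_ : Decidable q} {_ : Decidable r}
    {_ : Decidable s} {_ : Decidable t} (h : t ↔ p ∧ q ∧ r ∧ s) :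
    (if p then 1 else 0) * ((if q then 1 else 0) * ((if r then 1 else 0) * if s then 1 else 0)) =
      if t then 1 else 0 := by
  by_cases hp : p <;> by_cases hq : q <;> by_cases hr : r <;> by_cases hs : s <;>
    simp [h, hp, hq, hr, hs]

theorem boole_cases {o p q r s u t : Prop} {_ : Decidable o} {_ : Decidable p} {_ : Decidable q}
    {_ : Decidable r} {_ : Decidable s} {_ : Decidable u} {_ : Decidable t}
    (h : t ↔ (o ∧ p ∧ q) ∨ (¬ o ∧ r ∧ s ∧ u)) :
    (if o then 1 else 0) * ((if p then 1 else 0) * if q then 1 else 0) +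
      (1 - if o then 1 else 0) *
        ((if r then 1 else 0) * ((if s then 1 else 0) * if u then 1 else 0)) =
      if t then 1 else 0 := by
  by_cases ho : o
  · by_cases hp : p <;> by_cases hq : q <;> simp [h, ho, hp, hq]
  · by_cases hr : r <;> by_cases hs : s <;> by_cases hu : u <;> simp [h, ho, hr, hs, hu]

/-! ### The program

Registers `0`, `1`, `2` hold `n`, `m` and the weight of an edge, registers `3` to `6` the depth and
the counters of the current block, register `7` the address of its first word, register `8` the end
of the table; registers `9` and `10` hold carries. -/

/-- The new height. -/
def heightExp (a : RAMExp) (l : ℕ) : RAMExp :=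
  minE (.reg 0) (.sub (.add a (.const l)) (.const 1))

/-- The height of the front part after reading a letter. -/
def frontExp (q : Control) : RAMExp :=
  match q.buffer with
  | some (a, some (_, some d)) => heightExp (.reg 4) (a.countL + d.countL)
  | _ => .reg 4

/-- The height of the back part after reading a letter. -/
def backExp (q : Control) (c : Letter) : RAMExp :=
  match q.buffer with
  | some (_, some (b, some _)) => heightExp (.reg 5) (b.countR + c.countR)
  | _ => .reg 5

/-- The number of edges after reading a letter. -/
def edgesExp (q : Control) (c : Letter) : RAMExp :=
  match q.buffer with
  | some (_, some (_, some _)) =>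
    minE (.add (.reg 1) (.const 1))
      (.add (.add (.reg 6) (.mul (.reg 2) (.add (frontExp q) (backExp q c))))
        (.mul (.add (.reg 1) (.const 1))
          (.add (.sub (.const 1) (frontExp q)) (.sub (.const 1) (backExp q c)))))
  | _ => .reg 6

/-- `1` if the automaton accepts with the given last letter, `0` otherwise. -/
noncomputable def finalExp (q : Control) (c : Letter) : RAMExp :=
  match q.buffer with
  | some (_, some (_, some _)) =>
    .mul (boolE (q.next c).Wins) (.mul (posE (frontExp q)) (.mul (eqE (frontExp q) (backExp q c))
      (eqE (.add (.reg 6) (.mul (.reg 2) (frontExp q))) (.reg 1))))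
  | some (a, none) =>
    .add (.mul (eqE (.reg 0) (.const 1)) (.mul (boolE (a = .R ∧ c = .L)) (eqE (.reg 1) (.const 0))))
      (.mul (.sub (.const 1) (eqE (.reg 0) (.const 1))) (.mul (boolE (q.middle a c).Wins)
        (.mul (eqE (.add (.reg 4) (.const (a.countL + c.countL))) (.add (.reg 5) (.const 1)))
          (eqE (.reg 6) (.reg 1)))))
  | _ => .const 0

/-- The target of an arc to the next level. -/
noncomputable def indexExp (q : Control) (c : Letter) : RAMExp :=
  .add (.const 1) (.add (.mul (.add (.mul (.add (.mul (.add (.mul (.reg 3)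
    (.add (.reg 0) (.const 1))) (frontExp q)) (.add (.reg 0) (.const 1))) (backExp q c))
      (.add (.reg 1) (.const 2))) (edgesExp q c)) (.const numControls))
        (.const (controlEquiv (q.next c))))

/-- `1` at the last level, `0` otherwise. -/
def lastExp : RAMExp := eqE (.add (.reg 3) (.const 1)) (.mul (.const 2) (.reg 0))

/-- The word of an arc. -/
noncomputable def arcExp (q : Control) (c : Letter) : RAMExp :=
  .add (.mul lastExp (finalExp q c))
    (.mul (.sub (.const 1) lastExp) (.add (indexExp q c) (.const 2)))

/-- The words of a node. -/
noncomputable def nodeExp (q : Control) (j : ℕ) : RAMExp :=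
  if j = 0 then .add (.reg 3) (.const 1) else arcExp q (if j = 1 then .L else .R)

theorem eval_frontExp (ρ : ℕ → ℕ) (q : Control) :
    (frontExp q).eval ρ = q.nextFront (ρ 0) (ρ 4) := by
  obtain ⟨_, _, _, _, _ | ⟨_, _ | ⟨_, _ | _⟩⟩⟩ := q <;>
    simp only [frontExp, Control.nextFront, heightExp, eval_minE, eval, stepHeight]

theorem eval_backExp (ρ : ℕ → ℕ) (q : Control) (c : Letter) :
    (backExp q c).eval ρ = q.nextBack (ρ 0) c (ρ 5) := by
  obtain ⟨_, _, _, _, _ | ⟨_, _ | ⟨_, _ | _⟩⟩⟩ := q <;>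
    simp only [backExp, Control.nextBack, heightExp, eval_minE, eval, stepHeight]

theorem eval_edgesExp (ρ : ℕ → ℕ) (q : Control) (c : Letter) :
    (edgesExp q c).eval ρ = q.nextEdges (ρ 0) (ρ 2) (ρ 1) c (ρ 4) (ρ 5) (ρ 6) := by
  have h1 := eval_frontExp ρ q
  have h2 := eval_backExp ρ q c
  obtain ⟨_, _, _, _, _ | ⟨_, _ | ⟨_, _ | _⟩⟩⟩ := q <;>
    simp only [edgesExp, Control.nextEdges, eval_minE, eval, stepEdges, h1, h2]

open Classical in
theorem eval_finalExp (ρ : ℕ → ℕ) (q : Control) (c : Letter) :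
    (finalExp q c).eval ρ =
      if q.Final (ρ 0) (ρ 2) (ρ 1) c (ρ 4) (ρ 5) (ρ 6) then 1 else 0 := by
  have h1 := eval_frontExp ρ q
  have h2 := eval_backExp ρ q c
  obtain ⟨fr, bk, rv, rt, _ | ⟨a, _ | ⟨b, _ | d⟩⟩⟩ := q
  · simp [finalExp, Control.Final, eval]
  · simp only [finalExp, Control.Final, eval, eval_eqE, boolE]
    exact boole_cases Iff.rfl
  · simp [finalExp, Control.Final, eval]
  · simp only [finalExp, Control.Final, eval, eval_eqE, eval_posE, boolE, h1, h2]
    exact boole_mul_four Iff.rfl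

open Classical in
theorem eval_nodeExp (ρ : ℕ → ℕ) (q : Control) (j : ℕ) :
    (nodeExp q j).eval ρ =
      nodeWord (ρ 0) (ρ 2) (ρ 1) (ρ 3) ⟨q, ρ 4, ρ 5, ρ 6⟩ j := by
  have harc : ∀ c, (arcExp q c).eval ρ = arcWord (ρ 0) (ρ 2) (ρ 1) (ρ 3) ⟨q, ρ 4, ρ 5, ρ 6⟩ c := by
    intro c
    simp only [arcExp, arcWord, eval, lastExp, eval_eqE, eval_finalExp, indexExp, eval_frontExp,
      eval_backExp, eval_edgesExp, AutState.Accepts, nodeIndex, blockIndex, AutState.next]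
    by_cases h : ρ 3 + 1 = 2 * ρ 0
    · simp only [h, if_true, one_mul, Nat.sub_self, zero_mul, add_zero]
      exact if_congr Iff.rfl rfl rfl
    · simp [h]
  rw [nodeExp, nodeWord]
  split_ifs
  · rfl
  · exact harc _
  · exact harc _

theorem below_nodeExp (q : Control) (j : ℕ) : (nodeExp q j).Below 11 := by
  have hf : (frontExp q).Below 11 := by
    obtain ⟨_, _, _, _, _ | ⟨_, _ | ⟨_, _ | _⟩⟩⟩ := q <;> simp [frontExp, heightExp, minE, Below]
  have hb : ∀ c, (backExp q c).Below 11 := fun c => by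
    obtain ⟨_, _, _, _, _ | ⟨_, _ | ⟨_, _ | _⟩⟩⟩ := q <;> simp [backExp, heightExp, minE, Below]
  have he : ∀ c, (edgesExp q c).Below 11 := fun c => by
    have := hb c
    obtain ⟨_, _, _, _, _ | ⟨_, _ | ⟨_, _ | _⟩⟩⟩ := q <;> simp_all [edgesExp, minE, Below]
  have hl : ∀ c, (finalExp q c).Below 11 := fun c => by
    have := hb c
    obtain ⟨_, _, _, _, _ | ⟨_, _ | ⟨_, _ | _⟩⟩⟩ := q <;>
      simp_all [finalExp, eqE, posE, boolE, Below]
  rw [nodeExp]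
  split_ifs <;> simp [arcExp, lastExp, indexExp, eqE, Below, hf, hb, he, hl]

/-- The number of nodes. -/
noncomputable def sizeExp : RAMExp :=
  .add (.const 1) (.mul (.mul (.mul (.mul (.sub (.mul (.const 2) (.reg 0)) (.const 1))
    (.add (.reg 0) (.const 1))) (.add (.reg 0) (.const 1))) (.add (.reg 1) (.const 2)))
      (.const numControls))

theorem eval_sizeExp (ρ : ℕ → ℕ) : sizeExp.eval ρ = numNodes (ρ 0) (ρ 1) := rfl

/-- The words of the root. -/
noncomputable def rootExps : List RAMExp :=
  [nodeExp AutState.start.control 0, nodeExp AutState.start.control 1,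
    nodeExp AutState.start.control 2]

/-- The words of a block. -/
noncomputable def blockExps : List RAMExp :=
  List.ofFn fun k : Fin (3 * numControls) => nodeExp (controlOfNat (k / 3)) (k % 3)

end RAMExp

namespace RAMProg

open RAMExp

/-- A sequence of assignments. -/
def assignList (d : ℕ) : List (ℕ × RAMExp) → RAMProg
  | [] => .skip
  | a :: l => .seq (assign d a.1 a.2) (assignList d l)

/-- The running time of a sequence of assignments. -/
def assignListTime : List (ℕ × RAMExp) → ℕ
  | [] => 1
  | a :: l => a.2.time + 1 + assignListTime l

/-- The effect of a sequence of assignments. -/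
def runAssign (ρ : ℕ → ℕ) : List (ℕ × RAMExp) → ℕ → ℕ
  | [] => ρ
  | a :: l => runAssign (Function.update ρ a.1 (a.2.eval ρ)) l

/-- The assigned values are smaller than `B`. -/
def AssignsBelow (B : ℕ) (ρ : ℕ → ℕ) : List (ℕ × RAMExp) → Prop
  | [] => True
  | a :: l => a.2.eval ρ < B ∧ AssignsBelow B (Function.update ρ a.1 (a.2.eval ρ)) l

theorem reaches_assignList {W d B : ℕ} (hB : 2 ≤ B) {ρ : ℕ → ℕ} (μ : ℕ → ℕ)
    (hρ : ∀ r < d, ρ r < B) {l : List (ℕ × RAMExp)} (hl : ∀ a ∈ l, a.2.Below d)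
    (hW : ∀ a ∈ l, B ^ a.2.cost ≤ W) (h : AssignsBelow B ρ l) :
    Reaches W d (assignList d l) ρ μ (assignListTime l) (runAssign ρ l) μ := by
  induction l generalizing ρ with
  | nil => exact fun σ hσ hr hm => ⟨σ, .skip σ, hσ, hr, hm⟩
  | cons a l ih =>
    refine Reaches.seq (reaches_assign μ (hl a (by simp))
      ((small_of_lt hB hρ (hl a (by simp))).mono (hW a (by simp))))
      (ih (fun r hr => ?_) (fun b hb => hl b (by simp [hb])) (fun b hb => hW b (by simp [hb])) h.2)
    rcases eq_or_ne r a.1 with rfl | hne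
    · simpa using h.1
    · simpa [hne] using hρ r hr

/-- Pass on to the next block. -/
noncomputable def advance : List (ℕ × RAMExp) :=
  [(7, .add (.reg 7) (.const (3 * numControls))),
    -- A mixed-radix increment: register `9` holds the carry out of the edge count, register `10`
    -- the carry out of the back height, then register `9` the carry out of the front height into
    -- the depth.
    (9, eqE (.reg 6) (.add (.reg 1) (.const 1))),
    (6, .mul (.add (.reg 6) (.const 1)) (.sub (.const 1) (.reg 9))),
    (10, .mul (.reg 9) (eqE (.reg 5) (.reg 0))),
    (5, .mul (.add (.reg 5) (.reg 9)) (.sub (.const 1) (.reg 10))),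
    (9, .mul (.reg 10) (eqE (.reg 4) (.reg 0))),
    (4, .mul (.add (.reg 4) (.reg 10)) (.sub (.const 1) (.reg 9))),
    (3, .add (.reg 3) (.reg 9)),
    (9, .const 0),
    (10, .const 0)]

/-- Set up the first block. -/
noncomputable def prepare : List (ℕ × RAMExp) :=
  -- The first three words belong to the root, and the first block has depth 1.
  [(7, .const 3), (3, .const 1), (8, .mul (.const 3) sizeExp)]

/-- Set the output registers. -/
noncomputable def finish : List (ℕ × RAMExp) :=
  -- The size comes first because `sizeExp` reads `n` and `m` from registers `0` and `1`.
  [(0, sizeExp), (1, .const 0), (2, .const 0)]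

/-- The program that writes the table of the BDD of the automaton, for edges of weight `w`. -/
noncomputable def autProg (w : ℕ) : RAMProg :=
  .seq (assignList 11 [(2, .const w)]) (.seq (storeList 11 7 0 rootExps)
    (.seq (assignList 11 prepare)
      (.seq (.while (.lt 7 8) (.seq (storeList 11 7 0 blockExps) (assignList 11 advance)))
        (assignList 11 finish))))

/-- The registers before block `i` is written. -/
noncomputable def loopRegs (n w m i : ℕ) : ℕ → ℕ
  | 0 => n
  | 1 => m
  | 2 => w
  | 3 => blockLevel n m i + 1
  | 4 => i / (m + 2) / (n + 1) % (n + 1)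
  | 5 => i / (m + 2) % (n + 1)
  | 6 => i % (m + 2)
  | 7 => 3 + 3 * numControls * i
  | 8 => 3 * numNodes n m
  | _ => 0

/-- The memory before block `i` is written. -/
noncomputable def loopMem (n w m i a : ℕ) : ℕ :=
  if a < 3 + 3 * numControls * i then tableWord n w m a else 0

/-- The number of blocks. -/
def numBlocks (n m : ℕ) : ℕ := (2 * n - 1) * (n + 1) * (n + 1) * (m + 2)

theorem numNodes_eq (n m : ℕ) : numNodes n m = 1 + numBlocks n m * numControls := rfl

theorem tableWord_root (n w m : ℕ) {j : ℕ} (hj : j < 3) :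
    tableWord n w m j = nodeWord n w m 0 AutState.start j := by
  rw [tableWord, Nat.div_eq_of_lt hj, Nat.mod_eq_of_lt hj]
  rfl

/-- The control of a node depends only on its place within the block, so the same list of
expressions serves all blocks. -/
theorem tableWord_block (n w m i : ℕ) {k : ℕ} (hk : k < 3 * numControls) :
    tableWord n w m (3 + 3 * numControls * i + k) =
      nodeWord n w m (blockLevel n m i + 1) (blockState n m i (controlOfNat (k / 3))) (k % 3) := by
  have h1 : (3 + 3 * numControls * i + k) / 3 = i * numControls + k / 3 + 1 := by
    rw [show 3 + 3 * numControls * i + k = 3 * (i * numControls + 1) + k by ring,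
      Nat.mul_add_div (by omega)]
    omega
  have h2 : (3 + 3 * numControls * i + k) % 3 = k % 3 := by
    rw [show 3 + 3 * numControls * i + k = 3 * (i * numControls + 1) + k by ring,
      Nat.mul_add_mod]
  have h3 : k / 3 < numControls := by omega
  have h4 : controlOfNat (i * numControls + k / 3) = controlOfNat (k / 3) := by
    simp only [controlOfNat, mul_add_mod_of_lt h3, Nat.mod_eq_of_lt h3]
  rw [tableWord, h1, h2, nodeDepth, nodeState, mul_add_div_of_lt h3, h4]

/-- One digit of an increment with incoming carry `c`: the digit overflows exactly if it is maximal
and `c = 1`, and then it returns to zero. -/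
theorem digit_step (j k c : ℕ) (hc : c ≤ 1) :
    (j + c) % (k + 1) = (j % (k + 1) + c) * (1 - c * if j % (k + 1) = k then 1 else 0) ∧
    (j + c) / (k + 1) = j / (k + 1) + c * if j % (k + 1) = k then 1 else 0 := by
  have hlt : j % (k + 1) < k + 1 := Nat.mod_lt _ (Nat.succ_pos k)
  obtain rfl | rfl : c = 0 ∨ c = 1 := by omega
  · simp
  · have hj : j + 1 = j / (k + 1) * (k + 1) + (j % (k + 1) + 1) := by
      have := Nat.div_add_mod' j (k + 1)
      omega
    split_ifs with h
    · have hj' : j + 1 = (j / (k + 1) + 1) * (k + 1) + 0 := by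
        rw [hj, h]
        ring
      constructor
      · rw [hj', mul_add_mod_of_lt (by omega)]
        simp
      · rw [hj', mul_add_div_of_lt (by omega), mul_one]
    · have h' : j % (k + 1) + 1 < k + 1 := by omega
      constructor
      · conv_lhs => rw [hj, mul_add_mod_of_lt h']
        simp
      · conv_lhs => rw [hj, mul_add_div_of_lt h']
        simp

theorem runAssign_advance (n w m i : ℕ) :
    ∀ r < 11, runAssign (loopRegs n w m i) advance r = loopRegs n w m (i + 1) r := by
  have c1 : (if i % (m + 2) = m + 1 then 1 else 0) ≤ 1 := by split_ifs <;> omega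
  obtain ⟨e1, e2⟩ := digit_step i (m + 1) 1 le_rfl
  rw [one_mul] at e1 e2
  set c := if i % (m + 2) = m + 1 then 1 else 0 with hc
  obtain ⟨f1, f2⟩ := digit_step (i / (m + 2)) n c c1
  have c2 : (c * if i / (m + 2) % (n + 1) = n then 1 else 0) ≤ 1 := by split_ifs <;> omega
  set c' := c * if i / (m + 2) % (n + 1) = n then 1 else 0 with hc'
  obtain ⟨g1, g2⟩ := digit_step (i / (m + 2) / (n + 1)) n c' c2
  intro r hr
  interval_cases r <;>
    simp [runAssign, advance, eval_eqE, eval, loopRegs, blockLevel, ← hc, ← hc', e1, e2, f1, f2,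
      g1, g2]
  all_goals ring

theorem loop_bound {n m i : ℕ} (hi : i < numBlocks n m) :
    3 + 3 * numControls * i + 3 * numControls ≤ 3 * numNodes n m := by
  rw [numNodes_eq]
  nlinarith [Nat.mul_le_mul_right numControls (Nat.succ_le_of_lt hi)]

theorem blockLevel_lt {n m i : ℕ} (hn : 1 ≤ n) (hi : i < numBlocks n m) :
    blockLevel n m i + 1 < 2 * n := by
  have h := nodeDepth_lt (m := m) (u := i * numControls + 0 + 1) hn (by
    rw [numNodes_eq]
    have := mul_add_lt_mul hi numControls_pos
    omega)
  rwa [nodeDepth, Nat.mul_div_cancel _ numControls_pos] at h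

theorem assignsBelow_advance {n w m i B : ℕ} (hn : 1 ≤ n) (hi : i < numBlocks n m)
    (hB : 3 * numNodes n m + 2 * n + m + w + 5 < B) :
    AssignsBelow B (loopRegs n w m i) advance := by
  have h1 : i / (m + 2) / (n + 1) % (n + 1) < n + 1 := Nat.mod_lt _ (Nat.succ_pos n)
  have h2 : i / (m + 2) % (n + 1) < n + 1 := Nat.mod_lt _ (Nat.succ_pos n)
  have h3 : i % (m + 2) < m + 2 := Nat.mod_lt _ (Nat.succ_pos _)
  have h4 := loop_bound hi
  have h5 := blockLevel_lt hn hi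
  simp only [AssignsBelow, advance, eval_eqE, eval]
  have hc : (if i % (m + 2) = m + 1 then 1 else 0) ≤ 1 := by split_ifs <;> omega
  have hc' : (if i / (m + 2) % (n + 1) = n then if i % (m + 2) = m + 1 then 1 else 0 else 0)
      ≤ 1 := by split_ifs <;> omega
  have hc'' : (if i / (m + 2) / (n + 1) % (n + 1) = n then
      if i / (m + 2) % (n + 1) = n then if i % (m + 2) = m + 1 then 1 else 0 else 0 else 0)
      ≤ 1 := by split_ifs <;> omega
  have hmul : ∀ a b, a < B → a * (1 - b) < B := fun a b ha =>
    (Nat.mul_le_mul_left a (Nat.sub_le 1 b)).trans_lt (by rwa [mul_one])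
  simp [loopRegs]
  refine ⟨?_, ?_, hmul _ _ ?_, ?_, hmul _ _ ?_, ?_, hmul _ _ ?_, ?_, ?_⟩ <;> omega

end RAMProg

/-! ### Correctness, running time and word size of the program -/

namespace RAMProg

open RAMExp

/-- The registers while the root is written. -/
def rootRegs (n w m : ℕ) : ℕ → ℕ
  | 0 => n
  | 1 => m
  | 2 => w
  | _ => 0

/-- All expressions of the program. -/
noncomputable def autExps (w : ℕ) : List RAMExp :=
  .const w :: (rootExps ++ prepare.map Prod.snd ++ blockExps ++ advance.map Prod.snd ++
    finish.map Prod.snd)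

theorem below_autExps {w : ℕ} {e : RAMExp} (he : e ∈ autExps w) : e.Below 11 := by
  simp only [autExps, rootExps, blockExps, List.mem_cons, List.mem_append, List.mem_ofFn,
    prepare, advance, finish, List.map_cons, List.map_nil, List.not_mem_nil, or_false] at he
  rcases he with rfl | (((((rfl | rfl | rfl) | h) | ⟨k, rfl⟩) | h) | h)
  · trivial
  iterate 3 exact below_nodeExp _ _
  · rcases h with rfl | rfl | rfl <;> simp [Below, sizeExp]
  · exact below_nodeExp _ _
  · rcases h with rfl | rfl | rfl | rfl | rfl | rfl | rfl | rfl | rfl | rfl <;> simp [Below, eqE]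
  · rcases h with rfl | rfl | rfl <;> simp [Below, sizeExp]

/-- An exponent that bounds the values of the expressions of the program. -/
noncomputable def autCost (w : ℕ) : ℕ := ((autExps w).map RAMExp.cost).sum

theorem cost_le_autCost {w : ℕ} {e : RAMExp} (he : e ∈ autExps w) : e.cost ≤ autCost w :=
  List.single_le_sum (fun _ _ => Nat.zero_le _) _ (List.mem_map_of_mem he)

theorem loopRegs_lt {n w m i B : ℕ} (hn : 1 ≤ n) (hi : i ≤ numBlocks n m)
    (hB : 3 * numNodes n m + 2 * n + m + w + 5 < B) : ∀ r < 11, loopRegs n w m i r < B := by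
  have h1 : i / (m + 2) / (n + 1) % (n + 1) < n + 1 := Nat.mod_lt _ (Nat.succ_pos n)
  have h2 : i / (m + 2) % (n + 1) < n + 1 := Nat.mod_lt _ (Nat.succ_pos n)
  have h3 : i % (m + 2) < m + 2 := Nat.mod_lt _ (Nat.succ_pos _)
  have h4 : 3 + 3 * numControls * i ≤ 3 * numNodes n m := by
    rw [numNodes_eq]
    nlinarith [Nat.mul_le_mul_right numControls hi]
  have h5 : blockLevel n m i ≤ 2 * n - 1 := by
    refine Nat.div_le_of_le_mul (Nat.div_le_of_le_mul (Nat.div_le_of_le_mul (hi.trans_eq ?_)))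
    rw [numBlocks]
    ring
  intro r hr
  interval_cases r <;> simp only [loopRegs] <;> omega

theorem overwrite_root (n w m : ℕ) :
    overwrite (fun _ => 0) 0 (rootExps.map fun e => e.eval (rootRegs n w m)) =
      loopMem n w m 0 := by
  ext a
  simp only [overwrite, loopMem, rootExps, List.map_cons, List.map_nil, List.length_cons,
    List.length_nil, eval_nodeExp, rootRegs]
  by_cases ha : a < 3
  · rw [if_pos (by omega), if_pos (by omega), tableWord_root n w m ha]
    interval_cases a <;> rfl
  · rw [if_neg (by omega), if_neg (by omega)]

theorem overwrite_block (n w m i : ℕ) :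
    overwrite (loopMem n w m i) (3 + 3 * numControls * i)
      (blockExps.map fun e => e.eval (loopRegs n w m i)) = loopMem n w m (i + 1) := by
  ext a
  have hs : 3 + 3 * numControls * (i + 1) = 3 + 3 * numControls * i + 3 * numControls := by ring
  simp only [overwrite, loopMem, hs, List.length_map, blockExps, List.length_ofFn]
  by_cases h1 : 3 + 3 * numControls * i ≤ a
  · by_cases h2 : a < 3 + 3 * numControls * i + 3 * numControls
    · obtain ⟨k, rfl⟩ := Nat.exists_eq_add_of_le h1
      have hk : k < 3 * numControls := by omega
      rw [if_pos ⟨h1, h2⟩, if_pos h2, tableWord_block n w m i hk, Nat.add_sub_cancel_left,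
        List.getD_eq_getElem _ _ (by simpa using hk)]
      simp only [List.getElem_map, List.getElem_ofFn, eval_nodeExp]
      rfl
    · rw [if_neg (by omega), if_neg (by omega), if_neg h2]
  · rw [if_neg (by omega), if_pos (by omega), if_pos (by omega)]

/-- A bound for the running time. -/
noncomputable def autTime (w n m : ℕ) : ℕ :=
  assignListTime [(2, .const w)] + (storeListTime rootExps + (assignListTime prepare +
    ((numBlocks n m * (storeListTime blockExps + assignListTime advance + 1) + 1) +
      assignListTime finish)))

/-- The invariant of the main loop is that before block `i` the registers are `loopRegs` and the
memory is `loopMem`, an initial piece of the table followed by zeros. -/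
theorem autProg_constructs {n w m B W : ℕ} (hn : 1 ≤ n)
    (hB : 3 * numNodes n m + 2 * n + m + w + 5 < B) (hW : ∀ e ∈ autExps w, B ^ e.cost ≤ W) :
    (autProg w).Constructs W n m (autTime w n m) (autBDD n w m hn) := by
  have hB2 : 2 ≤ B := by omega
  have hBW : B ≤ W :=
    (Nat.le_self_pow (Nat.succ_ne_zero w) B).trans (hW (.const w) (List.mem_cons_self ..))
  have hsize : 0 < numNodes n m := by rw [numNodes_eq]; omega
  have hinit : ∀ r < 11, (RAMState.init n m).reg r < B := by
    intro r _
    simp only [RAMState.init]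
    split_ifs <;> omega
  have hroot : ∀ r < 11, rootRegs n w m r < B := by
    intro r hr
    interval_cases r <;> simp only [rootRegs] <;> omega
  have small : ∀ {ρ : ℕ → ℕ} {e : RAMExp}, (∀ r < 11, ρ r < B) → e ∈ autExps w → e.Small W ρ :=
    fun hρ he => (small_of_lt hB2 hρ (below_autExps he)).mono (hW _ he)
  have mroot : ∀ e ∈ rootExps, e ∈ autExps w := fun e he => by simp [autExps, he]
  have mblock : ∀ e ∈ blockExps, e ∈ autExps w := fun e he => by simp [autExps, he]
  have mprepare : ∀ a ∈ prepare, a.2 ∈ autExps w := fun a ha =>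
    List.mem_cons_of_mem _ (by simp only [List.mem_append]; simp [List.mem_map_of_mem ha])
  have madvance : ∀ a ∈ advance, a.2 ∈ autExps w := fun a ha =>
    List.mem_cons_of_mem _ (by simp only [List.mem_append]; simp [List.mem_map_of_mem ha])
  have mfinish : ∀ a ∈ finish, a.2 ∈ autExps w := fun a ha =>
    List.mem_cons_of_mem _ (by simp only [List.mem_append]; simp [List.mem_map_of_mem ha])
  have r1 : Reaches W 11 (assignList 11 [(2, .const w)]) (RAMState.init n m).reg (fun _ => 0)
      (assignListTime [(2, .const w)]) (rootRegs n w m) (fun _ => 0) := by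
    refine (reaches_assignList hB2 _ hinit (by simp [Below])
      (by simpa using hW (.const w) (List.mem_cons_self ..)) ?_).congr ?_ rfl
    · exact ⟨by simp only [eval]; omega, trivial⟩
    · intro r hr
      interval_cases r <;> simp [runAssign, rootRegs, RAMState.init, eval]
  -- Register `7` is still zero, so the root is written at address 0; the depth and the counters are
  -- zero as well, as in the initial state.
  have r2 : Reaches W 11 (storeList 11 7 0 rootExps) (rootRegs n w m) (fun _ => 0)
      (storeListTime rootExps) (rootRegs n w m) (loopMem n w m 0) :=
    (reaches_storeList (by omega) rootExps 0 _ (fun e he => below_autExps (mroot e he))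
      (fun e he => small hroot (mroot e he))
      (by simp only [rootRegs, rootExps, List.length_cons, List.length_nil]; omega)).congr
      (fun _ _ => rfl) (overwrite_root n w m)
  have r3 : Reaches W 11 (assignList 11 prepare) (rootRegs n w m) (loopMem n w m 0)
      (assignListTime prepare) (loopRegs n w m 0) (loopMem n w m 0) := by
    refine (reaches_assignList hB2 _ hroot (fun a ha => below_autExps (mprepare a ha))
      (fun a ha => hW _ (mprepare a ha)) ?_).congr ?_ rfl
    · simp only [AssignsBelow, prepare, eval, eval_sizeExp, Function.update, rootRegs]
      simp
      omega
    · intro r hr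
      interval_cases r <;>
        simp [runAssign, prepare, rootRegs, loopRegs, eval, eval_sizeExp, blockLevel]
  have r4 : Reaches W 11
      (.while (.lt 7 8) (.seq (storeList 11 7 0 blockExps) (assignList 11 advance)))
      (loopRegs n w m 0) (loopMem n w m 0)
      (numBlocks n m * (storeListTime blockExps + assignListTime advance + 1) + 1)
      (loopRegs n w m (numBlocks n m)) (loopMem n w m (numBlocks n m)) := by
    refine reaches_while (by omega) (by omega) (loopRegs n w m) (loopMem n w m) (fun i hi => ?_) ?_
      fun i hi => ?_
    · have := loop_bound hi
      have := numControls_pos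
      simp only [loopRegs]
      omega
    -- After the last block the write address equals the end of the table.
    · simp only [loopRegs, numNodes_eq, not_lt]
      exact le_of_eq (by ring)
    · have hρ := loopRegs_lt (w := w) hn hi.le hB
      have := loop_bound hi
      refine Reaches.seq ((reaches_storeList (by omega) blockExps 0 _
        (fun e he => below_autExps (mblock e he)) (fun e he => small hρ (mblock e he))
        ?_).congr (fun _ _ => rfl) (overwrite_block n w m i))
        ((reaches_assignList hB2 _ hρ (fun a ha => below_autExps (madvance a ha))
          (fun a ha => hW _ (madvance a ha)) (assignsBelow_advance hn hi hB)).congr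
          (runAssign_advance n w m i) rfl)
      simp only [loopRegs, blockExps, List.length_ofFn]
      omega
  have r5 := reaches_assignList (W := W) hB2 (loopMem n w m (numBlocks n m))
    (loopRegs_lt (w := w) hn le_rfl hB) (fun a ha => below_autExps (mfinish a ha))
    (fun a ha => hW _ (mfinish a ha))
    ⟨by simp only [eval_sizeExp, loopRegs]; omega, by simp only [eval]; omega,
      by simp only [eval]; omega, trivial⟩
  obtain ⟨σ, hx, -, hr, hm⟩ := (r1.seq (r2.seq (r3.seq (r4.seq r5)))) (RAMState.init n m)
    ⟨fun r => by simp only [RAMState.init]; split_ifs <;> omega,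
      fun _ => by simp only [RAMState.init]; omega⟩ (fun _ _ => rfl) rfl
  refine ⟨_, σ, hx, le_rfl, holds_autBDD hn w m ?_ ?_ ?_ fun a ha => ?_⟩
  · rw [hr 0 (by omega)]
    simp [runAssign, finish, eval_sizeExp, loopRegs]
  · rw [hr 1 (by omega)]
    simp [runAssign, finish, eval]
  · rw [hr 2 (by omega)]
    simp [runAssign, finish, eval]
  · rw [hm, loopMem, if_pos]
    refine ha.trans_eq ?_
    rw [numNodes_eq]
    ring

theorem numBlocks_le {n : ℕ} (hn : 1 ≤ n) (m : ℕ) :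
    numBlocks n m ≤ 24 * (n ^ 3 * max m 1) := by
  -- Together with three factors of at most `2 * n` this gives the constant `24`.
  have h1 : m + 2 ≤ 3 * max m 1 := by omega
  calc numBlocks n m ≤ 2 * n * (2 * n) * (2 * n) * (3 * max m 1) := by
        rw [numBlocks]
        gcongr <;> omega
    _ = 24 * (n ^ 3 * max m 1) := by ring

theorem exists_autBDD (w : ℕ) : ∃ (p : RAMProg) (C c : ℕ), ∀ n m : ℕ, 1 ≤ n →
    ∃ D : BDD (2 * n), D.Represents {G | IsConnBipPerm G ∧ w * G.edgeSet.ncard = m} ∧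
      D.size ≤ C * (n ^ 3 * max m 1) ∧
      p.Constructs ((n + m + 1) ^ c) n m (C * (n ^ 3 * max m 1)) D := by
  -- The required lower bound for `B` is itself written as an expression in `n` and `m`, so
  -- `small_of_lt` bounds it by a fixed power of `n + m + 1`.
  set E : RAMExp := .add (.mul (.const 3) sizeExp) (.add (.mul (.const 2) (.reg 0))
    (.add (.reg 1) (.const (w + 5)))) with hE
  have hbelow : E.Below 2 := by simp [hE, Below, sizeExp]
  set T := storeListTime blockExps + assignListTime advance + 1 with hT
  -- The summands cover the work outside the loop, the time for the blocks and the number of nodes;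
  -- for `n = 0` there are no blocks, so `autTime w 0 0` has no loop rounds.
  set C := autTime w 0 0 + 24 * T + (1 + 24 * numControls) with hC
  have hpos : ∀ {n : ℕ} (m : ℕ), 1 ≤ n → 1 ≤ n ^ 3 * max m 1 := fun m hn =>
    Nat.mul_pos (Nat.pow_pos hn) (by omega)
  -- The exponents multiply: register values lie below `B = (n + m + 1) ^ E.cost`, and values of
  -- expressions below `B ^ autCost w`.
  refine ⟨autProg w, C, E.cost * autCost w, fun n m hn =>
    ⟨autBDD n w m hn, autBDD_represents hn w m, ?_, ?_⟩⟩
  · calc numNodes n m = 1 + numBlocks n m * numControls := numNodes_eq n m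
      _ ≤ n ^ 3 * max m 1 + 24 * (n ^ 3 * max m 1) * numControls := by
        exact Nat.add_le_add (hpos m hn) (Nat.mul_le_mul_right _ (numBlocks_le hn m))
      _ = (1 + 24 * numControls) * (n ^ 3 * max m 1) := by ring
      _ ≤ C * (n ^ 3 * max m 1) := Nat.mul_le_mul_right _ (Nat.le_add_left _ _)
  · have htime : autTime w n m ≤ C * (n ^ 3 * max m 1) :=
      calc autTime w n m = autTime w 0 0 * 1 + numBlocks n m * T := by
            simp only [autTime, hT, numBlocks]
            ring
        _ ≤ autTime w 0 0 * (n ^ 3 * max m 1) + 24 * (n ^ 3 * max m 1) * T := by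
          exact Nat.add_le_add (Nat.mul_le_mul_left _ (hpos m hn))
            (Nat.mul_le_mul_right _ (numBlocks_le hn m))
        _ = (autTime w 0 0 + 24 * T) * (n ^ 3 * max m 1) := by ring
        _ ≤ C * (n ^ 3 * max m 1) := Nat.mul_le_mul_right _ (Nat.le_add_right _ _)
    have hE' := (small_of_lt (B := n + m + 1) (d := 2) (ρ := rootRegs n w m) (by omega)
      (fun r hr => by interval_cases r <;> simp only [rootRegs] <;> omega) hbelow).eval_lt
    have hB : 3 * numNodes n m + 2 * n + m + w + 5 < (n + m + 1) ^ E.cost := by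
      refine lt_of_eq_of_lt ?_ hE'
      simp only [hE, eval, eval_sizeExp, rootRegs]
      ring
    obtain ⟨t, σ, hx, ht, hσ⟩ := autProg_constructs (W := (n + m + 1) ^ (E.cost * autCost w)) hn hB
      fun e he => by
        rw [pow_mul]
        exact Nat.pow_le_pow_right (by positivity) (cost_le_autCost he)
    exact ⟨t, σ, hx, ht.trans htime, hσ⟩

end RAMProg

theorem mainTheorem4 :
    -- canonical representations: one for each isomorphism class
    (∀ (n : ℕ) (G : SimpleGraph (Fin n)), 1 ≤ n → IsConnBipPerm G →
      (∃ s, IsCanonicalRep G s) ∧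
      ∀ (H : SimpleGraph (Fin n)) (s s' : List Letter), IsConnBipPerm H →
        IsCanonicalRep G s → IsCanonicalRep H s' → (s = s' ↔ Nonempty (G ≃g H))) ∧
    -- the number of edges is half the sum of the heights at even positions
    (∀ (n : ℕ) (G : SimpleGraph (Fin n)) (P : PermDiagram (Fin n) n), 1 ≤ n →
      IsConnBipPerm G → P.IsDiagramOf G →
      ∑ i ∈ Finset.Icc 1 n, heightAt P.str (2 * i) = 2 * (G.edgeSet.ncard : ℤ)) ∧
    -- `n` vertices
    (∃ (p : RAMProg) (C c : ℕ), ∀ n : ℕ, 1 ≤ n →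
      ∃ D : BDD (2 * n),
        D.Represents {G | IsConnBipPerm G} ∧
        D.size ≤ C * n ^ 3 ∧
        p.Constructs ((n + 1) ^ c) n 0 (C * n ^ 3) D) ∧
    -- `n` vertices and `m` edges
    (∃ (p : RAMProg) (C c : ℕ), ∀ n m : ℕ, 1 ≤ n →
      ∃ D : BDD (2 * n),
        D.Represents {G | IsConnBipPerm G ∧ G.edgeSet.ncard = m} ∧
        D.size ≤ C * (n ^ 3 * max m 1) ∧
        p.Constructs ((n + m + 1) ^ c) n m (C * (n ^ 3 * max m 1)) D) := by
  refine ⟨fun n G _ hG => ⟨?_, fun H s s' hH hs hs' => ?_⟩, fun n G P _ hG hP => ?_, ?_, ?_⟩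
  · obtain ⟨P, hP⟩ := hG.2.2
    obtain ⟨Q, hQ, hc⟩ := PermDiagram.exists_canonical hP
    exact ⟨Q.str, Q, hQ, hc, rfl⟩
  · exact PermDiagram.iso_invariance G H hG hH hs hs'
  · exact PermDiagram.IsDiagramOf.sum_heightAt hG hP
  -- With weight zero and `m = 0` the edge condition is empty and the factor `max m 1` is one.
  · obtain ⟨p, C, c, h⟩ := RAMProg.exists_autBDD 0
    refine ⟨p, C, c, fun n hn => ?_⟩
    simpa using h n 0 hn
  · obtain ⟨p, C, c, h⟩ := RAMProg.exists_autBDD 1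
    refine ⟨p, C, c, fun n m hn => ?_⟩
    simpa only [one_mul] using h n m hn
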